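/- Let $p\ge 1$ be an integer and $(a_n)_{n\ge0}$ a sequence of real (or complex) numbers. With $\Delta s_n=s_{n+1}-s_n$, say that a sequence $(s_n)_{n\ge 0}$ satisfies condition (H) if there is $M>0$ with $$(n+1)\sum_{i=0}^n\binom{n}{i}^2\bigl|\Delta^i s_{n-i}\bigr|^2<M\qquad(n=0,1,2,\dots).$$ Suppose that both $(a_n)_{n\ge0}$ and $(n^pa_n)_{n\ge0}$ satisfy (H). Let $H^2(\mathbb{C}_{-1/2})$ be the Hardy space of functions $A$ holomorphic in $\operatorname{Re}\lambda>-1/2$ with $\sup_{\sigma>-1/2}\int_{-\infty}^{\infty}|A(\sigma+i\nu)|^2\,d\nu<\infty$; for such $A$, $A(-\tfrac12+i\,\cdot)$ denotes the boundary value, i.e. the limit of $A(\sigma+i\,\cdot)$ in $L^2(\mathbb{R})$ as $\sigma\downarrow-\tfrac12$. Then there is a unique $\tilde a\in H^2(\mathbb{C}_{-1/2})$ with $\tilde a(n)=a_n$ for all $n\ge0$ (the Carlsonian interpolation of the $a_n$), and the following hold. (1') The series $\frac1{2\pi}\sum_{n\ge0}a_nz^n$ converges uniformly in the unit disk $|z|<1$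 to an analytic function $f$. (2') $f$ extends to a function, still denoted $f$, that is holomorphic in the cut plane $\mathbb{C}\setminus[1,+\infty)$ and continuous on $\mathbb{C}\setminus(1,+\infty)$. (3') For every $x>1$ the limits $f_\pm(x)=\lim_{\epsilon\downarrow0}f(x\pm i\epsilon)$ exist; the jump function $F(x)=-i\,(f_+(x)-f_-(x))$ is of class $C^{p-1}$ on $(1,+\infty)$; and for every $\sigma\ge-\tfrac12$ the function $\nu\mapsto\tilde a(\sigma+i\nu)$ is integrable and $$|F(x)|\le\|\tilde a_\sigma\|_1\,x^\sigma\quad(x>1),\qquad \|\tilde a_\sigma\|_1=\frac1{2\pi}\int_{-\infty}^{+\infty}|\tilde a(\sigma+i\nu)|\,d\nu .$$ (4') For all $\sigma>-\tfrac12$ and $\nu\in\mathbb{R}$, $\tilde a$ is the Mellin transform of $F$, the integral being absolutely convergent: $$\tilde a(\sigma+i\nu)=\int_1^{+\infty}F(x)\,x^{-(\sigma+i\nu)-1}\,dx .$$ (5') For all $\sigma\ge-\tfrac12$, with both integrals finite, $$\int_{-\infty}^{+\infty}|\tilde a(\sigma+i\nu)|^2\,d\nu=2\pi\int_1^{+\infty}|F(x)|^2x^{-2\sigma-1}\,dx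 .$$ -/

import Mathlib

open Filter Topology MeasureTheory

/-- The `L²` Hausdorff condition on a sequence `s`: there is `M > 0` with
`(n + 1) ∑_{i ≤ n} (n choose i)² |Δ^i s_{n-i}|² < M` for all `n`, where `Δ s_n = s_{n+1} - s_n`
is the forward difference. -/
def HausdorffL2 (s : ℕ → ℂ) : Prop :=
  ∃ M : ℝ, 0 < M ∧ ∀ n : ℕ,
    ((n : ℝ) + 1) * ∑ i ∈ Finset.range (n + 1),
      ((n.choose i : ℝ)) ^ 2 * ‖((fwdDiff (1 : ℕ))^[i] s) (n - i)‖ ^ 2 < M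

/-- The restriction `ν ↦ A (σ + i ν)` of `A` to the vertical line `Re = σ`. -/
noncomputable def onLine (A : ℂ → ℂ) (σ : ℝ) (ν : ℝ) : ℂ :=
  A ((σ : ℂ) + (ν : ℂ) * Complex.I)

/-- The open half-plane `Re z > -1/2`. -/
def halfPlane : Set ℂ := {z : ℂ | -(1 / 2 : ℝ) < z.re}

/-- The Hardy space `H²` of the half-plane `Re z > -1/2`. As usual, an element is also regarded as
a function on the boundary line `Re z = -1/2`: its values there are the `L²` boundary values,
i.e. the limit of `A (σ + i ·)` in `L²(ℝ)` as `σ ↓ -1/2` (this fixes them almost everywhere). -/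
structure MemHardyH2 (A : ℂ → ℂ) : Prop where
  holomorphic : DifferentiableOn ℂ A halfPlane
  bounded : ∃ C : NNReal, ∀ σ : ℝ, -(1 / 2 : ℝ) < σ → eLpNorm (onLine A σ) 2 volume ≤ C
  boundary_memLp : MemLp (onLine A (-(1 / 2 : ℝ))) 2 volume
  boundary_limit :
    Tendsto (fun σ : ℝ => eLpNorm (onLine A σ - onLine A (-(1 / 2 : ℝ))) 2 volume)
      (𝓝[>] (-(1 / 2 : ℝ))) (𝓝 0)

/-- `A` is the Carlsonian interpolation of the sequence `a`: it lies in `H²(Re z > -1/2)` and takes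
the value `a n` at each integer `n ≥ 0`. -/
structure IsCarlsonInterpolation (a : ℕ → ℂ) (A : ℂ → ℂ) : Prop where
  memHardy : MemHardyH2 A
  interpolates : ∀ n : ℕ, A (n : ℂ) = a n

/-- The normalized `L¹` norm `(1 / 2π) ∫ |A (σ + i ν)| dν` on the line `Re = σ`. -/
noncomputable def lineNormL1 (A : ℂ → ℂ) (σ : ℝ) : ℝ :=
  1 / (2 * Real.pi) * ∫ ν : ℝ, ‖onLine A σ ν‖

/-- `F` is the jump function of `f` across the cut `(1, ∞)`: for every `x > 1` the one-sided limits
`f₊(x) = lim_{ε ↓ 0} f (x + i ε)` and `f₋(x) = lim_{ε ↓ 0} f (x - i ε)` exist, and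
`F x = -i (f₊(x) - f₋(x))`. -/
def IsJumpFunction (f : ℂ → ℂ) (F : ℝ → ℂ) : Prop :=
  ∀ x : ℝ, 1 < x → ∃ fplus fminus : ℂ,
    Tendsto (fun ε : ℝ => f ((x : ℂ) + (ε : ℂ) * Complex.I)) (𝓝[>] 0) (𝓝 fplus) ∧
    Tendsto (fun ε : ℝ => f ((x : ℂ) - (ε : ℂ) * Complex.I)) (𝓝[>] 0) (𝓝 fminus) ∧
    F x = -Complex.I * (fplus - fminus)

/-! Condition (H) is the solvability condition of the Hausdorff moment problem in L²(0,1). Step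
functions built from the differences of the sequence are bounded in L² and have almost the right
moments, so a weak limit u satisfies ∫₀¹ tⁿ u(t) dt = a_n (`HausdorffL2.exists_moments`). The
interpolation is then ∫₀¹ t^z u(t) dt. After t = e^(-v) it is a Fourier transform on every vertical
line, so Plancherel places it in H² and produces its boundary values. Uniqueness is a theorem of
Carlson type: an element of H² is bounded on Re z ≥ 0, and a bounded function vanishing at all
positive integers is zero, because the Blaschke products diverge to 0.

Let w be the density with moments n^p a_n. The same uniqueness argument shows that the transform of
w is z^p times that of u. The Hardy average t⁻¹∫ₜ¹ w divides a transform by z. It preserves L² when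
w has mean zero (Hardy's inequality), and it gains one derivative. Applying it p - 1 times to w
gives a density v whose transform is z times that of u and whose primitive T(t) = ∫ₜ¹ v is C^(p-1)
(`exists_hardyAverage_ladder`). One more average, T(t)/t, again represents a_n.

Since v has moments n a_n, summing the power series gives f(z) = (a_0 - ∫₀¹ v(t) log(1 - tz) dt) /
2π, which is holomorphic off the cut. Crossing the cut at x > 1 changes the logarithm by 2πi exactly
for t > 1/x, so the jump function is F(x) = T(1/x). The Mellin and Plancherel formulas follow from x
= 1/t. Having the interpolation and z times it both in L² on a line makes the interpolation
integrable there, and Fourier inversion then bounds F. -/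

/-! ### Uniqueness of Carlson type through Blaschke factors -/

theorem isOpen_halfPlane : IsOpen halfPlane := by
  unfold halfPlane
  exact isOpen_lt continuous_const Complex.continuous_re

theorem isPreconnected_halfPlane : IsPreconnected halfPlane := by
  unfold halfPlane
  exact (convex_halfSpace_re_gt _).isPreconnected

/-- The factor (z - k)/(z + k) has modulus 1 on the imaginary axis, so the quotient is still bounded
by M there. Phragmén–Lindelöf carries the same M to the right half-plane, with no loss in the
constant. -/
theorem exists_blaschke_quotient {g : ℂ → ℂ} (hg : DifferentiableOn ℂ g halfPlane) {M : ℝ}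
    (hM : ∀ z : ℂ, 0 ≤ z.re → ‖g z‖ ≤ M) {k : ℝ} (hk : 0 < k) (h0 : g k = 0) :
    ∃ h : ℂ → ℂ, DifferentiableOn ℂ h halfPlane ∧ (∀ z : ℂ, 0 ≤ z.re → ‖h z‖ ≤ M) ∧
      ∀ z : ℂ, g z * (z + k) = h z * (z - k) := by
  have hkm : (k : ℂ) ∈ halfPlane := by simp [halfPlane]; linarith
  have heq : ∀ z : ℂ, g z * (z + k) = (dslope g k z * (z + k)) * (z - k) := by
    intro z
    have := sub_smul_dslope g (k : ℂ) z
    rw [h0, sub_zero, smul_eq_mul] at this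
    rw [← this]; ring
  have hd : DifferentiableOn ℂ (fun z => dslope g k z * (z + k)) halfPlane :=
    ((Complex.differentiableOn_dslope (isOpen_halfPlane.mem_nhds hkm)).2 hg).mul (by fun_prop)
  have hcl : closure {z : ℂ | 0 < z.re} ⊆ halfPlane := by
    intro z hz
    have : z ∈ {z : ℂ | 0 ≤ z.re} :=
      closure_minimal (t := {z : ℂ | 0 ≤ z.re})
        (by intro w hw; simp only [Set.mem_ofPred_eq] at hw ⊢; exact hw.le) (isClosed_le continuous_const Complex.continuous_re) hz
    have : 0 ≤ z.re := this
    simp only [halfPlane, Set.mem_ofPred_eq]; linarith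
  have hM0 : 0 ≤ M := (norm_nonneg _).trans (hM 0 (by simp))
  -- If |z| ≥ 2k then |z + k| ≤ 3|z - k|. The crude bound 3M serves only the growth hypotheses of
  -- Phragmén–Lindelöf.
  have hfar : ∀ z : ℂ, 0 ≤ z.re → 2 * k ≤ ‖z‖ → ‖dslope g k z * (z + k)‖ ≤ 3 * M := by
    intro z hz hzk
    have h1 : ‖z‖ - k ≤ ‖z - k‖ := by
      have := norm_sub_norm_le z (k : ℂ)
      rwa [Complex.norm_real, Real.norm_of_nonneg hk.le] at this
    have h2 : ‖z + k‖ ≤ ‖z‖ + k := by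
      have := norm_add_le z (k : ℂ)
      rwa [Complex.norm_real, Real.norm_of_nonneg hk.le] at this
    have h3 := congrArg norm (heq z)
    rw [norm_mul, norm_mul _ (z - k)] at h3
    have h4 : 0 < ‖z - k‖ := by linarith
    have h5 : ‖z + k‖ ≤ 3 * ‖z - k‖ := by linarith
    refine le_of_mul_le_mul_right ?_ h4
    rw [← h3]
    calc ‖g z‖ * ‖z + k‖ ≤ M * (3 * ‖z - k‖) := by
          gcongr
          exact hM z hz
      _ = _ := by ring
  refine ⟨fun z => dslope g k z * (z + k), hd, ?_, heq⟩
  intro z hz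
  refine PhragmenLindelof.right_half_plane_of_bounded_on_real (C := M)
    (f := fun z => dslope g k z * (z + k)) (hd.mono hcl).diffContOnCl ⟨1, by norm_num, 0, ?_⟩ ?_ ?_ hz
  · refine Asymptotics.IsBigO.of_bound (3 * M) ?_
    rw [eventually_inf_principal]
    have : ∀ᶠ z : ℂ in Bornology.cobounded ℂ, 2 * k ≤ ‖z‖ :=
      tendsto_norm_cobounded_atTop.eventually_ge_atTop _
    filter_upwards [this] with z hz1 hz2
    simpa using hfar z (le_of_lt hz2) hz1
  · refine ⟨3 * M, ?_⟩
    rw [eventually_map]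
    filter_upwards [eventually_ge_atTop (2 * k)] with x hx
    refine hfar x ?_ ?_
    · simp; linarith
    · rw [Complex.norm_real, Real.norm_of_nonneg (by linarith)]; exact hx
  · intro x
    have h3 := congrArg norm (heq (x * Complex.I))
    rw [norm_mul, norm_mul _ ((x : ℂ) * Complex.I - k)] at h3
    have e : ‖(x : ℂ) * Complex.I - k‖ = ‖(x : ℂ) * Complex.I + k‖ := by
      rw [← norm_neg, ← Complex.norm_conj]
      simp
      ring_nf
    have h4 : 0 < ‖(x : ℂ) * Complex.I + k‖ := by
      rw [norm_pos_iff]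
      intro h
      have := congrArg Complex.re h
      simp at this
      linarith
    rw [e] at h3
    have := mul_right_cancel₀ h4.ne' h3
    rw [← this]
    exact hM _ (by simp)

theorem exists_blaschke_quotient_range {g : ℂ → ℂ} (hg : DifferentiableOn ℂ g halfPlane) {M : ℝ}
    (hM : ∀ z : ℂ, 0 ≤ z.re → ‖g z‖ ≤ M) (h0 : ∀ n : ℕ, g (n + 1) = 0) (N : ℕ) :
    ∃ h : ℂ → ℂ, DifferentiableOn ℂ h halfPlane ∧ (∀ z : ℂ, 0 ≤ z.re → ‖h z‖ ≤ M) ∧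
      ∀ z : ℂ, g z * ∏ k ∈ Finset.range N, (z + (k + 1)) =
        h z * ∏ k ∈ Finset.range N, (z - (k + 1)) := by
  induction N with
  | zero => exact ⟨g, hg, hM, by simp⟩
  | succ N ih =>
    obtain ⟨h, h1, h2, h3⟩ := ih
    have hN : h ((N + 1 : ℝ) : ℂ) = 0 := by
      have := h3 (N + 1)
      rw [h0 N, zero_mul] at this
      have hp : ∏ k ∈ Finset.range N, ((N : ℂ) + 1 - (k + 1)) ≠ 0 := by
        rw [Finset.prod_ne_zero_iff]
        intro k hk
        have hk' := Finset.mem_range.1 hk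
        intro h
        have : (N : ℂ) = k := by linear_combination h
        have : N = k := by exact_mod_cast this
        omega
      push_cast
      exact (mul_eq_zero.1 this.symm).resolve_right hp
    obtain ⟨q, q1, q2, q3⟩ := exists_blaschke_quotient h1 h2 (k := (N + 1 : ℝ)) (by positivity) hN
    refine ⟨q, q1, q2, fun z => ?_⟩
    rw [Finset.prod_range_succ, Finset.prod_range_succ]
    have := q3 z
    push_cast at this
    linear_combination (z + (N + 1)) * h3 z + (∏ k ∈ Finset.range N, (z - (k + 1))) * this

/-- Each factor is 1 - 2x/(k+1+x) ≤ exp(-x/(k+1)), and the harmonic series diverges. -/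
theorem tendsto_prod_blaschke {x : ℝ} (hx0 : 0 < x) (hx1 : x < 1) :
    Tendsto (fun N : ℕ => ∏ k ∈ Finset.range N, ((k + 1 - x) / (k + 1 + x))) atTop (𝓝 0) := by
  have h1 : ∀ N : ℕ, ∏ k ∈ Finset.range N, (((k : ℝ) + 1 - x) / (k + 1 + x)) ≤
      Real.exp (- x * ∑ k ∈ Finset.range N, 1 / ((k : ℝ) + 1)) := by
    intro N
    rw [Finset.mul_sum, Real.exp_sum]
    refine Finset.prod_le_prod (fun k _ => ?_) (fun k _ => ?_)
    · have : (0 : ℝ) ≤ k := k.cast_nonneg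
      exact div_nonneg (by linarith) (by linarith)
    · have hk : (0 : ℝ) ≤ k := k.cast_nonneg
      refine le_trans ?_ (Real.add_one_le_exp _)
      rw [div_le_iff₀ (by linarith)]
      field_simp
      nlinarith
  refine squeeze_zero (fun N => ?_) h1 ?_
  · refine Finset.prod_nonneg (fun k _ => ?_)
    have : (0 : ℝ) ≤ k := k.cast_nonneg
    exact div_nonneg (by linarith) (by linarith)
  · refine Real.tendsto_exp_atBot.comp ?_
    exact (Real.tendsto_sum_range_one_div_nat_succ_atTop).const_mul_atTop_of_neg (by linarith)

/-- Dividing out the first N zeros bounds |g(x)| by M times a Blaschke product that tends to 0, for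
every x in (0,1). The identity theorem does the rest. A zero at 0 itself is not needed. -/
theorem eqOn_zero_of_bounded_of_nat_zeros {g : ℂ → ℂ} (hg : DifferentiableOn ℂ g halfPlane) {M : ℝ}
    (hM : ∀ z : ℂ, 0 ≤ z.re → ‖g z‖ ≤ M) (h0 : ∀ n : ℕ, g (n + 1) = 0) :
    Set.EqOn g 0 halfPlane := by
  have hreal : ∀ x : ℝ, 0 < x → x < 1 → g x = 0 := by
    intro x hx0 hx1
    have hb : ∀ N : ℕ, ‖g x‖ ≤ M * ∏ k ∈ Finset.range N, ((k + 1 - x) / (k + 1 + x)) := by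
      intro N
      obtain ⟨h, -, h2, h3⟩ := exists_blaschke_quotient_range hg hM h0 N
      have h4 := congrArg norm (h3 x)
      rw [norm_mul, norm_mul, norm_prod, norm_prod] at h4
      have e1 : ∀ k : ℕ, ‖(x : ℂ) + (k + 1)‖ = k + 1 + x := by
        intro k
        rw [show (x : ℂ) + (k + 1) = ((k + 1 + x : ℝ) : ℂ) by push_cast; ring, Complex.norm_real,
          Real.norm_of_nonneg (by positivity)]
      have e2 : ∀ k : ℕ, ‖(x : ℂ) - (k + 1)‖ = k + 1 - x := by
        intro k
        have : (0 : ℝ) ≤ k := k.cast_nonneg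
        rw [norm_sub_rev, show (k + 1 : ℂ) - x = ((k + 1 - x : ℝ) : ℂ) by push_cast; ring,
          Complex.norm_real, Real.norm_of_nonneg (by linarith)]
      simp only [e1, e2] at h4
      rw [Finset.prod_div_distrib, ← mul_div_assoc, le_div_iff₀ (Finset.prod_pos fun k _ => by positivity), h4]
      refine mul_le_mul_of_nonneg_right (h2 x (by simpa using hx0.le)) (Finset.prod_nonneg fun k _ => ?_)
      have : (0 : ℝ) ≤ k := k.cast_nonneg
      linarith
    have := ge_of_tendsto' ((tendsto_prod_blaschke hx0 hx1).const_mul M) hb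
    rw [mul_zero] at this
    exact norm_le_zero_iff.1 this
  have hz : ((1 / 2 : ℝ) : ℂ) ∈ halfPlane := by
    simp only [halfPlane, Set.mem_ofPred_eq, Complex.ofReal_re]; norm_num
  refine (hg.analyticOnNhd isOpen_halfPlane).eqOn_zero_of_preconnected_of_frequently_eq_zero
    isPreconnected_halfPlane hz ?_
  have hmap : Tendsto (fun x : ℝ => (x : ℂ)) (𝓝[≠] (1 / 2)) (𝓝[≠] ((1 / 2 : ℝ) : ℂ)) := by
    refine tendsto_nhdsWithin_iff.2 ⟨(Complex.continuous_ofReal.tendsto _).mono_left nhdsWithin_le_nhds, ?_⟩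
    filter_upwards [self_mem_nhdsWithin] with x hx
    exact fun h => hx (Complex.ofReal_injective h)
  refine hmap.frequently (Eventually.frequently ?_)
  have : ∀ᶠ x : ℝ in 𝓝 (1 / 2), x ∈ Set.Ioo (0 : ℝ) 1 := Ioo_mem_nhds (by norm_num) (by norm_num)
  filter_upwards [nhdsWithin_le_nhds this] with x hx
  exact hreal x hx.1 hx.2

/-! ### Pointwise bounds in H² from the mean value property -/

theorem ofReal_mul_enorm_le_lintegral_circle {B : ℂ → ℂ} {c : ℂ} {R ρ : ℝ} (hρ : 0 < ρ) (hρR : ρ < R)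
    (hB : DifferentiableOn ℂ B (Metric.ball c R)) :
    ENNReal.ofReal (2 * Real.pi) * ‖B c‖ₑ ≤
      ∫⁻ θ in Set.Ioo (-Real.pi) Real.pi, ‖B (circleMap c ρ θ)‖ₑ := by
  have hsub : Metric.closedBall c ρ ⊆ Metric.ball c R := Metric.closedBall_subset_ball hρR
  have h1 : Real.circleAverage B c ρ = B c := by
    refine DiffContOnCl.circleAverage ?_
    rw [abs_of_pos hρ]
    exact (hB.mono (Metric.closure_ball_subset_closedBall.trans hsub)).diffContOnCl
  have h2 : (2 * Real.pi : ℝ) • B c = ∫ θ in (-Real.pi)..Real.pi, B (circleMap c ρ θ) := by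
    have hp : Function.Periodic (fun θ => B (circleMap c ρ θ)) (2 * Real.pi) := by
      intro θ
      simp only [(periodic_circleMap c ρ) θ]
    have := hp.intervalIntegral_add_eq (-Real.pi) 0
    rw [show -Real.pi + 2 * Real.pi = Real.pi by ring, zero_add] at this
    rw [this, ← h1, Real.circleAverage, smul_smul, mul_inv_cancel₀ (by positivity), one_smul]
  rw [← Real.enorm_of_nonneg (by positivity), ← enorm_smul, h2,
    intervalIntegral.integral_of_le (by linarith [Real.pi_pos]), integral_Ioc_eq_integral_Ioo]
  exact enorm_integral_le_lintegral_enorm _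

theorem mul_enorm_le_lintegral_ball {B : ℂ → ℂ} {c : ℂ} {R r : ℝ} (hr : 0 < r) (hrR : r < R)
    (hB : DifferentiableOn ℂ B (Metric.ball c R)) :
    ENNReal.ofReal (Real.pi * r ^ 2) * ‖B c‖ₑ ≤ ∫⁻ z in Metric.ball c r, ‖B z‖ₑ := by
  -- Nothing is known of B away from the ball, so the indicator supplies the measurability on the
  -- whole plane that Tonelli needs.
  have hmeas : Measurable ((Metric.ball c r).indicator (fun z => ‖B z‖ₑ)) := by
    classical
    rw [← Set.piecewise_eq_indicator]
    refine ContinuousOn.measurable_piecewise ?_ continuousOn_const measurableSet_ball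
    exact (hB.continuousOn.mono (Metric.ball_subset_ball hrR.le)).enorm
  rw [← lintegral_indicator measurableSet_ball]
  set f := (Metric.ball c r).indicator (fun z => ‖B z‖ₑ) with hf
  rw [← lintegral_add_left_eq_self f c, ← Complex.lintegral_comp_polarCoord_symm]
  have hsub : Set.Ioo 0 r ×ˢ Set.Ioo (-Real.pi) Real.pi ⊆ polarCoord.target := by
    rw [polarCoord_target]
    exact Set.prod_mono (fun x hx => hx.1) subset_rfl
  refine le_trans ?_ (lintegral_mono_set hsub)
  rw [Measure.volume_eq_prod, ← Measure.prod_restrict, lintegral_prod _ (by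
    refine Measurable.aemeasurable ?_
    refine Measurable.mul (by fun_prop) (hmeas.comp ?_)
    simp only [Complex.polarCoord_symm_apply]
    fun_prop)]
  have key : ∀ ρ ∈ Set.Ioo 0 r, ENNReal.ofReal (2 * Real.pi * ρ) * ‖B c‖ₑ ≤
      ∫⁻ θ in Set.Ioo (-Real.pi) Real.pi,
        ENNReal.ofReal (ρ, θ).1 • f (c + Complex.polarCoord.symm (ρ, θ)) := by
    intro ρ hρ
    have e : ∀ θ, c + Complex.polarCoord.symm (ρ, θ) = circleMap c ρ θ := by
      intro θ
      rw [Complex.polarCoord_symm_apply, circleMap, Complex.exp_mul_I]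
      simp
    have e2 : ∀ θ, f (circleMap c ρ θ) = ‖B (circleMap c ρ θ)‖ₑ := by
      intro θ
      rw [hf, Set.indicator_of_mem]
      rw [Metric.mem_ball, dist_eq_norm, circleMap_sub_center, norm_circleMap_zero, abs_of_pos hρ.1]
      exact hρ.2
    simp only [e, e2, smul_eq_mul]
    rw [lintegral_const_mul' _ _ ENNReal.ofReal_ne_top, mul_comm (2 * Real.pi),
      ENNReal.ofReal_mul hρ.1.le, mul_assoc]
    gcongr
    exact ofReal_mul_enorm_le_lintegral_circle hρ.1 (hρ.2.trans hrR) hB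
  calc ENNReal.ofReal (Real.pi * r ^ 2) * ‖B c‖ₑ
      = ∫⁻ ρ in Set.Ioo 0 r, ENNReal.ofReal (2 * Real.pi * ρ) * ‖B c‖ₑ := by
        rw [lintegral_mul_const' _ _ (by simp)]
        congr 1
        rw [← ofReal_integral_eq_lintegral_ofReal, ← integral_Ioc_eq_integral_Ioo,
          ← intervalIntegral.integral_of_le hr.le, intervalIntegral.integral_const_mul, integral_id]
        · congr 1; ring
        · exact (Continuous.integrableOn_Icc (by fun_prop)).mono_set Set.Ioo_subset_Icc_self
        · filter_upwards [ae_restrict_mem measurableSet_Ioo] with ρ hρ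
          have := hρ.1
          simp only [Pi.zero_apply]; positivity
    _ ≤ _ := by
        refine setLIntegral_mono' measurableSet_Ioo ?_
        exact key

/-- A disc of radius 1/4 centred in Re z ≥ 0 stays inside Re z > -1/2. Cauchy–Schwarz bounds the L¹
norm on each vertical slice by the H² bound, integrating over the slices bounds the area mean, and
that mean dominates |B| at the centre. -/
theorem MemHardyH2.exists_bound {B : ℂ → ℂ} (hB : MemHardyH2 B) :
    ∃ M : ℝ, ∀ z : ℂ, 0 ≤ z.re → ‖B z‖ ≤ M := by
  obtain ⟨C, hC⟩ := hB.bounded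
  have hline : ∀ σ : ℝ, -(1 / 2) < σ → ∀ y : ℝ,
      ∫⁻ ν in Set.Ioo (y - 1 / 4) (y + 1 / 4), ‖onLine B σ ν‖ₑ ≤ C := by
    intro σ hσ y
    have hc : Continuous (onLine B σ) := by
      refine hB.holomorphic.continuousOn.comp_continuous (by fun_prop) (fun ν => ?_)
      simpa [halfPlane] using hσ
    have h1 := eLpNorm_le_eLpNorm_mul_rpow_measure_univ (p := 1) (q := 2)
      (μ := volume.restrict (Set.Ioo (y - 1 / 4) (y + 1 / 4))) (by norm_num)
      hc.aestronglyMeasurable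
    rw [eLpNorm_one_eq_lintegral_enorm] at h1
    refine h1.trans ?_
    calc _ ≤ (C : ENNReal) * 1 := by
          gcongr
          · exact (eLpNorm_mono_measure _ Measure.restrict_le_self).trans (hC σ hσ)
          · refine ENNReal.rpow_le_one ?_ (by norm_num)
            rw [Measure.restrict_apply_univ, Real.volume_Ioo,
              show y + 1 / 4 - (y - 1 / 4) = 1 / 2 by ring]
            exact ENNReal.ofReal_le_one.2 (by norm_num)
      _ = C := mul_one _
  have hball : ∀ z : ℂ, 0 ≤ z.re → ∫⁻ w in Metric.ball z (1 / 4), ‖B w‖ₑ ≤ C := by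
    intro z hz
    have hsubm : Metric.ball z (1 / 4) ⊆ halfPlane := by
      intro w hw
      have h1 : |(w - z).re| ≤ ‖w - z‖ := Complex.abs_re_le_norm _
      rw [Metric.mem_ball, dist_eq_norm] at hw
      have := (abs_lt.1 (h1.trans_lt hw)).1
      simp only [Complex.sub_re] at this
      simp only [halfPlane, Set.mem_ofPred_eq]; linarith
    have hmeas : Measurable ((Metric.ball z (1 / 4)).indicator (fun z => ‖B z‖ₑ)) := by
      classical
      rw [← Set.piecewise_eq_indicator]
      refine ContinuousOn.measurable_piecewise ?_ continuousOn_const measurableSet_ball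
      exact (hB.holomorphic.continuousOn.mono hsubm).enorm
    have hmeas2 : Measurable (fun p : ℝ × ℝ => (Metric.ball z (1 / 4)).indicator (fun z => ‖B z‖ₑ)
        (Complex.measurableEquivRealProd.symm p)) := hmeas.comp (MeasurableEquiv.measurable _)
    rw [← lintegral_indicator measurableSet_ball,
      ← (Complex.volume_preserving_equiv_real_prod.symm).lintegral_comp hmeas,
      Measure.volume_eq_prod, lintegral_prod _ hmeas2.aemeasurable]
    calc _ ≤ ∫⁻ x : ℝ, (Set.Ioo (z.re - 1 / 4) (z.re + 1 / 4)).indicator (fun _ => (C : ENNReal)) x := by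
          refine lintegral_mono (fun x => ?_)
          have hmem : ∀ y : ℝ, Complex.measurableEquivRealProd.symm (x, y) ∈ Metric.ball z (1 / 4) →
              x ∈ Set.Ioo (z.re - 1 / 4) (z.re + 1 / 4) ∧ y ∈ Set.Ioo (z.im - 1 / 4) (z.im + 1 / 4) := by
            intro y hy
            rw [Metric.mem_ball, dist_eq_norm] at hy
            have h1 := abs_lt.1 ((Complex.abs_re_le_norm _).trans_lt hy)
            have h2 := abs_lt.1 ((Complex.abs_im_le_norm _).trans_lt hy)
            simp at h1 h2
            exact ⟨⟨by linarith, by linarith⟩, ⟨by linarith, by linarith⟩⟩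
          by_cases hx : x ∈ Set.Ioo (z.re - 1 / 4) (z.re + 1 / 4)
          · rw [Set.indicator_of_mem hx]
            refine le_trans ?_ (hline x (by linarith [hx.1]) z.im)
            rw [← lintegral_indicator measurableSet_Ioo]
            refine lintegral_mono (fun y => ?_)
            by_cases hy : Complex.measurableEquivRealProd.symm (x, y) ∈ Metric.ball z (1 / 4)
            · rw [Set.indicator_of_mem (hmem y hy).2, Set.indicator_of_mem hy]
              refine le_of_eq (congrArg (fun w => ‖B w‖ₑ) ?_)
              apply Complex.ext <;> simp
            · rw [Set.indicator_of_notMem hy]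
              exact zero_le
          · rw [Set.indicator_of_notMem hx]
            have : ∀ y : ℝ, (Metric.ball z (1 / 4)).indicator (fun z => ‖B z‖ₑ)
                (Complex.measurableEquivRealProd.symm (x, y)) = 0 :=
              fun y => Set.indicator_of_notMem (fun h => hx (hmem y h).1) _
            simp only [this, lintegral_zero, le_refl]
      _ ≤ C := by
          rw [lintegral_indicator_const measurableSet_Ioo]
          rw [Real.volume_Ioo, show z.re + 1 / 4 - (z.re - 1 / 4) = 1 / 2 by ring]
          exact mul_le_of_le_one_right' (ENNReal.ofReal_le_one.2 (by norm_num))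
  refine ⟨(C : ℝ) / (Real.pi * (1 / 4) ^ 2), fun z hz => ?_⟩
  have hd : DifferentiableOn ℂ B (Metric.ball z (1 / 2)) := by
    refine hB.holomorphic.mono ?_
    intro w hw
    have h1 : |(w - z).re| ≤ ‖w - z‖ := Complex.abs_re_le_norm _
    rw [Metric.mem_ball, dist_eq_norm] at hw
    have := (abs_lt.1 (h1.trans_lt hw)).1
    simp only [Complex.sub_re] at this
    simp only [halfPlane, Set.mem_ofPred_eq]; linarith
  have h := (mul_enorm_le_lintegral_ball (r := 1 / 4) (by norm_num) (by norm_num) hd).trans (hball z hz)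
  rw [← ofReal_norm, ← ENNReal.ofReal_mul (by positivity), ← ENNReal.ofReal_coe_nnreal,
    ENNReal.ofReal_le_ofReal_iff C.coe_nonneg] at h
  rw [le_div_iff₀ (by positivity)]
  linarith

theorem MemHardyH2.eqOn_of_nat {A B : ℂ → ℂ} (hA : MemHardyH2 A) (hB : MemHardyH2 B)
    (h : ∀ n : ℕ, B n = A n) : Set.EqOn B A halfPlane := by
  obtain ⟨M, hM⟩ := hA.exists_bound
  obtain ⟨N, hN⟩ := hB.exists_bound
  have := eqOn_zero_of_bounded_of_nat_zeros (g := fun z => B z - A z) (M := N + M)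
    (hB.holomorphic.sub hA.holomorphic)
    (fun z hz => (norm_sub_le _ _).trans (add_le_add (hN z hz) (hM z hz)))
    (fun n => by have := h (n + 1); push_cast at this; rw [this, sub_self])
  intro z hz
  exact sub_eq_zero.1 (this hz)

/-! ### The L² Fourier transform against the Fourier integral -/

section

open scoped FourierTransform SchwartzMap

/-- Smooth compactly supported functions are Schwartz, and they already determine a locally
integrable function almost everywhere. -/
theorem Lp_fourier_ae_eq_of_integral {h : Lp ℂ 2 (volume : Measure ℝ)} {k : ℝ → ℂ} (hk : Continuous k)
    (H : ∀ φ : 𝓢(ℝ, ℂ), ∫ x, φ x * h x = ∫ x, φ x * k x) : (h : ℝ → ℂ) =ᵐ[volume] k := by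
  have hl : LocallyIntegrable (h : ℝ → ℂ) volume :=
    (Lp.memLp h).locallyIntegrable (by norm_num)
  refine ae_eq_of_integral_contDiff_smul_eq hl hk.locallyIntegrable ?_
  intro g hg hgc
  have hg₁ : HasCompactSupport (Complex.ofRealCLM ∘ g) := hgc.comp_left rfl
  have hg₂ := Complex.ofRealCLM.contDiff.comp hg
  have := H (hg₁.toSchwartzMap hg₂)
  simpa using this

/-- Both transforms can be moved onto a Schwartz test function: the L² one through tempered
distributions, the integral one through Fubini. -/
theorem fourier_toLp_ae_eq {g : ℝ → ℂ} (hg1 : Integrable g) (hg2 : MemLp g 2 volume) :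
    ((𝓕 (hg2.toLp g) : Lp ℂ 2 (volume : Measure ℝ)) : ℝ → ℂ) =ᵐ[volume] 𝓕 g := by
  apply Lp_fourier_ae_eq_of_integral
  · exact VectorFourier.fourierIntegral_continuous Real.continuous_fourierChar (by fun_prop) hg1
  intro φ
  have h1 := congrArg (fun T => T φ) (Lp.fourier_toTemperedDistribution_eq (hg2.toLp g))
  simp only [TemperedDistribution.fourier_apply, Lp.toTemperedDistribution_apply, smul_eq_mul] at h1
  rw [← h1]
  have h2 := VectorFourier.integral_fourierIntegral_smul_eq_flip (μ := volume) (ν := volume) (L := innerₗ ℝ) (e := Real.fourierChar) Real.continuous_fourierChar (by fun_prop) φ.integrable hg1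
  simp only [smul_eq_mul] at h2
  rw [flip_innerₗ] at h2
  refine Eq.trans ?_ h2
  refine integral_congr_ae ?_
  filter_upwards [hg2.coeFn_toLp] with x hx
  rw [hx]; rfl

theorem fourierInv_toLp_ae_eq {g : ℝ → ℂ} (hg1 : Integrable g) (hg2 : MemLp g 2 volume) :
    ((𝓕⁻ (hg2.toLp g) : Lp ℂ 2 (volume : Measure ℝ)) : ℝ → ℂ) =ᵐ[volume] 𝓕⁻ g := by
  apply Lp_fourier_ae_eq_of_integral
  · exact VectorFourier.fourierIntegral_continuous Real.continuous_fourierChar (by fun_prop) hg1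
  intro φ
  have h1 := congrArg (fun T => T φ) (Lp.fourierInv_toTemperedDistribution_eq (hg2.toLp g))
  simp only [TemperedDistribution.fourierInv_apply, Lp.toTemperedDistribution_apply, smul_eq_mul] at h1
  rw [← h1]
  have h2 := VectorFourier.integral_fourierIntegral_smul_eq_flip (μ := volume) (ν := volume) (L := -innerₗ ℝ) (e := Real.fourierChar) Real.continuous_fourierChar (by fun_prop) φ.integrable hg1
  simp only [smul_eq_mul] at h2
  rw [show (-innerₗ ℝ : ℝ →ₗ[ℝ] ℝ →ₗ[ℝ] ℝ).flip = -innerₗ ℝ by ext; simp] at h2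
  refine Eq.trans ?_ (h2.trans ?_)
  refine integral_congr_ae ?_
  filter_upwards [hg2.coeFn_toLp] with x hx
  rw [hx, SchwartzMap.fourierInv_coe]; rfl
  rfl

/-- An integrable transform makes L² inversion an honest integral, bounded by the L¹ norm. The bound
on the jump function comes from here. -/
theorem norm_le_of_integrable_fourier {h : Lp ℂ 2 (volume : Measure ℝ)} {k : ℝ → ℂ} (hk : Integrable k)
    (hhk : ((𝓕 h : Lp ℂ 2 (volume : Measure ℝ)) : ℝ → ℂ) =ᵐ[volume] k) :
    ∀ᵐ x, ‖h x‖ ≤ ∫ ξ, ‖k ξ‖ := by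
  have hk2 : MemLp k 2 volume := (memLp_congr_ae hhk).1 (Lp.memLp _)
  have e : 𝓕 h = hk2.toLp k := by
    apply Lp.ext
    exact hhk.trans hk2.coeFn_toLp.symm
  have : h = 𝓕⁻ (hk2.toLp k) := by rw [← e, FourierTransform.fourierInv_fourier_eq]
  rw [this]
  filter_upwards [fourierInv_toLp_ae_eq hk hk2] with x hx
  rw [hx]
  exact VectorFourier.norm_fourierIntegral_le_integral_norm _ _ _ _ _

end

/-! ### The Hausdorff moment problem in L²(0,1) -/

/-- With E the shift, E - Δ = 1; expand (E - Δ)^N by the binomial theorem and evaluate at 0. -/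
theorem sum_choose_mul_fwdDiff_iter (s : ℕ → ℂ) (N : ℕ) :
    ∑ i ∈ Finset.range (N + 1), (N.choose i : ℂ) * ((-1) ^ i * ((fwdDiff (1 : ℕ))^[i] s) (N - i)) = s 0 := by
  have h1 : (-fwdDiff_aux.fwdDiffₗ ℕ ℂ 1 + fwdDiff_aux.shiftₗ ℕ ℂ 1) ^ N = 1 := by
    rw [fwdDiff_aux.shiftₗ, neg_add_cancel_left, one_pow]
  have hc : Commute (-fwdDiff_aux.fwdDiffₗ ℕ ℂ 1) (fwdDiff_aux.shiftₗ ℕ ℂ 1) := by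
    rw [fwdDiff_aux.shiftₗ]
    exact ((Commute.refl _).add_right (Commute.one_right _)).neg_left
  rw [hc.add_pow] at h1
  have h2 := congrArg (fun T : Module.End ℤ (ℕ → ℂ) => T s 0) h1
  simp only [LinearMap.sum_apply, Finset.sum_apply, Module.End.one_apply] at h2
  rw [← h2]
  refine Finset.sum_congr rfl (fun i _ => ?_)
  have hs : Commute ((-fwdDiff_aux.fwdDiffₗ ℕ ℂ 1) ^ i) (fwdDiff_aux.shiftₗ ℕ ℂ 1 ^ (N - i)) :=
    hc.pow_pow _ _
  rw [hs.eq, (Nat.cast_commute (N.choose i) _).symm.eq, Module.End.mul_apply, Module.End.mul_apply,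
    neg_pow (fwdDiff_aux.fwdDiffₗ ℕ ℂ 1), Module.End.natCast_apply, Pi.smul_apply, fwdDiff_aux.shiftₗ_pow_apply,
    Module.End.mul_apply]
  have e : ∀ (j : ℕ) (g : ℕ → ℂ), ((-1 : Module.End ℤ (ℕ → ℂ)) ^ j) g = (-1 : ℂ) ^ j • g := by
    intro j g
    induction j generalizing g with
    | zero => simp
    | succ j ih =>
      rw [pow_succ, Module.End.mul_apply, ih, pow_succ]
      simp
  rw [e, ← fwdDiff_aux.coe_fwdDiffₗ_pow]
  simp

/-- The signed Hausdorff differences `C(n,k) (-1)^(n-k) Δ^(n-k) s_k`. -/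
noncomputable def hausdorffWeight (s : ℕ → ℂ) (n k : ℕ) : ℂ :=
  (n.choose k : ℂ) * ((-1) ^ (n - k) * ((fwdDiff (1 : ℕ))^[n - k] s) k)

/-- Terms with k < m vanish, and C(n,k) C(k,m) = C(n,m) C(n-m,k-m) reduces the rest to the previous
identity for the sequence shifted by m. The ratio C(k,m)/C(n,m) plays the role of (k/n)^m, so the
weights have almost the moments s m. -/
theorem sum_hausdorffWeight_mul_choose_div (s : ℕ → ℂ) {n m : ℕ} (hmn : m ≤ n) :
    ∑ k ∈ Finset.range (n + 1), hausdorffWeight s n k * ((k.choose m : ℂ) / n.choose m) = s m := by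
  obtain ⟨N, rfl⟩ := Nat.exists_eq_add_of_le hmn
  have h := sum_choose_mul_fwdDiff_iter (fun j => s (j + m)) N
  rw [zero_add] at h
  rw [← h, show m + N + 1 = m + (N + 1) by ring, Finset.sum_range_add]
  rw [Finset.sum_eq_zero, zero_add, ← Finset.sum_range_reflect]
  · refine Finset.sum_congr rfl (fun i hi => ?_)
    have hi : i ≤ N := Nat.lt_succ_iff.1 (Finset.mem_range.1 hi)
    rw [hausdorffWeight, fwdDiff_iter_comp_add, show N + 1 - 1 - i = N - i by omega,
      show m + N - (m + (N - i)) = i by omega, show m + (N - i) = N - i + m by omega]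
    have hc : (m + N).choose (N - i + m) * (N - i + m).choose m = (m + N).choose m * N.choose i := by
      rw [Nat.choose_mul, show m + N - m = N by omega,
        show N - i + m - m = N - i by omega, Nat.choose_symm hi]
      omega
    have hc' : ((m + N).choose (N - i + m) : ℂ) * (N - i + m).choose m =
        (m + N).choose m * N.choose i := by exact_mod_cast hc
    have h0 : ((m + N).choose m : ℂ) ≠ 0 := by
      exact_mod_cast (Nat.choose_pos (by omega)).ne'
    rw [← mul_div_assoc, div_eq_iff h0]
    linear_combination ((-1) ^ i * (fwdDiff 1)^[i] s (N - i + m)) * hc'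
  · intro k hk
    rw [Nat.choose_eq_zero_of_lt (Finset.mem_range.1 hk)]
    simp

theorem sum_norm_hausdorffWeight_sq (s : ℕ → ℂ) (n : ℕ) :
    ∑ k ∈ Finset.range (n + 1), ‖hausdorffWeight s n k‖ ^ 2 =
    ∑ i ∈ Finset.range (n + 1),
      ((n.choose i : ℝ)) ^ 2 * ‖((fwdDiff (1 : ℕ))^[i] s) (n - i)‖ ^ 2 := by
  rw [← Finset.sum_range_reflect]
  refine Finset.sum_congr rfl (fun i hi => ?_)
  have hi : i ≤ n := Nat.lt_succ_iff.1 (Finset.mem_range.1 hi)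
  rw [hausdorffWeight, show n + 1 - 1 - i = n - i by omega, Nat.choose_symm hi,
    show n - (n - i) = i by omega]
  simp [mul_pow]

/-- The ratio is the product over j < m of (k-j)/(n-j), and each factor is within (j+1)/n of t. All
quantities lie in [0,1], so the errors add up; the induction closes because m² + m + 1 ≤ (m+1)². -/
theorem abs_choose_div_choose_sub_pow_le {n k : ℕ} (hn : 0 < n) (hk : k ≤ n) {t : ℝ}
    (ht1 : (k : ℝ) / (n + 1) ≤ t) (ht2 : t ≤ ((k : ℝ) + 1) / (n + 1)) {m : ℕ} (hm : m ≤ n) :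
    |(k.choose m : ℝ) / n.choose m - t ^ m| ≤ m ^ 2 / n := by
  have hn' : (0 : ℝ) < n := by exact_mod_cast hn
  have hk' : (k : ℝ) ≤ n := by exact_mod_cast hk
  have hk0 : (0 : ℝ) ≤ k := k.cast_nonneg
  have ht0 : 0 ≤ t := le_trans (by positivity) ht1
  have ht1' : t ≤ 1 := ht2.trans (by rw [div_le_one (by positivity)]; linarith)
  rw [div_le_iff₀ (by positivity)] at ht1
  rw [le_div_iff₀ (by positivity)] at ht2
  induction m with
  | zero => simp
  | succ m ih =>
    have ih := ih (by omega)
    -- Truncated subtraction gives r = 0 for k ≤ m, in agreement with `k.choose (m + 1) = 0`.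
    set r : ℝ := ((k - m : ℕ) : ℝ) / ((n - m : ℕ) : ℝ) with hr
    have hnm : 0 < n - m := by omega
    have hnm' : (0 : ℝ) < ((n - m : ℕ) : ℝ) := by exact_mod_cast hnm
    have hq : ((k.choose (m + 1) : ℕ) : ℝ) / (n.choose (m + 1) : ℕ) = (k.choose m : ℝ) / n.choose m * r := by
      have h1 : ((k.choose (m + 1) : ℕ) : ℝ) * (m + 1) = k.choose m * (k - m : ℕ) := by
        exact_mod_cast Nat.choose_succ_right_eq k m
      have h2 : ((n.choose (m + 1) : ℕ) : ℝ) * (m + 1) = n.choose m * (n - m : ℕ) := by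
        exact_mod_cast Nat.choose_succ_right_eq n m
      have h3 : (0 : ℝ) < n.choose (m + 1) := by exact_mod_cast Nat.choose_pos hm
      have h4 : (0 : ℝ) < n.choose m := by exact_mod_cast Nat.choose_pos (by omega)
      rw [hr, div_mul_div_comm, ← h1, ← h2]
      field_simp
    have hr0 : 0 ≤ r := by positivity
    have hkm : ((k - m : ℕ) : ℝ) ≤ ((n - m : ℕ) : ℝ) := by
      exact_mod_cast Nat.sub_le_sub_right hk m
    have hr1 : r ≤ 1 := (div_le_one hnm').2 hkm
    have hrn : r * ((n - m : ℕ) : ℝ) = ((k - m : ℕ) : ℝ) := div_mul_cancel₀ _ hnm'.ne'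
    have hcast : ((n - m : ℕ) : ℝ) = n - m := by rw [Nat.cast_sub (by omega)]
    have hkm1 : (k : ℝ) - m ≤ ((k - m : ℕ) : ℝ) := by
      have : k ≤ (k - m) + m := by omega
      have : (k : ℝ) ≤ ((k - m : ℕ) : ℝ) + m := by exact_mod_cast this
      linarith
    have hm0 : (0 : ℝ) ≤ m := m.cast_nonneg
    have hrup : r * n ≤ k := by
      by_cases hmk : m ≤ k
      · rw [hcast, Nat.cast_sub hmk] at hrn
        nlinarith
      · have : k - m = 0 := by omega
        rw [hr, this]; simp
    have hrlo : (k : ℝ) - m ≤ r * n := by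
      rw [hcast] at hrn
      nlinarith
    have hrt : |r - t| ≤ (m + 1) / n := by
      rw [le_div_iff₀ hn', ← abs_of_pos hn', ← abs_mul, abs_le]
      constructor <;> nlinarith
    rw [hq]
    have e : (k.choose m : ℝ) / n.choose m * r - t ^ (m + 1) =
      ((k.choose m : ℝ) / n.choose m - t ^ m) * r + t ^ m * (r - t) := by ring
    rw [e]
    calc _ ≤ |(k.choose m : ℝ) / n.choose m - t ^ m| * r + t ^ m * |r - t| := by
          refine (abs_add_le _ _).trans ?_
          rw [abs_mul, abs_mul, abs_of_nonneg hr0, abs_of_nonneg (pow_nonneg ht0 m)]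
      _ ≤ (m ^ 2 / n) * 1 + 1 * ((m + 1) / n) := by
          gcongr
          exact pow_le_one₀ ht0 ht1'
      _ ≤ _ := by
          push_cast
          rw [mul_one, one_mul, ← add_div]
          gcongr
          nlinarith

theorem integral_floor_step {E : Type*} [NormedAddCommGroup E] [NormedSpace ℝ E] {N : ℕ}
    (hN : 0 < N) (h : ℕ → ℝ → E) (hc : ∀ k, Continuous (h k)) :
    ∫ t in Set.Ioo (0 : ℝ) 1, h ⌊(N : ℝ) * t⌋₊ t =
      ∑ k ∈ Finset.range N, ∫ t in ((k : ℝ) / N)..((k + 1 : ℕ) : ℝ) / N, h k t := by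
  have hN' : (0 : ℝ) < N := by exact_mod_cast hN
  have hpiece : ∀ k : ℕ, Set.EqOn (h k) (fun t => h ⌊(N : ℝ) * t⌋₊ t)
      (Set.uIoo ((k : ℝ) / N) (((k + 1 : ℕ) : ℝ) / N)) := by
    intro k t ht
    rw [Set.uIoo_of_lt (by gcongr; simp)] at ht
    have h1 := (div_lt_iff₀ hN').1 ht.1
    have h2 := (lt_div_iff₀ hN').1 ht.2
    have : ⌊(N : ℝ) * t⌋₊ = k := by
      rw [Nat.floor_eq_iff (by nlinarith [k.cast_nonneg (α := ℝ)])]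
      push_cast at h2
      constructor <;> linarith
    simp only [this]
  have := intervalIntegral.sum_integral_adjacent_intervals (μ := volume) (f := fun t => h ⌊(N : ℝ) * t⌋₊ t)
    (a := fun k : ℕ => (k : ℝ) / N) (n := N) (fun k _ =>
      ((hc k).intervalIntegrable _ _).congr_uIoo (hpiece k))
  simp only [Nat.cast_zero, zero_div, div_self hN'.ne'] at this
  rw [intervalIntegral.integral_of_le zero_le_one, integral_Ioc_eq_integral_Ioo] at this
  rw [← this]
  refine Finset.sum_congr rfl (fun k _ => ?_)
  exact (intervalIntegral.integral_congr_uIoo (hpiece k)).symm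

/-- Banach–Alaoglu gives a weak-* cluster point of the functionals ⟨v n, ·⟩, and its values on the e
m are forced by the assumed limits. -/
theorem exists_inner_eq_of_tendsto {H : Type*} [NormedAddCommGroup H] [InnerProductSpace ℂ H]
    [CompleteSpace H] {v : ℕ → H} {C : ℝ} (hv : ∀ n, ‖v n‖ ≤ C) {e : ℕ → H} {s : ℕ → ℂ}
    (h : ∀ m, Tendsto (fun n => inner ℂ (v n) (e m)) atTop (𝓝 (s m))) :
    ∃ w : H, ∀ m, inner ℂ w (e m) = s m := by
  have hK := WeakDual.isCompact_closedBall (𝕜 := ℂ) (E := H) 0 C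
  let φ : ℕ → WeakDual ℂ H := fun n => StrongDual.toWeakDual (InnerProductSpace.toDual ℂ H (v n))
  have hφ : ∀ n, φ n ∈ WeakDual.toStrongDual ⁻¹' Metric.closedBall (0 : StrongDual ℂ H) C := by
    intro n
    simpa [φ] using hv n
  obtain ⟨ψ, -, hψ⟩ := hK.exists_clusterPt (f := map φ atTop)
    (by rw [le_principal_iff, mem_map]; exact Eventually.of_forall hφ)
  refine ⟨(InnerProductSpace.toDual ℂ H).symm (WeakDual.toStrongDual ψ), fun m => ?_⟩
  rw [InnerProductSpace.toDual_symm_apply]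
  have hcont : Continuous (fun χ : WeakDual ℂ H => χ (e m)) := WeakDual.eval_continuous _
  have h1 : MapClusterPt (ψ (e m)) atTop (fun n => φ n (e m)) :=
    MapClusterPt.continuousAt_comp hcont.continuousAt hψ
  -- The subsequence may depend on m: the cluster point is fixed beforehand and only the value at e
  -- m is compared.
  obtain ⟨k, hk, hk2⟩ : ∃ k : ℕ → ℕ, StrictMono k ∧ Tendsto (fun n => φ (k n) (e m)) atTop (𝓝 (ψ (e m))) :=
    h1.tendsto_subseq
  exact tendsto_nhds_unique hk2 ((h m).comp hk.tendsto_atTop)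

/-- Cauchy–Schwarz over n + 1 terms accounts for the factor n + 1 in (H). -/
theorem sum_norm_hausdorffWeight_le {s : ℕ → ℂ} {M : ℝ} {n : ℕ}
    (h : ((n : ℝ) + 1) * ∑ k ∈ Finset.range (n + 1), ‖hausdorffWeight s n k‖ ^ 2 ≤ M) :
    ∑ k ∈ Finset.range (n + 1), ‖hausdorffWeight s n k‖ ≤ √M := by
  refine Real.le_sqrt_of_sq_le (le_trans ?_ h)
  have := sq_sum_le_card_mul_sum_sq (s := Finset.range (n + 1)) (f := fun k => ‖hausdorffWeight s n k‖)
  simpa using this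

/-- The step function with value `(n + 1) C(n,k) (-1)^(n-k) Δ^(n-k) s_k` on
`[k / (n + 1), (k + 1) / (n + 1))`. -/
noncomputable def hausdorffStep (s : ℕ → ℂ) (n : ℕ) (t : ℝ) : ℂ :=
  ((n + 1 : ℕ) : ℂ) * hausdorffWeight s n ⌊((n + 1 : ℕ) : ℝ) * t⌋₊

theorem memLp_hausdorffStep (s : ℕ → ℂ) (n : ℕ) :
    MemLp (hausdorffStep s n) 2 (volume.restrict (Set.Ioo 0 1)) := by
  have hm : Measurable (hausdorffStep s n) := by
    unfold hausdorffStep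
    refine measurable_const.mul ?_
    exact (measurable_from_nat (f := hausdorffWeight s n)).comp
      (Nat.measurable_floor.comp (by fun_prop))
  refine MemLp.of_bound hm.aestronglyMeasurable
    (((n : ℝ) + 1) * ∑ k ∈ Finset.range (n + 1), ‖hausdorffWeight s n k‖) ?_
  filter_upwards [ae_restrict_mem measurableSet_Ioo] with t ht
  rw [hausdorffStep, norm_mul, Complex.norm_natCast]
  push_cast
  gcongr
  refine Finset.single_le_sum (f := fun k => ‖hausdorffWeight s n k‖) (fun _ _ => norm_nonneg _) ?_
  rw [Finset.mem_range, Nat.floor_lt (mul_nonneg (by positivity) ht.1.le)]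
  push_cast
  have : (0 : ℝ) ≤ n := n.cast_nonneg
  nlinarith [ht.2]

/-- There are n + 1 cells of length 1/(n+1), so the squared L² norm is exactly the quantity that (H)
keeps bounded. -/
theorem integral_norm_hausdorffStep_sq (s : ℕ → ℂ) (n : ℕ) :
    ∫ t in Set.Ioo (0 : ℝ) 1, ‖hausdorffStep s n t‖ ^ 2 =
      ((n : ℝ) + 1) * ∑ k ∈ Finset.range (n + 1), ‖hausdorffWeight s n k‖ ^ 2 := by
  have := integral_floor_step (N := n + 1) (by omega)
    (fun k _ => ‖((n + 1 : ℕ) : ℂ) * hausdorffWeight s n k‖ ^ 2) (fun k => continuous_const)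
  rw [Finset.mul_sum]
  refine this.trans (Finset.sum_congr rfl (fun k _ => ?_))
  rw [intervalIntegral.integral_const, norm_mul, Complex.norm_natCast, smul_eq_mul]
  push_cast
  field_simp
  ring

theorem integral_pow_mul_hausdorffStep (s : ℕ → ℂ) (n m : ℕ) :
    ∫ t in Set.Ioo (0 : ℝ) 1, (t : ℂ) ^ m * hausdorffStep s n t =
      ∑ k ∈ Finset.range (n + 1), hausdorffWeight s n k *
        (((n + 1 : ℕ) : ℂ) * ∫ t in ((k : ℝ) / (n + 1 : ℕ))..((k + 1 : ℕ) : ℝ) / (n + 1 : ℕ), (t : ℂ) ^ m) := by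
  have := integral_floor_step (N := n + 1) (by omega)
    (fun k t => (t : ℂ) ^ m * (((n + 1 : ℕ) : ℂ) * hausdorffWeight s n k)) (fun k => by fun_prop)
  refine this.trans (Finset.sum_congr rfl (fun k _ => ?_))
  rw [intervalIntegral.integral_mul_const]
  ring

/-- On each cell t^m differs from C(k,m)/C(n,m) by at most m²/n, while the weights have total mass
at most √M. -/
theorem norm_integral_pow_mul_hausdorffStep_sub_le {s : ℕ → ℂ} {M : ℝ} {n m : ℕ} (hn : 0 < n)
    (h : ((n : ℝ) + 1) * ∑ k ∈ Finset.range (n + 1), ‖hausdorffWeight s n k‖ ^ 2 ≤ M) (hm : m ≤ n) :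
    ‖(∫ t in Set.Ioo (0 : ℝ) 1, (t : ℂ) ^ m * hausdorffStep s n t) - s m‖ ≤ √M * (m ^ 2 / n) := by
  rw [integral_pow_mul_hausdorffStep, ← sum_hausdorffWeight_mul_choose_div s hm, ← Finset.sum_sub_distrib]
  have hn1 : (0 : ℝ) < ((n + 1 : ℕ) : ℝ) := by positivity
  have hk : ∀ k ∈ Finset.range (n + 1), ‖((n + 1 : ℕ) : ℂ) *
      (∫ t in ((k : ℝ) / (n + 1 : ℕ))..((k + 1 : ℕ) : ℝ) / (n + 1 : ℕ), (t : ℂ) ^ m) -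
        ((k.choose m : ℂ) / n.choose m)‖ ≤ m ^ 2 / n := by
    intro k hk
    have hkn : k ≤ n := Nat.lt_succ_iff.1 (Finset.mem_range.1 hk)
    have hlen : ((k + 1 : ℕ) : ℝ) / (n + 1 : ℕ) - (k : ℝ) / (n + 1 : ℕ) = 1 / (n + 1 : ℕ) := by
      push_cast; ring
    have hle : (k : ℝ) / (n + 1 : ℕ) ≤ ((k + 1 : ℕ) : ℝ) / (n + 1 : ℕ) := by gcongr; simp
    have e : ((n + 1 : ℕ) : ℂ) *
      (∫ t in ((k : ℝ) / (n + 1 : ℕ))..((k + 1 : ℕ) : ℝ) / (n + 1 : ℕ), (t : ℂ) ^ m) -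
        ((k.choose m : ℂ) / n.choose m) = ((n + 1 : ℕ) : ℂ) *
      (∫ t in ((k : ℝ) / (n + 1 : ℕ))..((k + 1 : ℕ) : ℝ) / (n + 1 : ℕ), ((t : ℂ) ^ m -
        ((k.choose m : ℂ) / n.choose m))) := by
      rw [intervalIntegral.integral_sub (Continuous.intervalIntegrable (by fun_prop) _ _) (by simp),
        intervalIntegral.integral_const, hlen, mul_sub]
      congr 1
      rw [Complex.real_smul]
      push_cast
      have : (n : ℂ) + 1 ≠ 0 := by exact_mod_cast n.succ_ne_zero
      field_simp
    rw [e, norm_mul, Complex.norm_natCast]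
    have hb := intervalIntegral.norm_integral_le_of_norm_le_const (C := (m : ℝ) ^ 2 / n)
      (f := fun t : ℝ => (t : ℂ) ^ m - ((k.choose m : ℂ) / n.choose m))
      (a := (k : ℝ) / (n + 1 : ℕ)) (b := ((k + 1 : ℕ) : ℝ) / (n + 1 : ℕ)) (by
        intro t ht
        rw [Set.uIoc_of_le hle] at ht
        have h1 := ht.1.le
        have h2 := ht.2
        push_cast at h1 h2
        have := abs_choose_div_choose_sub_pow_le hn hkn h1 h2 hm
        rw [norm_sub_rev]
        rw [← Real.norm_eq_abs, ← Complex.norm_real] at this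
        push_cast at this
        exact this)
    rw [abs_of_nonneg (sub_nonneg.2 hle), hlen] at hb
    calc _ ≤ ((n + 1 : ℕ) : ℝ) * (m ^ 2 / n * (1 / (n + 1 : ℕ))) := by gcongr
      _ = _ := by field_simp
  calc _ ≤ ∑ k ∈ Finset.range (n + 1), ‖hausdorffWeight s n k‖ * (m ^ 2 / n) := by
        refine norm_sum_le_of_le _ (fun k hk' => ?_)
        rw [← mul_sub, norm_mul]
        gcongr
        exact hk k hk'
    _ ≤ _ := by
        rw [← Finset.sum_mul]
        gcongr
        exact sum_norm_hausdorffWeight_le h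

theorem HausdorffL2.exists_moments {s : ℕ → ℂ} (hs : HausdorffL2 s) :
    ∃ u : ℝ → ℂ, MemLp u 2 (volume.restrict (Set.Ioo 0 1)) ∧
      ∀ m : ℕ, ∫ t in Set.Ioo (0 : ℝ) 1, (t : ℂ) ^ m * u t = s m := by
  obtain ⟨M, -, hM⟩ := hs
  have hM : ∀ n : ℕ, ((n : ℝ) + 1) * ∑ k ∈ Finset.range (n + 1), ‖hausdorffWeight s n k‖ ^ 2 ≤ M := by
    intro n
    rw [sum_norm_hausdorffWeight_sq]
    exact (hM n).le
  have hpow : ∀ m : ℕ, MemLp (fun t : ℝ => (t : ℂ) ^ m) 2 (volume.restrict (Set.Ioo 0 1)) := by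
    intro m
    refine MemLp.of_bound (by fun_prop) 1 ?_
    filter_upwards [ae_restrict_mem measurableSet_Ioo] with t ht
    rw [norm_pow, Complex.norm_real, Real.norm_of_nonneg ht.1.le]
    exact pow_le_one₀ ht.1.le ht.2.le
  have hinner : ∀ (f g : ℝ → ℂ) (hf : MemLp f 2 (volume.restrict (Set.Ioo 0 1)))
      (hg : MemLp g 2 (volume.restrict (Set.Ioo (0 : ℝ) 1))),
      inner ℂ (hf.star.toLp _) (hg.toLp _) = ∫ t in Set.Ioo (0 : ℝ) 1, g t * f t := by
    intro f g hf hg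
    rw [L2.inner_def]
    refine integral_congr_ae ?_
    filter_upwards [hf.star.coeFn_toLp, hg.coeFn_toLp] with t h1 h2
    rw [h1, h2]
    simp
  -- The step functions enter conjugated because the inner product is conjugate-linear in its first
  -- argument; the density is the conjugate of w.
  obtain ⟨w, hw⟩ := exists_inner_eq_of_tendsto
    (v := fun n => (memLp_hausdorffStep s n).star.toLp _) (C := √M) (e := fun m => (hpow m).toLp _) (s := s)
    (by
      intro n
      refine Real.le_sqrt_of_sq_le (le_trans (le_of_eq ?_) (hM n))
      rw [← integral_norm_hausdorffStep_sq, ← inner_self_eq_norm_sq (𝕜 := ℂ)]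
      have := hinner _ _ (memLp_hausdorffStep s n) (memLp_hausdorffStep s n).star
      rw [this]
      have e : ∀ t, star (hausdorffStep s n) t * hausdorffStep s n t =
          ((‖hausdorffStep s n t‖ ^ 2 : ℝ) : ℂ) := by
        intro t
        rw [Pi.star_apply, ← starRingEnd_apply, ← Complex.normSq_eq_conj_mul_self, Complex.normSq_eq_norm_sq]
      simp only [e]
      rw [integral_complex_ofReal]
      simp) (by
      intro m
      simp_rw [hinner _ _ (memLp_hausdorffStep s _) (hpow m)]
      rw [tendsto_iff_norm_sub_tendsto_zero]
      have hlim : Tendsto (fun n : ℕ => √M * ((m : ℝ) ^ 2 / n)) atTop (𝓝 0) := by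
        simpa using (tendsto_const_div_atTop_nhds_zero_nat ((m : ℝ) ^ 2)).const_mul (√M)
      refine squeeze_zero' (Eventually.of_forall fun _ => norm_nonneg _) ?_ hlim
      filter_upwards [eventually_ge_atTop (m + 1)] with n hn
      exact norm_integral_pow_mul_hausdorffStep_sub_le (by omega) (hM n) (by omega))
  refine ⟨star (w : ℝ → ℂ), (Lp.memLp w).star, fun m => ?_⟩
  rw [← hw m, ← hinner _ _ (Lp.memLp w).star (hpow m)]
  congr 1
  apply Lp.ext
  filter_upwards [(Lp.memLp w).star.star.coeFn_toLp] with t ht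
  rw [ht]
  simp

/-! ### The Mellin transform of an L² density on (0,1) -/

/-- Lebesgue measure on the unit interval `(0, 1)`. -/
noncomputable abbrev unitVol : Measure ℝ := volume.restrict (Set.Ioo 0 1)

/-- The Mellin-type transform `∫₀¹ t ^ z u(t) dt`. -/
noncomputable def cutMellin (u : ℝ → ℂ) (z : ℂ) : ℂ := ∫ t, (t : ℂ) ^ z * u t ∂unitVol

theorem eLpNorm_two_sq {α E : Type*} [MeasurableSpace α] [NormedAddCommGroup E] (f : α → E)
    (μ : Measure α) : eLpNorm f 2 μ ^ 2 = ∫⁻ x, ‖f x‖ₑ ^ 2 ∂μ := by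
  have := eLpNorm_nnreal_pow_eq_lintegral (μ := μ) (f := f) (p := 2) (by norm_num)
  simpa using this

theorem memLp_two_of_lintegral {α E : Type*} [MeasurableSpace α] [NormedAddCommGroup E] {f : α → E}
    {μ : Measure α} (hf : AEStronglyMeasurable f μ) (h : ∫⁻ x, ‖f x‖ₑ ^ 2 ∂μ ≠ ⊤) : MemLp f 2 μ := by
  refine ⟨hf, ?_⟩
  rw [← eLpNorm_two_sq] at h
  rw [lt_top_iff_ne_top]
  intro h'
  simp [h'] at h

theorem memLp_rpow_unitVol {σ : ℝ} (hσ : -(1 / 2) < σ) : MemLp (fun t : ℝ => t ^ σ) 2 unitVol := by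
  rw [memLp_two_iff_integrable_sq (by fun_prop)]
  have h : IntegrableOn (fun t : ℝ => t ^ (2 * σ)) (Set.Ioo 0 1) :=
    (intervalIntegral.integrableOn_Ioo_rpow_iff one_pos).2 (by linarith)
  refine h.congr ?_
  filter_upwards [ae_restrict_mem measurableSet_Ioo] with t ht
  rw [← Real.rpow_natCast, ← Real.rpow_mul ht.1.le, mul_comm]
  norm_num

theorem norm_cpow_unitVol (z : ℂ) : ∀ᵐ t : ℝ ∂unitVol, ‖(t : ℂ) ^ z‖ = t ^ z.re := by
  filter_upwards [ae_restrict_mem measurableSet_Ioo] with t ht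
  exact Complex.norm_cpow_eq_rpow_re_of_pos ht.1 z

theorem aestronglyMeasurable_cpow (z : ℂ) (μ : Measure ℝ) : AEStronglyMeasurable (fun t : ℝ => (t : ℂ) ^ z) μ :=
  (Measurable.pow_const (by fun_prop) z).aestronglyMeasurable

theorem memLp_cpow_unitVol {z : ℂ} (hz : -(1 / 2) < z.re) :
    MemLp (fun t : ℝ => (t : ℂ) ^ z) 2 unitVol :=
  (memLp_rpow_unitVol hz).of_le (aestronglyMeasurable_cpow z _) <| by
    filter_upwards [norm_cpow_unitVol z, ae_restrict_mem measurableSet_Ioo] with t h ht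
    rw [h, Real.norm_of_nonneg (Real.rpow_nonneg ht.1.le _)]

theorem integrable_cpow_mul {u : ℝ → ℂ} (hu : MemLp u 2 unitVol) {z : ℂ} (hz : -(1 / 2) < z.re) :
    Integrable (fun t : ℝ => (t : ℂ) ^ z * u t) unitVol :=
  (memLp_cpow_unitVol hz).integrable_mul hu

theorem norm_cutMellin_le {u : ℝ → ℂ} (hu : MemLp u 2 unitVol) {z : ℂ} (hz : 0 ≤ z.re) :
    ‖cutMellin u z‖ ≤ ∫ t, ‖u t‖ ∂unitVol := by
  refine norm_integral_le_of_norm_le (hu.integrable (by norm_num)).norm ?_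
  filter_upwards [norm_cpow_unitVol z, ae_restrict_mem measurableSet_Ioo] with t h ht
  rw [norm_mul, h]
  exact mul_le_of_le_one_left (norm_nonneg _) (Real.rpow_le_one ht.1.le ht.2.le hz)

theorem differentiableOn_cutMellin {u : ℝ → ℂ} (hu : MemLp u 2 unitVol) :
    DifferentiableOn ℂ (cutMellin u) halfPlane := by
  intro z hz
  have hz : -(1 / 2) < z.re := hz
  -- One δ pays for the radius of the ball and one for the logarithm, through |log t| t^δ < 1/δ. The
  -- remaining exponent Re z - 2δ still exceeds -1/2, so the bound is a product of two L² functions.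
  set δ : ℝ := (z.re + 1 / 2) / 3 with hδ
  have hδ0 : 0 < δ := by rw [hδ]; linarith
  have hball : Metric.ball z δ ∈ 𝓝 z := Metric.ball_mem_nhds _ hδ0
  refine DifferentiableAt.differentiableWithinAt ?_
  refine HasDerivAt.differentiableAt (hasDerivAt_integral_of_dominated_loc_of_deriv_le (μ := unitVol)
    (F := fun z t => (t : ℂ) ^ z * u t) (F' := fun z t => ((t : ℂ) ^ z * Complex.log t) * u t)
    (bound := fun t => (1 / δ) * (t ^ (z.re - 2 * δ) * ‖u t‖)) hball
    (Eventually.of_forall fun w => (aestronglyMeasurable_cpow w _).mul hu.1)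
    (integrable_cpow_mul hu hz)
    (((aestronglyMeasurable_cpow z _).mul
      (Complex.measurable_log.comp Complex.measurable_ofReal).aestronglyMeasurable).mul hu.1) ?_ ?_ ?_).2
  · filter_upwards [ae_restrict_mem measurableSet_Ioo] with t ht w hw
    have hre : z.re - δ ≤ w.re := by
      have h1 := Complex.abs_re_le_norm (w - z)
      rw [Metric.mem_ball, dist_eq_norm] at hw
      have := (abs_lt.1 (h1.trans_lt hw)).1
      simp only [Complex.sub_re] at this
      linarith
    rw [norm_mul, norm_mul, Complex.norm_cpow_eq_rpow_re_of_pos ht.1, ← Complex.ofReal_log ht.1.le,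
      Complex.norm_real, Real.norm_eq_abs, ← mul_assoc]
    refine mul_le_mul_of_nonneg_right ?_ (norm_nonneg _)
    calc t ^ w.re * |Real.log t| ≤ t ^ (z.re - δ) * |Real.log t| := by
          gcongr ?_ * _
          exact Real.rpow_le_rpow_of_exponent_ge ht.1 ht.2.le hre
      _ = |Real.log t * t ^ δ| * t ^ (z.re - 2 * δ) := by
          rw [abs_mul, abs_of_nonneg (Real.rpow_nonneg ht.1.le _), mul_assoc, ← Real.rpow_add ht.1]
          ring_nf
      _ ≤ _ := by
          exact mul_le_mul_of_nonneg_right (Real.abs_log_mul_self_rpow_lt t δ ht.1 ht.2.le hδ0).le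
            (Real.rpow_nonneg ht.1.le _)
  · refine Integrable.const_mul ?_ _
    exact (memLp_rpow_unitVol (by rw [hδ]; linarith)).integrable_mul hu.norm
  · filter_upwards [ae_restrict_mem measurableSet_Ioo] with t ht w _
    refine HasDerivAt.mul_const ?_ _
    have := (hasDerivAt_id w).const_cpow (c := (t : ℂ)) (Or.inl (by exact_mod_cast ht.1.ne'))
    simpa using this

/-! ### Logarithmic coordinates, Plancherel and membership in H² -/

theorem lintegral_comp_exp_neg (G : ℝ → ENNReal) :
    ∫⁻ v, ENNReal.ofReal (Real.exp (-v)) * G (Real.exp (-v)) = ∫⁻ t in Set.Ioi 0, G t := by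
  have himg : (fun v : ℝ => Real.exp (-v)) '' Set.univ = Set.Ioi 0 := by
    rw [Set.image_univ]
    ext t
    constructor
    · rintro ⟨v, rfl⟩; exact Real.exp_pos _
    · intro ht; exact ⟨-Real.log t, by simp [Real.exp_log (show (0 : ℝ) < t from ht)]⟩
  rw [← himg, lintegral_image_eq_lintegral_abs_deriv_mul (f' := fun v => -Real.exp (-v)) MeasurableSet.univ]
  · simp
  · intro v _
    have := ((hasDerivAt_id v).neg.exp).hasDerivWithinAt (s := Set.univ)
    simpa using this
  · intro v _ w _ h
    have := Real.exp_injective h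
    linarith

theorem quasiMeasurePreserving_exp_neg :
    Measure.QuasiMeasurePreserving (fun v : ℝ => Real.exp (-v)) volume (volume.restrict (Set.Ioi 0)) := by
  refine ⟨by fun_prop, Measure.AbsolutelyContinuous.mk fun s hs h => ?_⟩
  rw [Measure.map_apply (by fun_prop) hs]
  have h1 := lintegral_comp_exp_neg (s.indicator 1)
  rw [lintegral_indicator_one hs, h, lintegral_eq_zero_iff] at h1
  · refine measure_mono_null ?_ (ae_iff.1 h1)
    intro v hv
    have hv : Real.exp (-v) ∈ s := hv
    simp [hv, Real.exp_pos]
  · exact (by fun_prop : Measurable fun v : ℝ => ENNReal.ofReal (Real.exp (-v))).mul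
      ((measurable_one.indicator hs).comp (by fun_prop))

/-- The function on the line whose Fourier transform is the restriction of `cutMellin u` to the
vertical line `Re z = σ`. -/
noncomputable def expProfile (u : ℝ → ℂ) (σ : ℝ) (v : ℝ) : ℂ :=
  Real.exp (-σ * v) • (Set.Ioo (0 : ℝ) 1).indicator (fun t => (t : ℂ) * u t) (Real.exp (-v))

/-- The standard Mellin kernel is t^(z-1), whence the extra factor t in `expProfile`; the frequency
is ν/2π. -/
theorem cutMellin_eq_fourier (u : ℝ → ℂ) (σ ν : ℝ) :
    cutMellin u ((σ : ℂ) + (ν : ℂ) * Complex.I) =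
      FourierTransform.fourier (expProfile u σ) ((2 * Real.pi)⁻¹ * ν) := by
  have h := mellin_eq_fourier ((Set.Ioo (0 : ℝ) 1).indicator (fun t => (t : ℂ) * u t))
    (s := (σ : ℂ) + (ν : ℂ) * Complex.I)
  have e1 : ((σ : ℂ) + (ν : ℂ) * Complex.I).re = σ := by simp
  have e2 : ((σ : ℂ) + (ν : ℂ) * Complex.I).im = ν := by simp
  rw [e1, e2, div_eq_inv_mul] at h
  refine Eq.trans ?_ h
  rw [cutMellin, mellin, ← integral_indicator measurableSet_Ioo, ← integral_indicator measurableSet_Ioi]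
  congr 1
  ext t
  by_cases ht : t ∈ Set.Ioo (0 : ℝ) 1
  · have ht0 : (t : ℂ) ≠ 0 := by exact_mod_cast ht.1.ne'
    rw [Set.indicator_of_mem ht, Set.indicator_of_mem (show t ∈ Set.Ioi (0 : ℝ) from ht.1), Set.indicator_of_mem ht,
      smul_eq_mul, ← mul_assoc, Complex.cpow_sub _ _ ht0, Complex.cpow_one, div_mul_cancel₀ _ ht0]
  · rw [Set.indicator_of_notMem ht]
    by_cases ht' : t ∈ Set.Ioi (0 : ℝ)
    · rw [Set.indicator_of_mem ht', Set.indicator_of_notMem ht, smul_zero]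
    · rw [Set.indicator_of_notMem ht']

theorem aestronglyMeasurable_expProfile {u : ℝ → ℂ} (hu : AEStronglyMeasurable u unitVol) (σ : ℝ) :
    AEStronglyMeasurable (expProfile u σ) volume := by
  have h1 : AEStronglyMeasurable ((Set.Ioo (0 : ℝ) 1).indicator (fun t => (t : ℂ) * u t))
      (volume.restrict (Set.Ioi 0)) := by
    refine AEStronglyMeasurable.mono_measure ?_ Measure.restrict_le_self
    rw [aestronglyMeasurable_indicator_iff measurableSet_Ioo]
    exact AEStronglyMeasurable.mul (by fun_prop) hu
  exact AEStronglyMeasurable.smul (f := fun v => Real.exp (-σ * v)) (by fun_prop)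
    (h1.comp_quasiMeasurePreserving quasiMeasurePreserving_exp_neg)

theorem lintegral_enorm_expProfile (u : ℝ → ℂ) (σ : ℝ) :
    ∫⁻ v, ‖expProfile u σ v‖ₑ = ∫⁻ t, ENNReal.ofReal (t ^ σ) * ‖u t‖ₑ ∂unitVol := by
  have := lintegral_comp_exp_neg (fun t => (Set.Ioo (0 : ℝ) 1).indicator
    (fun t => ENNReal.ofReal (t ^ σ) * ‖u t‖ₑ) t)
  rw [setLIntegral_indicator measurableSet_Ioo, Set.inter_eq_left.2 (fun t ht => ht.1)] at this
  rw [← this]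
  refine lintegral_congr fun v => ?_
  rw [expProfile, enorm_smul]
  by_cases hv : Real.exp (-v) ∈ Set.Ioo (0 : ℝ) 1
  · rw [Set.indicator_of_mem hv, Set.indicator_of_mem hv, enorm_mul, ← mul_assoc, ← mul_assoc]
    congr 1
    rw [mul_comm, ← Real.exp_mul, ← ofReal_norm, ← ofReal_norm, Complex.norm_real, Real.norm_of_nonneg (Real.exp_pos _).le,
      Real.norm_of_nonneg (Real.exp_pos _).le]
    ring_nf
  · simp [Set.indicator_of_notMem hv]

/-- The exponential weight and the Jacobian combine into t^(2σ+1), which is at most 1 on (0,1) as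
soon as σ ≥ -1/2. This is why Re z = -1/2 is the natural boundary. -/
theorem lintegral_enorm_expProfile_sq (u : ℝ → ℂ) (σ : ℝ) :
    ∫⁻ v, ‖expProfile u σ v‖ₑ ^ 2 = ∫⁻ t, ENNReal.ofReal (t ^ (2 * σ + 1)) * ‖u t‖ₑ ^ 2 ∂unitVol := by
  have := lintegral_comp_exp_neg (fun t => (Set.Ioo (0 : ℝ) 1).indicator
    (fun t => ENNReal.ofReal (t ^ (2 * σ + 1)) * ‖u t‖ₑ ^ 2) t)
  rw [setLIntegral_indicator measurableSet_Ioo, Set.inter_eq_left.2 (fun t ht => ht.1)] at this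
  rw [← this]
  refine lintegral_congr fun v => ?_
  rw [expProfile, enorm_smul]
  by_cases hv : Real.exp (-v) ∈ Set.Ioo (0 : ℝ) 1
  · rw [Set.indicator_of_mem hv, Set.indicator_of_mem hv, enorm_mul, ← mul_assoc, ← mul_assoc, mul_pow]
    congr 1
    rw [← Real.exp_mul, ← ofReal_norm, ← ofReal_norm, Complex.norm_real, Real.norm_of_nonneg (Real.exp_pos _).le,
      Real.norm_of_nonneg (Real.exp_pos _).le, ← ENNReal.ofReal_mul (Real.exp_pos _).le,
      ← ENNReal.ofReal_pow (by positivity), ← ENNReal.ofReal_mul (Real.exp_pos _).le, ← Real.exp_add, ← Real.exp_add, ← Real.exp_nat_mul]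
    congr 2
    push_cast
    ring
  · simp [Set.indicator_of_notMem hv]

section

open scoped FourierTransform

theorem map_scale_volume : Measure.map (fun ν : ℝ => (2 * Real.pi)⁻¹ * ν) volume =
    ENNReal.ofReal (2 * Real.pi) • (volume : Measure ℝ) := by
  rw [Real.map_volume_mul_left (by positivity), inv_inv, abs_of_pos (by positivity)]

theorem measurableEmbedding_scale : MeasurableEmbedding (fun ν : ℝ => (2 * Real.pi)⁻¹ * ν) :=
  (Homeomorph.mulLeft₀ (2 * Real.pi)⁻¹ (by positivity)).measurableEmbedding

theorem ae_scale {P : ℝ → Prop} (h : ∀ᵐ ξ, P ξ) : ∀ᵐ ν : ℝ, P ((2 * Real.pi)⁻¹ * ν) := by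
  have : ∀ᵐ ξ ∂(Measure.map (fun ν : ℝ => (2 * Real.pi)⁻¹ * ν) volume), P ξ := by
    rw [map_scale_volume]
    exact Measure.ae_smul_measure h _
  exact ae_of_ae_map measurableEmbedding_scale.measurable.aemeasurable this

theorem eLpNorm_two_scale_sq (h : ℝ → ℂ) :
    eLpNorm (fun ν : ℝ => h ((2 * Real.pi)⁻¹ * ν)) 2 volume ^ 2 =
      ENNReal.ofReal (2 * Real.pi) * eLpNorm h 2 volume ^ 2 := by
  rw [eLpNorm_two_sq, eLpNorm_two_sq, ← measurableEmbedding_scale.lintegral_map (fun x => ‖h x‖ₑ ^ 2),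
    map_scale_volume, lintegral_smul_measure, smul_eq_mul]

theorem integral_scale {E : Type*} [NormedAddCommGroup E] [NormedSpace ℝ E] (h : ℝ → E) :
    ∫ ξ : ℝ, h (2 * Real.pi * ξ) = (2 * Real.pi)⁻¹ • ∫ ν : ℝ, h ν := by
  rw [Measure.integral_comp_mul_left, abs_of_pos (by positivity)]

theorem memLp_expProfile {u : ℝ → ℂ} (hu : MemLp u 2 unitVol) {σ : ℝ} (hσ : -(1 / 2) ≤ σ) :
    MemLp (expProfile u σ) 2 volume := by
  refine memLp_two_of_lintegral (aestronglyMeasurable_expProfile hu.1 σ) ?_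
  rw [lintegral_enorm_expProfile_sq, ← lt_top_iff_ne_top]
  refine lt_of_le_of_lt (b := ∫⁻ t, ‖u t‖ₑ ^ 2 ∂unitVol) ?_ ?_
  · refine lintegral_mono_ae ?_
    filter_upwards [ae_restrict_mem measurableSet_Ioo] with t ht
    refine mul_le_of_le_one_left' (ENNReal.ofReal_le_one.2 ?_)
    exact Real.rpow_le_one ht.1.le ht.2.le (by linarith)
  · rw [← eLpNorm_two_sq]
    exact ENNReal.pow_lt_top hu.2

theorem integrable_expProfile {u : ℝ → ℂ} (hu : MemLp u 2 unitVol) {σ : ℝ} (hσ : -(1 / 2) < σ) :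
    Integrable (expProfile u σ) volume := by
  refine ⟨aestronglyMeasurable_expProfile hu.1 σ, ?_⟩
  rw [hasFiniteIntegral_iff_enorm, lintegral_enorm_expProfile]
  have h := ((memLp_rpow_unitVol hσ).integrable_mul hu.norm).2
  rw [hasFiniteIntegral_iff_enorm] at h
  refine lt_of_le_of_lt (lintegral_mono_ae ?_) h
  filter_upwards [ae_restrict_mem measurableSet_Ioo] with t ht
  rw [Pi.mul_apply, enorm_mul, enorm_norm, Real.enorm_of_nonneg (Real.rpow_nonneg ht.1.le _)]

/-- The profile lives on v > 0, where e^(-(σ+1/2)v) - 1 has modulus at most 1 and tends to 0;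
dominated convergence applies. By Plancherel this becomes the L² boundary limit of the transform. -/
theorem tendsto_eLpNorm_expProfile_sub {u : ℝ → ℂ} (hu : MemLp u 2 unitVol) :
    Tendsto (fun σ : ℝ => eLpNorm (expProfile u σ - expProfile u (-(1 / 2))) 2 volume)
      (𝓝[>] (-(1 / 2))) (𝓝 0) := by
  have hb := memLp_expProfile hu (le_refl _)
  have hfac : ∀ σ v, expProfile u σ v - expProfile u (-(1 / 2)) v =
      ((Real.exp (-(σ + 1 / 2) * v) - 1 : ℝ) : ℂ) * expProfile u (-(1 / 2)) v := by
    intro σ v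
    rw [expProfile, expProfile, Complex.real_smul, Complex.real_smul, ← mul_assoc, ← Complex.ofReal_mul,
      ← sub_mul, ← Complex.ofReal_sub, sub_mul, ← Real.exp_add, one_mul]
    ring_nf
  have hsupp : ∀ v ≤ 0, expProfile u (-(1 / 2)) v = 0 := by
    intro v hv
    rw [expProfile, Set.indicator_of_notMem, smul_zero]
    intro h
    have := Real.one_le_exp (x := -v) (by linarith)
    linarith [h.2]
  have hlim : Tendsto (fun σ : ℝ => ∫⁻ v, ‖(expProfile u σ - expProfile u (-(1 / 2))) v‖ₑ ^ 2)
      (𝓝[>] (-(1 / 2))) (𝓝 (∫⁻ _ : ℝ, 0)) := by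
    refine tendsto_lintegral_filter_of_dominated_convergence'
      (fun v => ‖expProfile u (-(1 / 2)) v‖ₑ ^ 2) ?_ ?_ ?_ ?_
    · refine Eventually.of_forall fun σ => ?_
      exact (((aestronglyMeasurable_expProfile hu.1 σ).sub
        (aestronglyMeasurable_expProfile hu.1 _)).enorm).pow_const 2
    · filter_upwards [self_mem_nhdsWithin] with σ hσ
      refine Eventually.of_forall fun v => ?_
      rw [Pi.sub_apply, hfac, enorm_mul]
      rcases le_or_gt v 0 with hv | hv
      · rw [hsupp v hv, enorm_zero, mul_zero]
      · gcongr
        refine mul_le_of_le_one_left' ?_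
        rw [← ofReal_norm, ENNReal.ofReal_le_one, Complex.norm_real, Real.norm_eq_abs, abs_le]
        have hσ : -(1 / 2) < σ := hσ
        have h1 := Real.exp_pos (-(σ + 1 / 2) * v)
        have h2 : Real.exp (-(σ + 1 / 2) * v) ≤ 1 := Real.exp_le_one_iff.2 (by nlinarith)
        constructor <;> linarith
    · rw [← eLpNorm_two_sq]
      exact ENNReal.pow_ne_top hb.2.ne
    · refine Eventually.of_forall fun v => ?_
      have : Tendsto (fun σ : ℝ => (expProfile u σ - expProfile u (-(1 / 2))) v) (𝓝[>] (-(1 / 2))) (𝓝 0) := by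
        have hc : Continuous (fun σ : ℝ => ((Real.exp (-(σ + 1 / 2) * v) - 1 : ℝ) : ℂ) * expProfile u (-(1 / 2)) v) := by
          fun_prop
        have := (hc.tendsto (-(1 / 2))).mono_left (nhdsWithin_le_nhds (s := Set.Ioi (-(1 / 2))))
        simp only [Pi.sub_apply, hfac]
        simpa using this
      have h2 := (ENNReal.continuous_pow 2).tendsto _ |>.comp (continuous_enorm.tendsto _ |>.comp this)
      simpa [Function.comp_def] using h2
  rw [lintegral_zero] at hlim
  have := (ENNReal.continuous_rpow_const (y := 1 / 2)).tendsto 0 |>.comp hlim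
  rw [ENNReal.zero_rpow_of_pos (by norm_num)] at this
  refine this.congr fun σ => ?_
  simp only [Function.comp_apply]
  rw [← eLpNorm_two_sq, ← ENNReal.rpow_natCast, ← ENNReal.rpow_mul]
  norm_num

/-- The `L²` Fourier transform of `expProfile u σ`, as a function on the line `Re z = σ`. -/
noncomputable def lineTransform (u : ℝ → ℂ) (σ : ℝ) (ν : ℝ) : ℂ := by
  classical
  exact if h : MemLp (expProfile u σ) 2 volume then
    (𝓕 (h.toLp (expProfile u σ)) : Lp ℂ 2 (volume : Measure ℝ)) ((2 * Real.pi)⁻¹ * ν) else 0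

/-- `cutMellin u` on the open half-plane, completed by its `L²` boundary values. -/
noncomputable def hardyExtension (u : ℝ → ℂ) (z : ℂ) : ℂ := by
  classical
  exact if -(1 / 2) < z.re then cutMellin u z else lineTransform u (-(1 / 2)) z.im

theorem hardyExtension_of_mem {u : ℝ → ℂ} {z : ℂ} (hz : z ∈ halfPlane) :
    hardyExtension u z = cutMellin u z := if_pos hz

/-- Inside the half-plane the profile is integrable as well, so the Fourier integral and the L²
transform agree almost everywhere. On the boundary line it is the definition. -/
theorem onLine_hardyExtension_ae {u : ℝ → ℂ} (hu : MemLp u 2 unitVol) {σ : ℝ} (hσ : -(1 / 2) ≤ σ) :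
    onLine (hardyExtension u) σ =ᵐ[volume] lineTransform u σ := by
  rcases hσ.lt_or_eq with h | h
  · have h1 := fourier_toLp_ae_eq (integrable_expProfile hu h) (memLp_expProfile hu hσ)
    filter_upwards [ae_scale h1] with ν hν
    rw [lineTransform, dif_pos (memLp_expProfile hu hσ), hν, onLine, hardyExtension_of_mem,
      cutMellin_eq_fourier]
    simpa [halfPlane] using h
  · subst h
    refine Eventually.of_forall fun ν => ?_
    rw [onLine, hardyExtension, if_neg (by simp)]
    simp

theorem eLpNorm_lineTransform_sub_sq {u w : ℝ → ℂ} {σ τ : ℝ} (h1 : MemLp (expProfile u σ) 2 volume)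
    (h2 : MemLp (expProfile w τ) 2 volume) :
    eLpNorm (lineTransform u σ - lineTransform w τ) 2 volume ^ 2 =
      ENNReal.ofReal (2 * Real.pi) * eLpNorm (expProfile u σ - expProfile w τ) 2 volume ^ 2 := by
  have e : lineTransform u σ - lineTransform w τ = fun ν =>
      (((𝓕 (h1.toLp _) : Lp ℂ 2 (volume : Measure ℝ)) : ℝ → ℂ) -
       ((𝓕 (h2.toLp _) : Lp ℂ 2 (volume : Measure ℝ)) : ℝ → ℂ)) ((2 * Real.pi)⁻¹ * ν) := by
    ext ν
    simp only [Pi.sub_apply, lineTransform, dif_pos h1, dif_pos h2]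
  rw [e, eLpNorm_two_scale_sq]
  congr 2
  rw [← Lp.edist_def, ← Lp.edist_toLp_toLp _ _ h1 h2]
  exact (Lp.fourierTransformₗᵢ ℝ ℂ).edist_map _ _

theorem eLpNorm_lineTransform_sq {u : ℝ → ℂ} {σ : ℝ} (h1 : MemLp (expProfile u σ) 2 volume) :
    eLpNorm (lineTransform u σ) 2 volume ^ 2 =
      ENNReal.ofReal (2 * Real.pi) * eLpNorm (expProfile u σ) 2 volume ^ 2 := by
  have e : lineTransform u σ = fun ν =>
      ((𝓕 (h1.toLp _) : Lp ℂ 2 (volume : Measure ℝ)) : ℝ → ℂ) ((2 * Real.pi)⁻¹ * ν) := by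
    ext ν
    simp only [lineTransform, dif_pos h1]
  rw [e, eLpNorm_two_scale_sq]
  congr 2
  rw [← Lp.enorm_def, ← Lp.enorm_toLp h1]
  exact (Lp.fourierTransformₗᵢ ℝ ℂ).enorm_map _

theorem memLp_onLine_hardyExtension {u : ℝ → ℂ} (hu : MemLp u 2 unitVol) {σ : ℝ} (hσ : -(1 / 2) ≤ σ) :
    MemLp (onLine (hardyExtension u) σ) 2 volume := by
  rw [memLp_congr_ae (onLine_hardyExtension_ae hu hσ)]
  have h1 := memLp_expProfile hu hσ
  have e : lineTransform u σ = ((𝓕 (h1.toLp _) : Lp ℂ 2 (volume : Measure ℝ)) : ℝ → ℂ) ∘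
      (fun ν => (2 * Real.pi)⁻¹ * ν) := by
    ext ν
    simp only [lineTransform, dif_pos h1, Function.comp_apply]
  rw [e, ← measurableEmbedding_scale.memLp_map_measure_iff, map_scale_volume]
  exact (Lp.memLp _).smul_measure ENNReal.ofReal_ne_top

theorem lintegral_onLine_hardyExtension_sq {u : ℝ → ℂ} (hu : MemLp u 2 unitVol) {σ : ℝ}
    (hσ : -(1 / 2) ≤ σ) : ∫⁻ ν, ‖onLine (hardyExtension u) σ ν‖ₑ ^ 2 =
      ENNReal.ofReal (2 * Real.pi) * ∫⁻ t, ENNReal.ofReal (t ^ (2 * σ + 1)) * ‖u t‖ₑ ^ 2 ∂unitVol := by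
  rw [← eLpNorm_two_sq, eLpNorm_congr_ae (onLine_hardyExtension_ae hu hσ),
    eLpNorm_lineTransform_sq (memLp_expProfile hu hσ), eLpNorm_two_sq, lintegral_enorm_expProfile_sq]

theorem memHardyH2_hardyExtension {u : ℝ → ℂ} (hu : MemLp u 2 unitVol) : MemHardyH2 (hardyExtension u) where
  holomorphic := (differentiableOn_cutMellin hu).congr fun z hz => hardyExtension_of_mem hz
  bounded := by
    -- Adding 1 avoids a square root: if N² ≤ X then N ≤ X + 1.
    refine ⟨(ENNReal.ofReal (2 * Real.pi) * eLpNorm u 2 unitVol ^ 2 + 1).toNNReal, fun σ hσ => ?_⟩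
    have hfin : ENNReal.ofReal (2 * Real.pi) * eLpNorm u 2 unitVol ^ 2 + 1 ≠ ⊤ :=
      ENNReal.add_ne_top.2 ⟨ENNReal.mul_ne_top ENNReal.ofReal_ne_top (ENNReal.pow_ne_top hu.2.ne),
        ENNReal.one_ne_top⟩
    rw [ENNReal.coe_toNNReal hfin]
    have h1 : eLpNorm (onLine (hardyExtension u) σ) 2 volume ^ 2 ≤
        ENNReal.ofReal (2 * Real.pi) * eLpNorm u 2 unitVol ^ 2 := by
      rw [eLpNorm_two_sq, lintegral_onLine_hardyExtension_sq hu hσ.le, eLpNorm_two_sq]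
      gcongr 1
      refine lintegral_mono_ae ?_
      filter_upwards [ae_restrict_mem measurableSet_Ioo] with t ht
      refine mul_le_of_le_one_left' (ENNReal.ofReal_le_one.2 ?_)
      exact Real.rpow_le_one ht.1.le ht.2.le (by linarith)
    rcases le_or_gt (eLpNorm (onLine (hardyExtension u) σ) 2 volume) 1 with h | h
    · exact h.trans le_add_self
    · refine le_trans (le_self_pow h.le two_ne_zero) (h1.trans le_self_add)
  boundary_memLp := memLp_onLine_hardyExtension hu le_rfl
  boundary_limit := by
    have h0 := tendsto_eLpNorm_expProfile_sub hu
    have h1 : Tendsto (fun σ : ℝ => (ENNReal.ofReal (2 * Real.pi) *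
        eLpNorm (expProfile u σ - expProfile u (-(1 / 2))) 2 volume ^ 2) ^ (1 / 2 : ℝ))
        (𝓝[>] (-(1 / 2))) (𝓝 0) := by
      have h2 := ENNReal.Tendsto.const_mul (a := ENNReal.ofReal (2 * Real.pi))
        (((ENNReal.continuous_pow 2).tendsto 0).comp h0) (Or.inr ENNReal.ofReal_ne_top)
      have h3 := (ENNReal.continuous_rpow_const (y := 1 / 2)).tendsto _ |>.comp h2
      simpa [Function.comp_def] using h3
    refine h1.congr' ?_
    filter_upwards [self_mem_nhdsWithin] with σ hσ
    have hσ : -(1 / 2) < σ := hσ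
    rw [← eLpNorm_lineTransform_sub_sq (memLp_expProfile hu hσ.le) (memLp_expProfile hu le_rfl),
      ← ENNReal.rpow_natCast, ← ENNReal.rpow_mul]
    norm_num
    refine eLpNorm_congr_ae ?_
    have := (onLine_hardyExtension_ae hu hσ.le).sub (onLine_hardyExtension_ae hu (le_refl (-(1 / 2))))
    norm_num at this
    exact this.symm

/-- Fourier inversion in L² with the change of variable ν = 2πξ, whose Jacobian is the 1/2π in
`lineNormL1`. -/
theorem norm_expProfile_le {u : ℝ → ℂ} (hu : MemLp u 2 unitVol) {σ : ℝ} (hσ : -(1 / 2) ≤ σ)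
    (hint : Integrable (onLine (hardyExtension u) σ)) :
    ∀ᵐ v, ‖expProfile u σ v‖ ≤ lineNormL1 (hardyExtension u) σ := by
  have h1 := memLp_expProfile hu hσ
  have h2pi : (2 * Real.pi) ≠ 0 := by positivity
  have hk : Integrable (fun ξ => lineTransform u σ (2 * Real.pi * ξ)) :=
    (hint.congr (onLine_hardyExtension_ae hu hσ)).comp_mul_left' h2pi
  have := norm_le_of_integrable_fourier (h := h1.toLp _) hk (by
    refine Eventually.of_forall fun ξ => ?_
    simp only [lineTransform, dif_pos h1]
    rw [inv_mul_cancel_left₀ h2pi])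
  filter_upwards [this, h1.coeFn_toLp] with v hv hv2
  rw [hv2] at hv
  refine hv.trans (le_of_eq ?_)
  rw [integral_scale (fun ν => ‖lineTransform u σ ν‖), lineNormL1, one_div, smul_eq_mul]
  congr 1
  refine integral_congr_ae ?_
  filter_upwards [onLine_hardyExtension_ae hu hσ] with ν hν
  rw [hν]

end

/-! ### Comparing the transforms of the two densities -/

/-- Dividing the difference of the two sides by (z+1)^p makes it bounded on Re z ≥ 0, where |z| ≤
|z+1| and 1 ≤ |z+1|. It vanishes at the positive integers, hence identically. -/
theorem cutMellin_eq_pow_mul {u w : ℝ → ℂ} (hu : MemLp u 2 unitVol) (hw : MemLp w 2 unitVol) {p : ℕ}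
    (h : ∀ n : ℕ, cutMellin w n = (n : ℂ) ^ p * cutMellin u n) :
    ∀ z ∈ halfPlane, cutMellin w z = z ^ p * cutMellin u z := by
  have hne : ∀ z ∈ halfPlane, z + 1 ≠ 0 := by
    intro z hz h
    have hz : -(1 / 2) < z.re := hz
    have := congrArg Complex.re h
    simp at this
    linarith
  have key := eqOn_zero_of_bounded_of_nat_zeros
    (g := fun z => (z ^ p * cutMellin u z - cutMellin w z) / (z + 1) ^ p)
    (M := (∫ t, ‖u t‖ ∂unitVol) + ∫ t, ‖w t‖ ∂unitVol) ?_ ?_ ?_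
  · intro z hz
    have := key hz
    simp only [Pi.zero_apply, div_eq_zero_iff, pow_eq_zero_iff', hne z hz, false_and, or_false] at this
    exact (sub_eq_zero.1 this).symm
  · refine DifferentiableOn.div (((by fun_prop : DifferentiableOn ℂ (fun z : ℂ => z ^ p) halfPlane).mul
      (differentiableOn_cutMellin hu)).sub (differentiableOn_cutMellin hw)) (by fun_prop) ?_
    exact fun z hz => pow_ne_zero _ (hne z hz)
  · intro z hz
    have h1 : 1 ≤ ‖z + 1‖ := by
      refine le_trans ?_ (Complex.re_le_norm _)
      simpa using hz
    have h2 : ‖z‖ ≤ ‖z + 1‖ := by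
      rw [Complex.norm_def, Complex.norm_def]
      refine Real.sqrt_le_sqrt ?_
      simp only [Complex.normSq_apply, Complex.add_re, Complex.add_im, Complex.one_re, Complex.one_im]
      nlinarith
    rw [norm_div, norm_pow, div_le_iff₀ (by positivity)]
    have h3 := norm_cutMellin_le hu hz
    have h4 := norm_cutMellin_le hw hz
    have h5 : 1 ≤ ‖z + 1‖ ^ p := one_le_pow₀ h1
    have h6 : ‖z‖ ^ p ≤ ‖z + 1‖ ^ p := by gcongr
    have h7 : 0 ≤ ∫ t, ‖w t‖ ∂unitVol := (norm_nonneg _).trans h4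
    calc _ ≤ ‖z‖ ^ p * ‖cutMellin u z‖ + ‖cutMellin w z‖ := by
          refine (norm_sub_le _ _).trans ?_
          rw [norm_mul, norm_pow]
      _ ≤ ‖z + 1‖ ^ p * (∫ t, ‖u t‖ ∂unitVol) + (∫ t, ‖w t‖ ∂unitVol) * 1 := by
          rw [mul_one]; gcongr
      _ ≤ ‖z + 1‖ ^ p * (∫ t, ‖u t‖ ∂unitVol) + (∫ t, ‖w t‖ ∂unitVol) * ‖z + 1‖ ^ p := by gcongr
      _ = _ := by ring
  · intro n
    have := h (n + 1)
    push_cast at this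
    rw [this, sub_self, zero_div]

/-! ### Hardy averages: dividing the transform by z and gaining a derivative -/

/-- The primitive `∫ₜ¹ w`. -/
noncomputable def tailPrimitive (w : ℝ → ℂ) (t : ℝ) : ℂ := ∫ s in Set.Ioo t 1, w s

/-- The Hardy average `t⁻¹ ∫ₜ¹ w`. -/
noncomputable def hardyAverage (w : ℝ → ℂ) (t : ℝ) : ℂ := (t : ℂ)⁻¹ * tailPrimitive w t

theorem tailPrimitive_eq_intervalIntegral (w : ℝ → ℂ) {t : ℝ} (ht : t ≤ 1) :
    tailPrimitive w t = ∫ s in t..1, w s := by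
  rw [intervalIntegral.integral_of_le ht, integral_Ioc_eq_integral_Ioo, tailPrimitive]

theorem intervalIntegrable_of_unitVol {w : ℝ → ℂ} (hw : Integrable w unitVol) {a b : ℝ}
    (ha : a ∈ Set.Icc (0 : ℝ) 1) (hb : b ∈ Set.Icc (0 : ℝ) 1) : IntervalIntegrable w volume a b := by
  have : IntervalIntegrable w volume 0 1 :=
    (intervalIntegrable_iff_integrableOn_Ioo_of_le zero_le_one).2 hw
  refine this.mono_set ?_
  rw [Set.uIcc_of_le (zero_le_one' ℝ)]
  exact Set.uIcc_subset_Icc ha hb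

theorem continuousOn_tailPrimitive {w : ℝ → ℂ} (hw : Integrable w unitVol) :
    ContinuousOn (tailPrimitive w) (Set.Icc 0 1) := by
  have h : IntegrableOn w (Set.uIcc 0 1) volume := by
    rw [Set.uIcc_of_le zero_le_one, integrableOn_Icc_iff_integrableOn_Ioo]
    exact hw
  have := intervalIntegral.continuousOn_primitive_interval_left h
  rw [Set.uIcc_of_le zero_le_one] at this
  exact this.congr fun t ht => tailPrimitive_eq_intervalIntegral w ht.2

theorem aestronglyMeasurable_hardyAverage {w : ℝ → ℂ} (hw : Integrable w unitVol) :
    AEStronglyMeasurable (hardyAverage w) unitVol := by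
  refine AEStronglyMeasurable.mul ?_
    (((continuousOn_tailPrimitive hw).mono Set.Ioo_subset_Icc_self).aestronglyMeasurable measurableSet_Ioo)
  exact (Complex.measurable_ofReal.inv).aestronglyMeasurable

theorem contDiffOn_tailPrimitive {w : ℝ → ℂ} (hw : Integrable w unitVol) {k : ℕ}
    (h : ContDiffOn ℝ k w (Set.Ioo 0 1)) : ContDiffOn ℝ (k + 1 : ℕ) (tailPrimitive w) (Set.Ioo 0 1) := by
  have hd : ∀ t ∈ Set.Ioo (0 : ℝ) 1, HasDerivAt (tailPrimitive w) (-w t) t := by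
    intro t ht
    have hnhds : Set.Ioo (0 : ℝ) 1 ∈ 𝓝 t := isOpen_Ioo.mem_nhds ht
    have h1 := intervalIntegral.integral_hasDerivAt_left
      (intervalIntegrable_of_unitVol hw ⟨ht.1.le, ht.2.le⟩ ⟨zero_le_one, le_rfl⟩)
      (h.continuousOn.stronglyMeasurableAtFilter isOpen_Ioo t ht)
      (h.continuousOn.continuousAt hnhds)
    refine h1.congr_of_eventuallyEq ?_
    filter_upwards [hnhds] with s hs
    exact tailPrimitive_eq_intervalIntegral w hs.2.le
  push_cast
  rw [contDiffOn_succ_iff_deriv_of_isOpen isOpen_Ioo]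
  refine ⟨fun t ht => (hd t ht).differentiableAt.differentiableWithinAt, by simp, ?_⟩
  exact h.neg.congr fun t ht => (hd t ht).deriv

theorem lintegral_rpow_Ioo {s a b : ℝ} (ha : 0 ≤ a) (hab : a ≤ b) (h : -1 < s ∨ s ≠ -1 ∧ 0 < a) :
    ∫⁻ t in Set.Ioo a b, ENNReal.ofReal (t ^ s) = ENNReal.ofReal ((b ^ (s + 1) - a ^ (s + 1)) / (s + 1)) := by
  have h' : -1 < s ∨ s ≠ -1 ∧ (0 : ℝ) ∉ Set.uIcc a b := by
    refine h.imp_right fun ⟨h1, h2⟩ => ⟨h1, ?_⟩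
    rw [Set.uIcc_of_le hab]
    exact fun h => absurd h.1 (not_le.2 h2)
  rw [← integral_rpow h', intervalIntegral.integral_of_le hab, integral_Ioc_eq_integral_Ioo,
    ofReal_integral_eq_lintegral_ofReal]
  · have : IntervalIntegrable (fun x : ℝ => x ^ s) volume a b := by
      rcases h' with h | ⟨_, h⟩
      · exact intervalIntegral.intervalIntegrable_rpow' h
      · exact intervalIntegral.intervalIntegrable_rpow (Or.inr h)
    exact (intervalIntegrable_iff_integrableOn_Ioo_of_le hab).1 this
  · filter_upwards [ae_restrict_mem measurableSet_Ioo] with t ht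
    exact Real.rpow_nonneg (ha.trans ht.1.le) _

/-- Cauchy–Schwarz after writing W = (s^(1/4) W) · s^(-1/4). -/
theorem sq_lintegral_Ioo_le (W : ℝ → ENNReal) {t : ℝ} (ht : 0 < t)
    (hW : AEMeasurable W (volume.restrict (Set.Ioo 0 t))) :
    (∫⁻ s in Set.Ioo 0 t, W s) ^ 2 ≤
      ENNReal.ofReal (2 * t ^ (1 / 2 : ℝ)) * ∫⁻ s in Set.Ioo 0 t, ENNReal.ofReal (s ^ (1 / 2 : ℝ)) * W s ^ 2 := by
  have h := ENNReal.lintegral_mul_le_Lp_mul_Lq (volume.restrict (Set.Ioo 0 t)) (p := 2) (q := 2)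
    Real.HolderConjugate.two_two (f := fun s => ENNReal.ofReal (s ^ (1 / 4 : ℝ)) * W s)
    (g := fun s => ENNReal.ofReal (s ^ (-(1 / 4) : ℝ))) (AEMeasurable.mul (by fun_prop) hW) (by fun_prop)
  have e1 : ∫⁻ s in Set.Ioo 0 t, ((fun s => ENNReal.ofReal (s ^ (1 / 4 : ℝ)) * W s) *
      fun s => ENNReal.ofReal (s ^ (-(1 / 4) : ℝ))) s = ∫⁻ s in Set.Ioo 0 t, W s := by
    refine setLIntegral_congr_fun measurableSet_Ioo fun s hs => ?_
    simp only [Pi.mul_apply]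
    rw [mul_right_comm, ← ENNReal.ofReal_mul (Real.rpow_nonneg hs.1.le _), ← Real.rpow_add hs.1]
    norm_num
  have e2 : ∫⁻ s in Set.Ioo 0 t, (ENNReal.ofReal (s ^ (1 / 4 : ℝ)) * W s) ^ (2 : ℝ) =
      ∫⁻ s in Set.Ioo 0 t, ENNReal.ofReal (s ^ (1 / 2 : ℝ)) * W s ^ 2 := by
    refine setLIntegral_congr_fun measurableSet_Ioo fun s hs => ?_
    rw [ENNReal.rpow_two, mul_pow, ← ENNReal.ofReal_pow (Real.rpow_nonneg hs.1.le _), ← Real.rpow_natCast (s ^ _),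
      ← Real.rpow_mul hs.1.le]
    norm_num
  have e3 : ∫⁻ s in Set.Ioo 0 t, (ENNReal.ofReal (s ^ (-(1 / 4) : ℝ))) ^ (2 : ℝ) =
      ENNReal.ofReal (2 * t ^ (1 / 2 : ℝ)) := by
    have : ∫⁻ s in Set.Ioo 0 t, (ENNReal.ofReal (s ^ (-(1 / 4) : ℝ))) ^ (2 : ℝ) =
        ∫⁻ s in Set.Ioo 0 t, ENNReal.ofReal (s ^ (-(1 / 2) : ℝ)) := by
      refine setLIntegral_congr_fun measurableSet_Ioo fun s hs => ?_
      rw [ENNReal.rpow_two, ← ENNReal.ofReal_pow (Real.rpow_nonneg hs.1.le _), ← Real.rpow_natCast (s ^ _),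
        ← Real.rpow_mul hs.1.le]
      norm_num
    rw [this, lintegral_rpow_Ioo le_rfl ht.le (Or.inl (by norm_num)), Real.zero_rpow (by norm_num)]
    congr 1
    rw [sub_zero, show (-(1 / 2) + 1 : ℝ) = 1 / 2 by norm_num]
    ring
  rw [e1, e2, e3] at h
  calc _ ≤ _ := pow_le_pow_left' h 2
    _ = _ := by
      rw [mul_pow, ← ENNReal.rpow_natCast, ← ENNReal.rpow_natCast, ← ENNReal.rpow_mul, ← ENNReal.rpow_mul]
      norm_num
      rw [mul_comm]

/-- Hardy's inequality. After the weighted Cauchy–Schwarz bound and Tonelli, the inner integral of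
2t^(-3/2) over (s,1) is at most 4s^(-1/2), which cancels the weight s^(1/2). -/
theorem lintegral_hardy_le {W : ℝ → ENNReal} (hW : AEMeasurable W unitVol) :
    ∫⁻ t, ENNReal.ofReal (t ^ (-2 : ℝ)) * (∫⁻ s in Set.Ioo 0 t, W s) ^ 2 ∂unitVol ≤
      4 * ∫⁻ s, W s ^ 2 ∂unitVol := by
  have h1 : ∀ t ∈ Set.Ioo (0 : ℝ) 1, ENNReal.ofReal (t ^ (-2 : ℝ)) * (∫⁻ s in Set.Ioo 0 t, W s) ^ 2 ≤
      ∫⁻ s, (Set.Ioi s).indicator (fun t => ENNReal.ofReal (2 * t ^ (-(3 / 2) : ℝ))) t *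
        (ENNReal.ofReal (s ^ (1 / 2 : ℝ)) * W s ^ 2) ∂unitVol := by
    intro t ht
    have hsub : Set.Ioo 0 t ⊆ Set.Ioo (0 : ℝ) 1 := Set.Ioo_subset_Ioo_right ht.2.le
    have h2 := sq_lintegral_Ioo_le W ht.1 (hW.mono_measure (Measure.restrict_mono hsub le_rfl))
    calc _ ≤ ENNReal.ofReal (t ^ (-2 : ℝ)) * (ENNReal.ofReal (2 * t ^ (1 / 2 : ℝ)) *
          ∫⁻ s in Set.Ioo 0 t, ENNReal.ofReal (s ^ (1 / 2 : ℝ)) * W s ^ 2) := by gcongr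
      _ = ENNReal.ofReal (2 * t ^ (-(3 / 2) : ℝ)) *
          ∫⁻ s in Set.Ioo 0 t, ENNReal.ofReal (s ^ (1 / 2 : ℝ)) * W s ^ 2 := by
          rw [← mul_assoc, ← ENNReal.ofReal_mul (Real.rpow_nonneg ht.1.le _), mul_left_comm, ← Real.rpow_add ht.1]
          norm_num
      _ = ∫⁻ s in Set.Ioo 0 t, ENNReal.ofReal (2 * t ^ (-(3 / 2) : ℝ)) *
          (ENNReal.ofReal (s ^ (1 / 2 : ℝ)) * W s ^ 2) := by
          rw [lintegral_const_mul' _ _ ENNReal.ofReal_ne_top]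
      _ = ∫⁻ s in Set.Ioo 0 t, (Set.Ioi s).indicator (fun t => ENNReal.ofReal (2 * t ^ (-(3 / 2) : ℝ))) t *
          (ENNReal.ofReal (s ^ (1 / 2 : ℝ)) * W s ^ 2) := by
          refine setLIntegral_congr_fun measurableSet_Ioo fun s hs => ?_
          rw [Set.indicator_of_mem (show t ∈ Set.Ioi s from hs.2)]
      _ ≤ _ := lintegral_mono_set hsub
  refine (setLIntegral_mono' measurableSet_Ioo h1).trans ?_
  rw [lintegral_lintegral_swap]
  · rw [← lintegral_const_mul' _ _ (by norm_num)]
    refine setLIntegral_mono' measurableSet_Ioo fun s hs => ?_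
    have hmeas : Measurable ((Set.Ioi s).indicator (fun t : ℝ => ENNReal.ofReal (2 * t ^ (-(3 / 2) : ℝ)))) :=
      Measurable.indicator (by fun_prop) measurableSet_Ioi
    have hin : ∫⁻ t, (Set.Ioi s).indicator (fun t : ℝ => ENNReal.ofReal (2 * t ^ (-(3 / 2) : ℝ))) t ∂unitVol ≤
        ENNReal.ofReal (4 * s ^ (-(1 / 2) : ℝ)) := by
      rw [setLIntegral_indicator measurableSet_Ioi]
      have hset : Set.Ioi s ∩ Set.Ioo 0 1 = Set.Ioo s 1 := by
        ext t
        constructor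
        · rintro ⟨h1, h2⟩; exact ⟨h1, h2.2⟩
        · rintro ⟨h1, h2⟩; exact ⟨h1, hs.1.trans h1, h2⟩
      rw [hset]
      simp_rw [ENNReal.ofReal_mul (show (0 : ℝ) ≤ 2 by norm_num)]
      rw [lintegral_const_mul' _ _ ENNReal.ofReal_ne_top,
        lintegral_rpow_Ioo hs.1.le hs.2.le (Or.inr ⟨by norm_num, hs.1⟩), ← ENNReal.ofReal_mul zero_le_two]
      refine ENNReal.ofReal_le_ofReal ?_
      rw [show (-(3 / 2) + 1 : ℝ) = -(1 / 2) by norm_num, Real.one_rpow]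
      linarith
    rw [lintegral_mul_const _ hmeas]
    calc _ ≤ ENNReal.ofReal (4 * s ^ (-(1 / 2) : ℝ)) * (ENNReal.ofReal (s ^ (1 / 2 : ℝ)) * W s ^ 2) := by gcongr
      _ = _ := by
        have h4 : 0 ≤ s ^ (-(1 / 2) : ℝ) := Real.rpow_nonneg hs.1.le _
        rw [← mul_assoc, ← ENNReal.ofReal_mul (by positivity), mul_assoc, ← Real.rpow_add hs.1]
        norm_num
  · have hset : MeasurableSet {q : ℝ × ℝ | q.2 < q.1} := measurableSet_lt measurable_snd measurable_fst
    have h1 : Measurable ({q : ℝ × ℝ | q.2 < q.1}.indicator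
        (fun q => ENNReal.ofReal (2 * q.1 ^ (-(3 / 2) : ℝ)))) := Measurable.indicator (by fun_prop) hset
    have h2 : AEMeasurable (fun s : ℝ => ENNReal.ofReal (s ^ (1 / 2 : ℝ)) * W s ^ 2) unitVol :=
      AEMeasurable.mul (by fun_prop) (hW.pow_const 2)
    exact h1.aemeasurable.mul h2.comp_snd

/-- Mean zero turns ∫ₜ¹ w into -∫₀ᵗ w, to which Hardy's inequality applies. With a nonzero mean the
average would behave like a multiple of 1/t at 0. -/
theorem memLp_hardyAverage {w : ℝ → ℂ} (hw : MemLp w 2 unitVol) (h0 : ∫ t, w t ∂unitVol = 0) :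
    MemLp (hardyAverage w) 2 unitVol := by
  have hwi : Integrable w unitVol := hw.integrable (by norm_num)
  refine memLp_two_of_lintegral (aestronglyMeasurable_hardyAverage hwi) ?_
  have hb := lintegral_hardy_le (W := fun s => ‖w s‖ₑ) hw.1.enorm
  refine ne_top_of_le_ne_top ?_ ((lintegral_mono_ae ?_).trans hb)
  · rw [← eLpNorm_two_sq]
    exact ENNReal.mul_ne_top (by norm_num) (ENNReal.pow_ne_top hw.2.ne)
  · filter_upwards [ae_restrict_mem measurableSet_Ioo] with t ht
    have htail : tailPrimitive w t = -∫ s in Set.Ioo 0 t, w s := by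
      have h1 := intervalIntegral.integral_add_adjacent_intervals
        (intervalIntegrable_of_unitVol hwi (a := 0) (b := t) ⟨le_rfl, zero_le_one⟩ ⟨ht.1.le, ht.2.le⟩)
        (intervalIntegrable_of_unitVol hwi (a := t) (b := 1) ⟨ht.1.le, ht.2.le⟩ ⟨zero_le_one, le_rfl⟩)
      rw [← tailPrimitive_eq_intervalIntegral w ht.2.le, intervalIntegral.integral_of_le zero_le_one,
        integral_Ioc_eq_integral_Ioo, h0, intervalIntegral.integral_of_le ht.1.le,
        integral_Ioc_eq_integral_Ioo] at h1
      exact eq_neg_of_add_eq_zero_right h1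
    rw [hardyAverage, enorm_mul, mul_pow, htail, enorm_neg]
    gcongr
    · rw [← ofReal_norm, ← ENNReal.ofReal_pow (norm_nonneg _), norm_inv, Complex.norm_real,
        Real.norm_of_nonneg ht.1.le, Real.rpow_neg ht.1.le, inv_pow]
      norm_num
    · exact enorm_integral_le_lintegral_enorm _

/-- Fubini on the triangle t < s, with ∫₀ˢ t^(z-1) dt = s^z / z. Absolute convergence needs Re z >
0; the identity theorem later extends the relation to the whole half-plane. -/
theorem mul_cutMellin_hardyAverage_of_pos {w : ℝ → ℂ} (hw : Integrable w unitVol) {z : ℂ} (hz : 0 < z.re) :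
    z * cutMellin (hardyAverage w) z = cutMellin w z := by
  have hz0 : z ≠ 0 := by rintro rfl; simp at hz
  have hset : MeasurableSet {q : ℝ × ℝ | q.1 < q.2} := measurableSet_lt measurable_fst measurable_snd
  have hpow : Integrable (fun t : ℝ => (t : ℂ) ^ (z - 1)) unitVol := by
    have : IntervalIntegrable (fun t : ℝ => (t : ℂ) ^ (z - 1)) volume 0 1 :=
      intervalIntegral.intervalIntegrable_cpow' (by simpa using hz)
    exact (intervalIntegrable_iff_integrableOn_Ioo_of_le zero_le_one).1 this
  have hprod : Integrable ({q : ℝ × ℝ | q.1 < q.2}.indicator (fun q => (q.1 : ℂ) ^ (z - 1) * w q.2))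
      (unitVol.prod unitVol) := (hpow.mul_prod hw).indicator hset
  have h1 : cutMellin (hardyAverage w) z = ∫ t, ∫ s, {q : ℝ × ℝ | q.1 < q.2}.indicator
      (fun q => (q.1 : ℂ) ^ (z - 1) * w q.2) (t, s) ∂unitVol ∂unitVol := by
    refine integral_congr_ae ?_
    filter_upwards [ae_restrict_mem measurableSet_Ioo] with t ht
    have ht0 : (t : ℂ) ≠ 0 := by exact_mod_cast ht.1.ne'
    have e : ∀ s, {q : ℝ × ℝ | q.1 < q.2}.indicator (fun q => (q.1 : ℂ) ^ (z - 1) * w q.2) (t, s) =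
        (Set.Ioi t).indicator (fun s => (t : ℂ) ^ (z - 1) * w s) s := by
      intro s
      by_cases h : t < s
      · rw [Set.indicator_of_mem (show (t, s) ∈ {q : ℝ × ℝ | q.1 < q.2} from h),
          Set.indicator_of_mem (show s ∈ Set.Ioi t from h)]
      · rw [Set.indicator_of_notMem (show (t, s) ∉ {q : ℝ × ℝ | q.1 < q.2} from h),
          Set.indicator_of_notMem (show s ∉ Set.Ioi t from h)]
    simp only [e]
    rw [integral_indicator measurableSet_Ioi, Measure.restrict_restrict measurableSet_Ioi]
    have hset : Set.Ioi t ∩ Set.Ioo 0 1 = Set.Ioo t 1 := by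
      ext s
      constructor
      · rintro ⟨h1, h2⟩; exact ⟨h1, h2.2⟩
      · rintro ⟨h1, h2⟩; exact ⟨h1, ht.1.trans h1, h2⟩
    rw [hset, integral_const_mul, hardyAverage, tailPrimitive, ← mul_assoc, Complex.cpow_sub _ _ ht0,
      Complex.cpow_one, div_eq_mul_inv]
  rw [h1, integral_integral_swap (f := fun t s => {q : ℝ × ℝ | q.1 < q.2}.indicator
      (fun q => (q.1 : ℂ) ^ (z - 1) * w q.2) (t, s)) hprod, ← integral_const_mul]
  refine integral_congr_ae ?_
  filter_upwards [ae_restrict_mem measurableSet_Ioo] with s hs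
  have e : ∀ t, {q : ℝ × ℝ | q.1 < q.2}.indicator (fun q => (q.1 : ℂ) ^ (z - 1) * w q.2) (t, s) =
      (Set.Iio s).indicator (fun t : ℝ => (t : ℂ) ^ (z - 1) * w s) t := by
    intro t
    by_cases h : t < s
    · rw [Set.indicator_of_mem (show (t, s) ∈ {q : ℝ × ℝ | q.1 < q.2} from h),
        Set.indicator_of_mem (show t ∈ Set.Iio s from h)]
    · rw [Set.indicator_of_notMem (show (t, s) ∉ {q : ℝ × ℝ | q.1 < q.2} from h),
        Set.indicator_of_notMem (show t ∉ Set.Iio s from h)]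
  simp only [e]
  rw [integral_indicator measurableSet_Iio, Measure.restrict_restrict measurableSet_Iio]
  have hset : Set.Iio s ∩ Set.Ioo 0 1 = Set.Ioo 0 s := by
    ext t
    constructor
    · rintro ⟨h1, h2⟩; exact ⟨h2.1, h1⟩
    · rintro ⟨h1, h2⟩; exact ⟨h2, h1, h2.trans hs.2⟩
  rw [hset, integral_mul_const, ← integral_Ioc_eq_integral_Ioo, ← intervalIntegral.integral_of_le hs.1.le,
    integral_cpow (Or.inl (by simpa using hz)), sub_add_cancel, Complex.ofReal_zero, Complex.zero_cpow hz0,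
    sub_zero]
  field_simp

theorem eqOn_halfPlane_of_eq_of_pos {g h : ℂ → ℂ} (hg : DifferentiableOn ℂ g halfPlane)
    (hh : DifferentiableOn ℂ h halfPlane) (H : ∀ z : ℂ, 0 < z.re → g z = h z) : Set.EqOn g h halfPlane := by
  refine (hg.analyticOnNhd isOpen_halfPlane).eqOn_of_preconnected_of_eventuallyEq
    (hh.analyticOnNhd isOpen_halfPlane) isPreconnected_halfPlane (z₀ := 1) ?_ ?_
  · change -(1 / 2) < (1 : ℂ).re
    norm_num
  · filter_upwards [(isOpen_lt continuous_const Complex.continuous_re).mem_nhds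
      (show (1 : ℂ) ∈ {z : ℂ | 0 < z.re} by simp)] with z hz
    exact H z hz

theorem mul_cutMellin_hardyAverage {w : ℝ → ℂ} (hw : MemLp w 2 unitVol) (h0 : ∫ t, w t ∂unitVol = 0)
    {z : ℂ} (hz : z ∈ halfPlane) : z * cutMellin (hardyAverage w) z = cutMellin w z :=
  eqOn_halfPlane_of_eq_of_pos (differentiableOn_id.mul (differentiableOn_cutMellin (memLp_hardyAverage hw h0)))
    (differentiableOn_cutMellin hw)
    (fun _ h => mul_cutMellin_hardyAverage_of_pos (hw.integrable (by norm_num)) h) hz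

/-- Each Hardy average lowers the power of z in the transform by one and raises the smoothness of
the tail primitive by one. It stops at the first power of z, so the density obtained still carries
the factor z needed for the logarithmic potential. -/
theorem exists_hardyAverage_ladder {u : ℝ → ℂ} (hu : MemLp u 2 unitVol) (q : ℕ) :
    ∀ (w : ℝ → ℂ) (k : ℕ), MemLp w 2 unitVol → (∀ z ∈ halfPlane, cutMellin w z = z ^ (q + 1) * cutMellin u z) →
      ContDiffOn ℝ k (tailPrimitive w) (Set.Ioo 0 1) →
      ∃ v : ℝ → ℂ, MemLp v 2 unitVol ∧ (∀ z ∈ halfPlane, cutMellin v z = z * cutMellin u z) ∧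
        ContDiffOn ℝ (k + q : ℕ) (tailPrimitive v) (Set.Ioo 0 1) := by
  induction q with
  | zero =>
    intro w k hw h hk
    exact ⟨w, hw, by simpa using h, by simpa using hk⟩
  | succ q ih =>
    intro w k hw h hk
    have h00 : (0 : ℂ) ∈ halfPlane := by simp [halfPlane]
    -- The point z = 0 lies in the half-plane and the transform of w carries a positive power of z,
    -- so w has mean zero.
    have h0 : ∫ t, w t ∂unitVol = 0 := by
      have := h 0 h00
      simpa [cutMellin] using this
    have hJ := memLp_hardyAverage hw h0
    have hne : ∀ z ∈ halfPlane, z ≠ 0 → cutMellin (hardyAverage w) z = z ^ (q + 1) * cutMellin u z := by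
      intro z hz hz0
      refine mul_left_cancel₀ hz0 ?_
      rw [mul_cutMellin_hardyAverage hw h0 hz, h z hz]
      ring
    have hall := eqOn_halfPlane_of_eq_of_pos (differentiableOn_cutMellin hJ)
      ((by fun_prop : DifferentiableOn ℂ (fun z : ℂ => z ^ (q + 1)) halfPlane).mul (differentiableOn_cutMellin hu))
      (fun z hz => hne z (by change -(1 / 2) < z.re; linarith) (by rintro rfl; simp at hz))
    have hJc : ContDiffOn ℝ k (hardyAverage w) (Set.Ioo 0 1) := by
      refine ContDiffOn.mul (ContDiffOn.inv Complex.ofRealCLM.contDiff.contDiffOn fun t ht => ?_) hk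
      simpa using ht.1.ne'
    obtain ⟨v, h1, h2, h3⟩ := ih (hardyAverage w) (k + 1) hJ hall
      (contDiffOn_tailPrimitive (hJ.integrable (by norm_num)) hJc)
    exact ⟨v, h1, h2, by rwa [show k + (q + 1) = k + 1 + q by ring]⟩

/-! ### Integrability on vertical lines and the bound on the jump -/

/-- From (1 + |ν|)|g| ≤ |g| + |h|, the function g is dominated by a product of two L² functions, one
of them 1/(1 + |ν|). -/
theorem integrable_of_memLp_of_mul {g h : ℝ → ℂ} {σ : ℝ} (hg : MemLp g 2 volume) (hh : MemLp h 2 volume)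
    (H : ∀ᵐ ν : ℝ, h ν = ((σ : ℂ) + (ν : ℂ) * Complex.I) * g ν) : Integrable g volume := by
  have hk : MemLp (fun ν : ℝ => (1 + |ν|)⁻¹) 2 volume := by
    rw [memLp_two_iff_integrable_sq (by fun_prop)]
    refine integrable_inv_one_add_sq.mono' (by fun_prop) (Eventually.of_forall fun ν => ?_)
    rw [Real.norm_of_nonneg (by positivity), inv_pow]
    gcongr
    nlinarith [abs_nonneg ν, sq_abs ν]
  refine ((hg.norm.add hh.norm).integrable_mul hk).mono' hg.1 ?_
  filter_upwards [H] with ν hν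
  have h1 : |ν| ≤ ‖(σ : ℂ) + (ν : ℂ) * Complex.I‖ := by
    have := Complex.abs_im_le_norm ((σ : ℂ) + (ν : ℂ) * Complex.I)
    simpa using this
  simp only [Pi.mul_apply, Pi.add_apply]
  rw [← div_eq_mul_inv, le_div_iff₀ (by positivity), hν, norm_mul]
  nlinarith [norm_nonneg (g ν)]

/-- On the boundary line only L² limits are available; they converge almost everywhere along a
subsequence, and the relation valid inside passes to the limit. -/
theorem onLine_mul_ae {u v : ℝ → ℂ} (hu : MemLp u 2 unitVol) (hv : MemLp v 2 unitVol)
    (h : ∀ z ∈ halfPlane, cutMellin v z = z * cutMellin u z) {σ : ℝ} (hσ : -(1 / 2) ≤ σ) :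
    ∀ᵐ ν : ℝ, onLine (hardyExtension v) σ ν = ((σ : ℂ) + (ν : ℂ) * Complex.I) * onLine (hardyExtension u) σ ν := by
  have hopen : ∀ τ : ℝ, -(1 / 2) < τ → ∀ ν : ℝ, onLine (hardyExtension v) τ ν =
      ((τ : ℂ) + (ν : ℂ) * Complex.I) * onLine (hardyExtension u) τ ν := by
    intro τ hτ ν
    have hm : ((τ : ℂ) + (ν : ℂ) * Complex.I) ∈ halfPlane := by
      simpa [halfPlane] using hτ
    rw [onLine, onLine, hardyExtension_of_mem hm, hardyExtension_of_mem hm, h _ hm]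
  rcases hσ.lt_or_eq with hσ | rfl
  · exact Eventually.of_forall (hopen σ hσ)
  have hs1 : Tendsto (fun n : ℕ => (-(1 / 2) + 1 / ((n : ℝ) + 1) : ℝ)) atTop (𝓝[>] (-(1 / 2))) := by
    refine tendsto_nhdsWithin_iff.2 ⟨?_, Eventually.of_forall fun n => ?_⟩
    · have := (tendsto_one_div_add_atTop_nhds_zero_nat (𝕜 := ℝ)).const_add (-(1 / 2))
      rwa [add_zero] at this
    · have : (0 : ℝ) < 1 / ((n : ℝ) + 1) := by positivity
      simp only [Set.mem_Ioi]; linarith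
  have hs2 : ∀ n : ℕ, -(1 / 2) < (-(1 / 2) + 1 / ((n : ℝ) + 1) : ℝ) := by
    intro n
    have : (0 : ℝ) < 1 / ((n : ℝ) + 1) := by positivity
    linarith
  have hmeas : ∀ {w : ℝ → ℂ}, MemLp w 2 unitVol → ∀ n : ℕ,
      MemLp (onLine (hardyExtension w) (-(1 / 2) + 1 / ((n : ℝ) + 1))) 2 volume :=
    fun hw n => memLp_onLine_hardyExtension hw (hs2 n).le
  have hlim : ∀ {w : ℝ → ℂ}, MemLp w 2 unitVol → TendstoInMeasure volume
      (fun n : ℕ => onLine (hardyExtension w) (-(1 / 2) + 1 / ((n : ℝ) + 1))) atTop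
      (onLine (hardyExtension w) (-(1 / 2))) := by
    intro w hw
    exact tendstoInMeasure_of_tendsto_eLpNorm two_ne_zero (fun n => (hmeas hw n).1)
      (memLp_onLine_hardyExtension hw le_rfl).1 ((memHardyH2_hardyExtension hw).boundary_limit.comp hs1)
  obtain ⟨k, hk, hk2⟩ := (hlim hu).exists_seq_tendsto_ae
  have hlv := (hlim hv)
  -- A second extraction, inside the subsequence found for u, makes both limits hold along the same
  -- indices.
  obtain ⟨l, hl, hl2⟩ := (TendstoInMeasure.comp hlv hk.tendsto_atTop).exists_seq_tendsto_ae
  filter_upwards [hk2, hl2] with ν h1 h2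
  have h3 := h1.comp hl.tendsto_atTop
  have h4 : Tendsto (fun n : ℕ => (((-(1 / 2) + 1 / (((k (l n) : ℕ) : ℝ) + 1) : ℝ) : ℂ) + (ν : ℂ) * Complex.I))
      atTop (𝓝 (((-(1 / 2) : ℝ) : ℂ) + (ν : ℂ) * Complex.I)) := by
    refine Tendsto.add_const _ ?_
    refine (Complex.continuous_ofReal.tendsto _).comp ?_
    exact (tendsto_nhdsWithin_iff.1 hs1).1.comp (hk.tendsto_atTop.comp hl.tendsto_atTop)
  refine tendsto_nhds_unique h2 ((h4.mul h3).congr fun n => ?_)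
  exact (hopen _ (hs2 _) ν).symm

theorem integrable_onLine_hardyExtension {u v : ℝ → ℂ} (hu : MemLp u 2 unitVol) (hv : MemLp v 2 unitVol)
    (h : ∀ z ∈ halfPlane, cutMellin v z = z * cutMellin u z) {σ : ℝ} (hσ : -(1 / 2) ≤ σ) :
    Integrable (onLine (hardyExtension u) σ) :=
  integrable_of_memLp_of_mul (memLp_onLine_hardyExtension hu hσ) (memLp_onLine_hardyExtension hv hσ)
    (onLine_mul_ae hu hv h hσ)

theorem forall_norm_le_of_ae {g : ℝ → ℂ} {s : Set ℝ} (hs : IsOpen s) (hg : ContinuousOn g s) {C : ℝ}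
    (h : ∀ᵐ y, y ∈ s → ‖g y‖ ≤ C) : ∀ y ∈ s, ‖g y‖ ≤ C := by
  by_contra! hcon
  obtain ⟨y, hy, hyC⟩ := hcon
  have hopen : IsOpen (s ∩ (fun y => ‖g y‖) ⁻¹' Set.Ioi C) := hg.norm.isOpen_inter_preimage hs isOpen_Ioi
  have hpos := hopen.measure_pos volume ⟨y, hy, hyC⟩
  refine hpos.ne' (measure_mono_null ?_ (ae_iff.1 h))
  rintro x ⟨hx, hxC⟩ hcon
  exact absurd (hcon hx) (not_le.2 hxC)

/-- The factor t in the profile cancels the 1/t of the Hardy average, so at y = log x the profile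
equals x^(-σ) times the tail primitive at 1/x. Continuity upgrades the almost everywhere bound to
every point. -/
theorem norm_tailPrimitive_inv_le {v : ℝ → ℂ} (hv : Integrable v unitVol) (hJ : MemLp (hardyAverage v) 2 unitVol)
    {σ : ℝ} (hσ : -(1 / 2) ≤ σ) (hint : Integrable (onLine (hardyExtension (hardyAverage v)) σ))
    {x : ℝ} (hx : 1 < x) :
    ‖tailPrimitive v x⁻¹‖ ≤ lineNormL1 (hardyExtension (hardyAverage v)) σ * x ^ σ := by
  have h1 := norm_expProfile_le hJ hσ hint
  have hmem : ∀ y ∈ Set.Ioi (0 : ℝ), Real.exp (-y) ∈ Set.Ioo (0 : ℝ) 1 := fun y hy =>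
    ⟨Real.exp_pos _, by rw [Real.exp_lt_one_iff]; simpa using hy⟩
  have h2 : ∀ y ∈ Set.Ioi (0 : ℝ), expProfile (hardyAverage v) σ y =
      Real.exp (-σ * y) • tailPrimitive v (Real.exp (-y)) := by
    intro y hy
    rw [expProfile, Set.indicator_of_mem (hmem y hy), hardyAverage, mul_inv_cancel_left₀]
    exact_mod_cast (Real.exp_pos _).ne'
  have hcont : ContinuousOn (fun y => Real.exp (-σ * y) • tailPrimitive v (Real.exp (-y))) (Set.Ioi 0) := by
    refine ContinuousOn.smul (f := fun y => Real.exp (-σ * y)) (by fun_prop) ?_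
    exact (continuousOn_tailPrimitive hv).comp (by fun_prop) fun y hy => Set.Ioo_subset_Icc_self (hmem y hy)
  have h3 := forall_norm_le_of_ae isOpen_Ioi hcont (h1.mono fun y hy hy0 => by rwa [h2 y hy0] at hy)
    (Real.log x) (Real.log_pos hx)
  have hx0 : 0 < x := by linarith
  rw [norm_smul, Real.norm_of_nonneg (Real.exp_pos _).le, Real.exp_neg, Real.exp_log hx0] at h3
  rw [Real.rpow_def_of_pos hx0, ← div_le_iff₀ (Real.exp_pos _), div_eq_mul_inv, ← Real.exp_neg, mul_comm]
  rwa [show -(Real.log x * σ) = -σ * Real.log x by ring]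

/-! ### The inversion x = 1/t: Mellin and Plancherel formulas on (1, ∞) -/

theorem integrableOn_Ioi_one_iff_comp_inv {E : Type*} [NormedAddCommGroup E] [NormedSpace ℝ E] (G : ℝ → E) :
    IntegrableOn (fun t : ℝ => t ^ (-2 : ℝ) • G t⁻¹) (Set.Ioo 0 1) ↔ IntegrableOn G (Set.Ioi 1) := by
  have h := integrableOn_Ioi_comp_rpow_iff ((Set.Ioi (1 : ℝ)).indicator G) (p := -1) (by norm_num)
  have e : Set.EqOn (fun x : ℝ => (|(-1 : ℝ)| * x ^ ((-1 : ℝ) - 1)) • (Set.Ioi (1 : ℝ)).indicator G (x ^ (-1 : ℝ)))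
      ((Set.Ioo (0 : ℝ) 1).indicator (fun t : ℝ => t ^ (-2 : ℝ) • G t⁻¹)) (Set.Ioi 0) := by
    intro x hx
    have hx : 0 < x := hx
    simp only
    rw [Real.rpow_neg_one, abs_neg, abs_one, one_mul, show (-1 - 1 : ℝ) = -2 by norm_num]
    by_cases hx1 : x < 1
    · rw [Set.indicator_of_mem (show x⁻¹ ∈ Set.Ioi (1 : ℝ) from (one_lt_inv₀ hx).2 hx1),
        Set.indicator_of_mem (show x ∈ Set.Ioo (0 : ℝ) 1 from ⟨hx, hx1⟩)]
    · rw [Set.indicator_of_notMem (show x⁻¹ ∉ Set.Ioi (1 : ℝ) from fun h => hx1 ((one_lt_inv₀ hx).1 h)),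
        Set.indicator_of_notMem (show x ∉ Set.Ioo (0 : ℝ) 1 from fun h => hx1 h.2), smul_zero]
  rw [integrableOn_congr_fun e measurableSet_Ioi, integrableOn_indicator_iff measurableSet_Ioo,
    integrableOn_indicator_iff measurableSet_Ioi] at h
  rwa [Set.inter_eq_left.2 (fun t ht => ht.1), Set.inter_eq_left.2 (Set.Ioi_subset_Ioi zero_le_one)] at h

theorem integral_Ioo_comp_inv {E : Type*} [NormedAddCommGroup E] [NormedSpace ℝ E] (G : ℝ → E) :
    ∫ t in Set.Ioo (0 : ℝ) 1, t ^ (-2 : ℝ) • G t⁻¹ = ∫ x in Set.Ioi (1 : ℝ), G x := by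
  have h := integral_comp_rpow_Ioi ((Set.Ioi (1 : ℝ)).indicator G) (p := -1) (by norm_num)
  have e : Set.EqOn (fun x : ℝ => (|(-1 : ℝ)| * x ^ ((-1 : ℝ) - 1)) • (Set.Ioi (1 : ℝ)).indicator G (x ^ (-1 : ℝ)))
      ((Set.Ioo (0 : ℝ) 1).indicator (fun t : ℝ => t ^ (-2 : ℝ) • G t⁻¹)) (Set.Ioi 0) := by
    intro x hx
    have hx : 0 < x := hx
    simp only
    rw [Real.rpow_neg_one, abs_neg, abs_one, one_mul, show (-1 - 1 : ℝ) = -2 by norm_num]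
    by_cases hx1 : x < 1
    · rw [Set.indicator_of_mem (show x⁻¹ ∈ Set.Ioi (1 : ℝ) from (one_lt_inv₀ hx).2 hx1),
        Set.indicator_of_mem (show x ∈ Set.Ioo (0 : ℝ) 1 from ⟨hx, hx1⟩)]
    · rw [Set.indicator_of_notMem (show x⁻¹ ∉ Set.Ioi (1 : ℝ) from fun h => hx1 ((one_lt_inv₀ hx).1 h)),
        Set.indicator_of_notMem (show x ∉ Set.Ioo (0 : ℝ) 1 from fun h => hx1 h.2), smul_zero]
  rw [setIntegral_congr_fun measurableSet_Ioi e, setIntegral_indicator measurableSet_Ioo,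
    setIntegral_indicator measurableSet_Ioi] at h
  rwa [Set.inter_eq_right.2 (fun t ht => ht.1), Set.inter_eq_right.2 (Set.Ioi_subset_Ioi zero_le_one)] at h

theorem mellin_tailPrimitive_inv {v : ℝ → ℂ} (hJ : MemLp (hardyAverage v) 2 unitVol) {z : ℂ}
    (hz : z ∈ halfPlane) :
    IntegrableOn (fun x : ℝ => tailPrimitive v x⁻¹ * (x : ℂ) ^ (-z - 1)) (Set.Ioi 1) ∧
      cutMellin (hardyAverage v) z = ∫ x in Set.Ioi (1 : ℝ), tailPrimitive v x⁻¹ * (x : ℂ) ^ (-z - 1) := by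
  have e : Set.EqOn (fun t : ℝ => (t : ℂ) ^ z * hardyAverage v t)
      (fun t : ℝ => t ^ (-2 : ℝ) • (tailPrimitive v t⁻¹⁻¹ * ((t⁻¹ : ℝ) : ℂ) ^ (-z - 1))) (Set.Ioo 0 1) := by
    intro t ht
    have ht0 : (t : ℂ) ≠ 0 := by exact_mod_cast ht.1.ne'
    have hpi : (t : ℂ).arg ≠ Real.pi := by
      rw [Complex.arg_ofReal_of_nonneg ht.1.le]
      exact Real.pi_pos.ne
    simp only
    rw [inv_inv, hardyAverage, Complex.real_smul, Complex.ofReal_inv, Complex.inv_cpow _ _ hpi, ← Complex.cpow_neg,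
      show -(-z - 1) = z + 1 by ring, Complex.cpow_add _ _ ht0, Complex.cpow_one, Real.rpow_neg ht.1.le]
    push_cast
    norm_num
    field_simp
  rw [← integrableOn_Ioi_one_iff_comp_inv, ← integral_Ioo_comp_inv, ← integrableOn_congr_fun e measurableSet_Ioo,
    ← setIntegral_congr_fun measurableSet_Ioo e]
  exact ⟨integrable_cpow_mul hJ hz, rfl⟩

/-- The inversion turns the integral over (1, ∞) into that of t^(2σ+1) |T(t)/t|² over (0,1), with T
the tail primitive, which Plancherel has already computed. -/
theorem plancherel_tailPrimitive_inv {v : ℝ → ℂ} (hJ : MemLp (hardyAverage v) 2 unitVol) {σ : ℝ}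
    (hσ : -(1 / 2) ≤ σ) :
    Integrable (fun ν : ℝ => ‖onLine (hardyExtension (hardyAverage v)) σ ν‖ ^ 2) ∧
      IntegrableOn (fun x : ℝ => ‖tailPrimitive v x⁻¹‖ ^ 2 * x ^ (-2 * σ - 1)) (Set.Ioi 1) ∧
      ∫ ν : ℝ, ‖onLine (hardyExtension (hardyAverage v)) σ ν‖ ^ 2 =
        2 * Real.pi * ∫ x in Set.Ioi (1 : ℝ), ‖tailPrimitive v x⁻¹‖ ^ 2 * x ^ (-2 * σ - 1) := by
  have e : Set.EqOn (fun t : ℝ => t ^ (2 * σ + 1) * ‖hardyAverage v t‖ ^ 2)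
      (fun t : ℝ => t ^ (-2 : ℝ) • (‖tailPrimitive v t⁻¹⁻¹‖ ^ 2 * (t⁻¹ : ℝ) ^ (-2 * σ - 1))) (Set.Ioo 0 1) := by
    intro t ht
    simp only
    rw [inv_inv, hardyAverage, norm_mul, norm_inv, Complex.norm_real, Real.norm_of_nonneg ht.1.le, smul_eq_mul,
      Real.inv_rpow ht.1.le, ← Real.rpow_neg ht.1.le, mul_pow, inv_pow, Real.rpow_neg ht.1.le]
    norm_num
    ring_nf
  have hi := memLp_onLine_hardyExtension hJ hσ
  have hm : AEStronglyMeasurable (fun t : ℝ => t ^ (2 * σ + 1) * ‖hardyAverage v t‖ ^ 2) unitVol :=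
    AEStronglyMeasurable.mul (by fun_prop) (hJ.1.norm.pow 2)
  rw [← integrableOn_Ioi_one_iff_comp_inv, ← integral_Ioo_comp_inv, ← integrableOn_congr_fun e measurableSet_Ioo,
    ← setIntegral_congr_fun measurableSet_Ioo e]
  refine ⟨(memLp_two_iff_integrable_sq_norm hi.1).1 hi, ?_, ?_⟩
  · refine ((memLp_two_iff_integrable_sq_norm hJ.1).1 hJ).mono' hm ?_
    filter_upwards [ae_restrict_mem measurableSet_Ioo] with t ht
    rw [norm_mul, Real.norm_of_nonneg (Real.rpow_nonneg ht.1.le _), Real.norm_of_nonneg (by positivity)]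
    exact mul_le_of_le_one_left (by positivity) (Real.rpow_le_one ht.1.le ht.2.le (by linarith))
  · rw [integral_eq_lintegral_of_nonneg_ae (Eventually.of_forall fun ν => sq_nonneg _)
        (f := fun ν => ‖onLine (hardyExtension (hardyAverage v)) σ ν‖ ^ 2) (hi.1.norm.pow 2),
      integral_eq_lintegral_of_nonneg_ae ?_ hm]
    · have h1 := lintegral_onLine_hardyExtension_sq hJ hσ
      have h2 : ∀ ν, ENNReal.ofReal (‖onLine (hardyExtension (hardyAverage v)) σ ν‖ ^ 2) =
          ‖onLine (hardyExtension (hardyAverage v)) σ ν‖ₑ ^ 2 := by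
        intro ν
        rw [ENNReal.ofReal_pow (norm_nonneg _), ofReal_norm]
      have h3 : ∫⁻ t in Set.Ioo (0 : ℝ) 1, ENNReal.ofReal (t ^ (2 * σ + 1) * ‖hardyAverage v t‖ ^ 2) =
          ∫⁻ t, ENNReal.ofReal (t ^ (2 * σ + 1)) * ‖hardyAverage v t‖ₑ ^ 2 ∂unitVol := by
        refine setLIntegral_congr_fun measurableSet_Ioo fun t ht => ?_
        rw [ENNReal.ofReal_mul (Real.rpow_nonneg ht.1.le _), ENNReal.ofReal_pow (norm_nonneg _), ofReal_norm]
      simp_rw [h2]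
      rw [h1, h3, ENNReal.toReal_mul, ENNReal.toReal_ofReal (by positivity)]
    · filter_upwards [ae_restrict_mem measurableSet_Ioo] with t ht
      exact mul_nonneg (Real.rpow_nonneg ht.1.le _) (by positivity)

/-! ### Estimates for the logarithmic singularity -/

theorem lintegral_abs_rpow_neg_half_ne_top :
    ∫⁻ s in Set.Ioo (-1 : ℝ) 2, ENNReal.ofReal (|s| ^ (-(1 / 2) : ℝ)) ≠ ⊤ := by
  have h : IntervalIntegrable (fun s : ℝ => (s : ℂ) ^ ((-(1 / 2) : ℝ) : ℂ)) volume (-1) 2 :=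
    intervalIntegral.intervalIntegrable_cpow' (by rw [Complex.ofReal_re]; norm_num)
  have h2 := ((intervalIntegrable_iff_integrableOn_Ioo_of_le (by norm_num)).1 h).2
  rw [hasFiniteIntegral_iff_enorm] at h2
  refine ne_top_of_le_ne_top h2.ne (lintegral_mono fun s => ?_)
  rw [← ofReal_norm, Complex.norm_cpow_real, Complex.norm_real, Real.norm_eq_abs]

/-- The logarithm is majorised by a power -1/4, whose square is still integrable and can be paired
with an L² density. Uniformity in x comes from 1 - tx = x(x⁻¹ - t), a translation into (-1,2), and
x^(-1/2) ≤ 2. -/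
theorem exists_lintegral_abs_one_sub_mul_le : ∃ K : ENNReal, K ≠ ⊤ ∧ ∀ x : ℝ, 1 / 2 ≤ x →
    ∫⁻ t, ENNReal.ofReal (|1 - t * x| ^ (-(1 / 4) : ℝ)) ^ 2 ∂unitVol ≤ K := by
  refine ⟨2 * ∫⁻ s in Set.Ioo (-1 : ℝ) 2, ENNReal.ofReal (|s| ^ (-(1 / 2) : ℝ)),
    ENNReal.mul_ne_top (by norm_num) lintegral_abs_rpow_neg_half_ne_top, fun x hx => ?_⟩
  have hx0 : 0 < x := by linarith
  have hxi : x⁻¹ ≤ 2 := by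
    rw [inv_le_comm₀ hx0 (by norm_num)]; linarith
  have hxi0 : 0 < x⁻¹ := inv_pos.2 hx0
  rw [← lintegral_const_mul' _ _ (by norm_num), ← lintegral_indicator measurableSet_Ioo,
    ← lintegral_indicator measurableSet_Ioo, ← lintegral_sub_left_eq_self ((Set.Ioo (-1 : ℝ) 2).indicator _) x⁻¹]
  refine lintegral_mono fun t => ?_
  by_cases ht : t ∈ Set.Ioo (0 : ℝ) 1
  · rw [Set.indicator_of_mem ht, Set.indicator_of_mem
      (show x⁻¹ - t ∈ Set.Ioo (-1 : ℝ) 2 from ⟨by linarith [ht.2], by linarith [ht.1]⟩)]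
    have e : 1 - t * x = x * (x⁻¹ - t) := by
      rw [mul_sub, mul_inv_cancel₀ hx0.ne']; ring
    rw [← ENNReal.ofReal_pow (Real.rpow_nonneg (abs_nonneg _) _), ← Real.rpow_natCast (_ ^ _),
      ← Real.rpow_mul (abs_nonneg _), e, abs_mul, Real.mul_rpow (abs_nonneg _) (abs_nonneg _), abs_of_pos hx0,
      show (2 : ENNReal) = ENNReal.ofReal 2 by norm_num, ← ENNReal.ofReal_mul zero_le_two]
    refine ENNReal.ofReal_le_ofReal ?_
    rw [show (-(1 / 4) * ((2 : ℕ) : ℝ) : ℝ) = -(1 / 2) by norm_num]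
    refine mul_le_mul_of_nonneg_right ?_ (Real.rpow_nonneg (abs_nonneg _) _)
    rw [Real.rpow_neg hx0.le, ← Real.inv_rpow hx0.le]
    calc _ ≤ (2 : ℝ) ^ (1 / 2 : ℝ) := Real.rpow_le_rpow hxi0.le hxi (by norm_num)
      _ ≤ 2 ^ (1 : ℝ) := Real.rpow_le_rpow_of_exponent_le (by norm_num) (by norm_num)
      _ = 2 := Real.rpow_one 2
  · rw [Set.indicator_of_notMem ht]
    exact zero_le

theorem log_one_add_le_rpow {s : ℝ} (hs : 0 ≤ s) : Real.log (1 + s) ≤ 4 * s ^ (1 / 4 : ℝ) := by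
  have h1 : (1 + s) ^ (1 / 4 : ℝ) ≤ 1 + s ^ (1 / 4 : ℝ) := by
    have := Real.rpow_add_le_add_rpow zero_le_one hs (p := 1 / 4) (by norm_num) (by norm_num)
    rwa [Real.one_rpow] at this
  have h2 : Real.log (1 + s) = 4 * Real.log ((1 + s) ^ (1 / 4 : ℝ)) := by
    rw [Real.log_rpow (by linarith)]; ring
  have h3 := Real.log_le_sub_one_of_pos (Real.rpow_pos_of_pos (by linarith : 0 < 1 + s) (1 / 4))
  linarith

/-- A Hölder estimate for the logarithm: for b ≤ a, write log(a/b) = log(1 + (a-b)/b) and bound it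
by a quarter power. It is used for continuity at the branch point. -/
theorem abs_log_sub_log_le {a b : ℝ} (ha : 0 < a) (hb : 0 < b) :
    |Real.log a - Real.log b| ≤ 4 * |a - b| ^ (1 / 4 : ℝ) * (a ^ (-(1 / 4) : ℝ) + b ^ (-(1 / 4) : ℝ)) := by
  wlog hab : b ≤ a generalizing a b
  · have := this hb ha (le_of_not_ge hab)
    rwa [abs_sub_comm, abs_sub_comm b a, add_comm (b ^ _)] at this
  have h1 := log_one_add_le_rpow (s := (a - b) / b) (div_nonneg (by linarith) hb.le)
  have h2 : 1 + (a - b) / b = a / b := by field_simp; ring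
  rw [h2, Real.log_div ha.ne' hb.ne', Real.div_rpow (by linarith) hb.le, div_eq_mul_inv, ← Real.rpow_neg hb.le] at h1
  rw [abs_of_nonneg (sub_nonneg.2 (Real.log_le_log hb hab)), abs_of_nonneg (sub_nonneg.2 hab), mul_assoc]
  have h3 : 0 ≤ (a - b) ^ (1 / 4 : ℝ) * a ^ (-(1 / 4) : ℝ) :=
    mul_nonneg (Real.rpow_nonneg (by linarith) _) (Real.rpow_nonneg ha.le _)
  linarith

theorem norm_log_le_of_bounds {w : ℂ} {r R : ℝ} (hr : 0 < r) (hrw : r ≤ ‖w‖) (hwR : ‖w‖ ≤ R) :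
    ‖Complex.log w‖ ≤ Real.pi + 4 * (R ^ (1 / 4 : ℝ) + r ^ (-(1 / 4) : ℝ)) := by
  have hw : 0 < ‖w‖ := hr.trans_le hrw
  have hR : 0 < R := hw.trans_le hwR
  have h1 : |Real.log ‖w‖| ≤ 4 * (R ^ (1 / 4 : ℝ) + r ^ (-(1 / 4) : ℝ)) := by
    have p1 : 0 ≤ R ^ (1 / 4 : ℝ) := Real.rpow_nonneg hR.le _
    have p2 : 0 ≤ r ^ (-(1 / 4) : ℝ) := Real.rpow_nonneg hr.le _
    rw [abs_le]
    constructor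
    · have h := Real.log_le_rpow_div (x := r⁻¹) (by positivity) (show (0 : ℝ) < 1 / 4 by norm_num)
      rw [Real.log_inv, Real.inv_rpow hr.le, ← Real.rpow_neg hr.le] at h
      have h' := Real.log_le_log hr hrw
      linarith
    · have h := Real.log_le_rpow_div (x := R) hR.le (show (0 : ℝ) < 1 / 4 by norm_num)
      have h' := Real.log_le_log hw hwR
      linarith
  have h2 := Complex.norm_le_abs_re_add_abs_im (Complex.log w)
  rw [Complex.log_re, Complex.log_im] at h2
  linarith [Complex.abs_arg_le_pi w]

/-! ### The logarithmic potential: power series and holomorphy off the cut -/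

/-- The logarithmic potential `∫₀¹ v(t) log (1 - t z) dt`. -/
noncomputable def logPotential (v : ℝ → ℂ) (z : ℂ) : ℂ := ∫ t, v t * Complex.log (1 - t * z) ∂unitVol

/-- Termwise integration of the Taylor series of -log(1 - tz). The term n = 0 is zero by the
convention for division by 0. -/
theorem hasSum_logPotential {v : ℝ → ℂ} (hv : Integrable v unitVol) {z : ℂ} (hz : ‖z‖ < 1) :
    HasSum (fun n : ℕ => z ^ n / n * ∫ t, (t : ℂ) ^ n * v t ∂unitVol) (-logPotential v z) := by
  have hint : ∀ n : ℕ, Integrable (fun t : ℝ => (t : ℂ) ^ n * v t) unitVol := by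
    intro n
    refine hv.norm.mono' (AEStronglyMeasurable.mul (by fun_prop) hv.1) ?_
    filter_upwards [ae_restrict_mem measurableSet_Ioo] with t ht
    rw [norm_mul, norm_pow, Complex.norm_real, Real.norm_of_nonneg ht.1.le]
    exact mul_le_of_le_one_left (norm_nonneg _) (pow_le_one₀ ht.1.le ht.2.le)
  have h := hasSum_integral_of_summable_integral_norm (μ := unitVol)
    (F := fun (n : ℕ) (t : ℝ) => z ^ n / n * ((t : ℂ) ^ n * v t)) (fun n => (hint n).const_mul _) ?_
  · simp_rw [integral_const_mul] at h
    refine (?_ : -logPotential v z = _) ▸ h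
    rw [logPotential, ← integral_neg]
    refine integral_congr_ae ?_
    filter_upwards [ae_restrict_mem measurableSet_Ioo] with t ht
    have hn : ‖(t : ℂ) * z‖ < 1 := by
      rw [norm_mul, Complex.norm_real, Real.norm_of_nonneg ht.1.le]
      nlinarith [ht.1, ht.2, norm_nonneg z]
    have := (Complex.hasSum_taylorSeries_neg_log hn).mul_left (v t)
    rw [← mul_neg, ← this.tsum_eq]
    refine tsum_congr fun n => ?_
    ring
  · refine Summable.of_nonneg_of_le (fun n => integral_nonneg fun t => norm_nonneg _) (fun n => ?_)
      ((summable_geometric_of_lt_one (norm_nonneg z) hz).mul_right (∫ t, ‖v t‖ ∂unitVol))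
    rw [← integral_const_mul]
    refine integral_mono_ae ((hint n).const_mul _).norm (hv.norm.const_mul _) ?_
    filter_upwards [ae_restrict_mem measurableSet_Ioo] with t ht
    rw [norm_mul, norm_mul, norm_div, norm_pow, norm_pow, Complex.norm_natCast, Complex.norm_real,
      Real.norm_of_nonneg ht.1.le]
    have h1 : ‖z‖ ^ n / n ≤ ‖z‖ ^ n := by
      rcases n.eq_zero_or_pos with rfl | hn
      · simp
      · exact div_le_self (by positivity) (by exact_mod_cast hn)
    have h2 : t ^ n * ‖v t‖ ≤ ‖v t‖ := mul_le_of_le_one_left (norm_nonneg _) (pow_le_one₀ ht.1.le ht.2.le)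
    have := ht.1
    gcongr

theorem one_sub_mul_mem_slitPlane {z : ℂ} (hz : z ∉ (fun x : ℝ => (x : ℂ)) '' Set.Ici 1) {t : ℝ}
    (ht : t ∈ Set.Icc (0 : ℝ) 1) : 1 - (t : ℂ) * z ∈ Complex.slitPlane := by
  rw [Complex.mem_slitPlane_iff]
  by_contra! h
  obtain ⟨h1, h2⟩ := h
  simp at h1 h2
  rcases h2 with h2 | h2
  · rw [h2] at h1; norm_num at h1
  · refine hz ⟨z.re, ?_, Complex.ext (by simp) (by simp [h2])⟩
    have := ht.2
    have := ht.1
    by_contra hlt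
    simp only [Set.mem_Ici, not_le] at hlt
    have ht1 : t = 1 := by nlinarith
    rw [ht1] at h1
    linarith

theorem isOpen_compl_cut : IsOpen ((fun x : ℝ => (x : ℂ)) '' Set.Ici 1)ᶜ :=
  (Complex.isometry_ofReal.isClosedEmbedding.isClosedMap _ isClosed_Ici).isOpen_compl

theorem aestronglyMeasurable_log_one_sub (z : ℂ) :
    AEStronglyMeasurable (fun t : ℝ => Complex.log (1 - t * z)) unitVol :=
  (Complex.measurable_log.comp (by fun_prop)).aestronglyMeasurable

theorem differentiableAt_logPotential {v : ℝ → ℂ} (hv : Integrable v unitVol) {z : ℂ}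
    (hz : z ∉ (fun x : ℝ => (x : ℂ)) '' Set.Ici 1) : DifferentiableAt ℂ (logPotential v) z := by
  obtain ⟨ε, hε, hball⟩ := Metric.nhds_basis_closedBall.mem_iff.1 (isOpen_compl_cut.mem_nhds hz)
  -- Compactness keeps |1 - tw| above some δ > 0 for t in [0,1] and w near z, which dominates the
  -- derivative in w of the integrand.
  have hcomp : IsCompact (Set.Icc (0 : ℝ) 1 ×ˢ Metric.closedBall z ε) :=
    isCompact_Icc.prod (isCompact_closedBall z ε)
  obtain ⟨q, hq, hmin⟩ := hcomp.exists_isMinOn ⟨(0, z), ⟨by simp, Metric.mem_closedBall_self hε.le⟩⟩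
    (f := fun q : ℝ × ℂ => ‖1 - (q.1 : ℂ) * q.2‖) (by fun_prop)
  set δ : ℝ := ‖1 - (q.1 : ℂ) * q.2‖ with hδ
  have hδ0 : 0 < δ := norm_pos_iff.2 (Complex.slitPlane_ne_zero (one_sub_mul_mem_slitPlane (hball hq.2) hq.1))
  have hlow : ∀ t ∈ Set.Icc (0 : ℝ) 1, ∀ w ∈ Metric.closedBall z ε, δ ≤ ‖1 - (t : ℂ) * w‖ :=
    fun t ht w hw => hmin (Set.mk_mem_prod ht hw)
  refine HasDerivAt.differentiableAt (hasDerivAt_integral_of_dominated_loc_of_deriv_le (μ := unitVol)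
    (F := fun w t => v t * Complex.log (1 - t * w)) (F' := fun w t => v t * (-t / (1 - t * w)))
    (bound := fun t => ‖v t‖ * (1 / δ)) (Metric.closedBall_mem_nhds z hε)
    (Eventually.of_forall fun w => hv.1.mul (aestronglyMeasurable_log_one_sub w)) ?_ ?_ ?_ ?_ ?_).2
  · refine (hv.norm.mul_const (Real.pi + 4 * ((1 + ‖z‖) ^ (1 / 4 : ℝ) + δ ^ (-(1 / 4) : ℝ)))).mono'
      (hv.1.mul (aestronglyMeasurable_log_one_sub z)) ?_
    filter_upwards [ae_restrict_mem measurableSet_Ioo] with t ht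
    rw [norm_mul]
    gcongr
    refine norm_log_le_of_bounds hδ0 (hlow t ⟨ht.1.le, ht.2.le⟩ z (Metric.mem_closedBall_self hε.le)) ?_
    refine (norm_sub_le _ _).trans ?_
    rw [norm_one, norm_mul, Complex.norm_real, Real.norm_of_nonneg ht.1.le]
    nlinarith [norm_nonneg z, ht.2]
  · refine hv.1.mul (Measurable.aestronglyMeasurable ?_)
    exact Complex.measurable_ofReal.neg.div (by fun_prop)
  · filter_upwards [ae_restrict_mem measurableSet_Ioo] with t ht w hw
    rw [norm_mul, norm_div, norm_neg, Complex.norm_real, Real.norm_of_nonneg ht.1.le]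
    gcongr
    · exact ht.2.le
    · exact hlow t ⟨ht.1.le, ht.2.le⟩ w hw
  · exact hv.norm.mul_const _
  · filter_upwards [ae_restrict_mem measurableSet_Ioo] with t ht w hw
    refine HasDerivAt.const_mul _ ?_
    refine HasDerivAt.clog ?_ (one_sub_mul_mem_slitPlane (hball hw) ⟨ht.1.le, ht.2.le⟩)
    simpa using ((hasDerivAt_id w).const_mul (t : ℂ)).const_sub 1

/-- The bound must be uniform in x, since near the branch point the singularity t = 1/x moves. It
follows from ab ≤ a² + b². -/
theorem exists_integral_norm_mul_rpow_le {v : ℝ → ℂ} (hv : MemLp v 2 unitVol) :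
    ∃ C : ℝ, ∀ x : ℝ, 1 / 2 ≤ x →
      Integrable (fun t : ℝ => ‖v t‖ * |1 - t * x| ^ (-(1 / 4) : ℝ)) unitVol ∧
      ∫ t, ‖v t‖ * |1 - t * x| ^ (-(1 / 4) : ℝ) ∂unitVol ≤ C := by
  obtain ⟨K, hK, hKx⟩ := exists_lintegral_abs_one_sub_mul_le
  refine ⟨(∫ t, ‖v t‖ ^ 2 ∂unitVol) + K.toReal, fun x hx => ?_⟩
  have hnn : ∀ t : ℝ, 0 ≤ |1 - t * x| ^ (-(1 / 4) : ℝ) := fun t => Real.rpow_nonneg (abs_nonneg _) _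
  have hm : AEStronglyMeasurable (fun t : ℝ => |1 - t * x| ^ (-(1 / 4) : ℝ)) unitVol :=
    Measurable.aestronglyMeasurable (Measurable.pow_const (by fun_prop) _)
  have hL : ∫⁻ t, ‖|1 - t * x| ^ (-(1 / 4) : ℝ)‖ₑ ^ 2 ∂unitVol ≤ K := by
    refine le_trans (lintegral_mono fun t => ?_) (hKx x hx)
    rw [Real.enorm_of_nonneg (hnn t)]
  have hg : MemLp (fun t : ℝ => |1 - t * x| ^ (-(1 / 4) : ℝ)) 2 unitVol :=
    memLp_two_of_lintegral hm (ne_top_of_le_ne_top hK hL)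
  have hgi := (memLp_two_iff_integrable_sq hm).1 hg
  have hvi := (memLp_two_iff_integrable_sq_norm hv.1).1 hv
  have hint : Integrable (fun t : ℝ => ‖v t‖ * |1 - t * x| ^ (-(1 / 4) : ℝ)) unitVol :=
    hv.norm.integrable_mul hg
  refine ⟨hint, ?_⟩
  calc _ ≤ ∫ t, (‖v t‖ ^ 2 + (|1 - t * x| ^ (-(1 / 4) : ℝ)) ^ 2) ∂unitVol := by
        refine integral_mono hint (hvi.add hgi) fun t => ?_
        simp only
        nlinarith [sq_nonneg (‖v t‖ - |1 - t * x| ^ (-(1 / 4) : ℝ)), sq_nonneg (‖v t‖), sq_nonneg (|1 - t * x| ^ (-(1 / 4) : ℝ))]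
    _ = (∫ t, ‖v t‖ ^ 2 ∂unitVol) + ∫ t, (|1 - t * x| ^ (-(1 / 4) : ℝ)) ^ 2 ∂unitVol := integral_add hvi hgi
    _ ≤ _ := by
        gcongr
        rw [integral_eq_lintegral_of_nonneg_ae (Eventually.of_forall fun t => sq_nonneg _) hgi.1]
        refine ENNReal.toReal_mono hK (le_trans (lintegral_mono fun t => ?_) (hKx x hx))
        rw [ENNReal.ofReal_pow (hnn t)]

/-! ### Boundary values on the two sides of the cut -/

/-- The bound uses |1 - tz| ≥ |1 - t Re z| and so depends only on Re z and R: a single dominating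
function for the vertical approach to a point of the cut. -/
theorem norm_log_one_sub_mul_le {x R : ℝ} {z : ℂ} (hzx : z.re = x) (hzR : ‖z‖ ≤ R) {t : ℝ}
    (ht : t ∈ Set.Ioo (0 : ℝ) 1) (htx : 1 - t * x ≠ 0) :
    ‖Complex.log (1 - t * z)‖ ≤ Real.pi + 4 * ((1 + R) ^ (1 / 4 : ℝ) + |1 - t * x| ^ (-(1 / 4) : ℝ)) := by
  refine norm_log_le_of_bounds (abs_pos.2 htx) ?_ ?_
  · have := Complex.abs_re_le_norm (1 - (t : ℂ) * z)
    simpa [hzx] using this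
  · refine (norm_sub_le _ _).trans ?_
    rw [norm_one, norm_mul, Complex.norm_real, Real.norm_of_nonneg ht.1.le]
    nlinarith [norm_nonneg z, ht.2]

theorem ae_one_sub_mul_ne_zero (x : ℝ) : ∀ᵐ t ∂unitVol, 1 - t * x ≠ 0 := by
  refine ae_restrict_of_ae ?_
  have : ∀ᵐ t : ℝ, t ≠ x⁻¹ := by
    rw [ae_iff]
    simp
  filter_upwards [this] with t ht h
  exact ht (eq_inv_of_mul_eq_one_left (by linarith))

theorem integrable_logBound {v : ℝ → ℂ} (hv : MemLp v 2 unitVol) {x : ℝ} (hx : 1 / 2 ≤ x) (c : ℝ) :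
    Integrable (fun t : ℝ => ‖v t‖ * (Real.pi + 4 * (c + |1 - t * x| ^ (-(1 / 4) : ℝ)))) unitVol := by
  obtain ⟨C, hC⟩ := exists_integral_norm_mul_rpow_le hv
  have := ((hv.integrable (by norm_num)).norm.mul_const (Real.pi + 4 * c)).add ((hC x hx).1.const_mul 4)
  refine this.congr (Eventually.of_forall fun t => ?_)
  simp only [Pi.add_apply]
  ring

theorem tendsto_logPotential {v : ℝ → ℂ} (hv : MemLp v 2 unitVol) {ι : Type*} {l : Filter ι}
    [l.IsCountablyGenerated] {x R : ℝ} (hx : 1 / 2 ≤ x) {z : ι → ℂ}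
    (hz : ∀ᶠ i in l, (z i).re = x ∧ ‖z i‖ ≤ R) {L : ℝ → ℂ}
    (hL : ∀ t ∈ Set.Ioo (0 : ℝ) 1, 1 - t * x ≠ 0 → Tendsto (fun i => Complex.log (1 - t * z i)) l (𝓝 (L t))) :
    Tendsto (fun i => logPotential v (z i)) l (𝓝 (∫ t, v t * L t ∂unitVol)) := by
  refine tendsto_integral_filter_of_dominated_convergence
    (fun t : ℝ => ‖v t‖ * (Real.pi + 4 * ((1 + R) ^ (1 / 4 : ℝ) + |1 - t * x| ^ (-(1 / 4) : ℝ))))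
    (Eventually.of_forall fun i => hv.1.mul (aestronglyMeasurable_log_one_sub (z i))) ?_
    (integrable_logBound hv hx _) ?_
  · filter_upwards [hz] with i hi
    filter_upwards [ae_restrict_mem measurableSet_Ioo, ae_one_sub_mul_ne_zero x] with t ht htx
    rw [norm_mul]
    gcongr
    exact norm_log_one_sub_mul_le hi.1 hi.2 ht htx
  · filter_upwards [ae_restrict_mem measurableSet_Ioo, ae_one_sub_mul_ne_zero x] with t ht htx
    exact (hL t ht htx).const_mul _

theorem integrable_mul_log_norm {v : ℝ → ℂ} (hv : MemLp v 2 unitVol) {z : ℂ} (hz : 1 / 2 ≤ z.re) :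
    Integrable (fun t : ℝ => v t * (Real.log ‖1 - (t : ℂ) * z‖ : ℂ)) unitVol := by
  have hm : Measurable (fun t : ℝ => (Real.log ‖1 - (t : ℂ) * z‖ : ℂ)) :=
    Complex.measurable_ofReal.comp (Real.measurable_log.comp (by fun_prop))
  refine (integrable_logBound hv hz ((1 + ‖z‖) ^ (1 / 4 : ℝ))).mono' (hv.1.mul hm.aestronglyMeasurable) ?_
  filter_upwards [ae_restrict_mem measurableSet_Ioo, ae_one_sub_mul_ne_zero z.re] with t ht htx
  rw [norm_mul]
  gcongr
  refine le_trans ?_ (norm_log_one_sub_mul_le rfl le_rfl ht htx)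
  rw [Complex.norm_real, Real.norm_eq_abs, ← Complex.log_re]
  exact Complex.abs_re_le_norm _

/-- Beyond t = 1/x the boundary logarithm is log|1 - tx| plus a constant c, equal to -πi or πi
according to the side. Integrating that constant against v is what brings in the tail primitive at
1/x. -/
theorem integral_mul_boundary_log {v : ℝ → ℂ} (hv : MemLp v 2 unitVol) {x : ℝ} (hx : 1 < x) (c : ℂ) :
    ∫ t, v t * ((Real.log ‖1 - (t : ℂ) * (x : ℂ)‖ : ℂ) + (Set.Ioi x⁻¹).indicator (fun _ => c) t) ∂unitVol =
      (∫ t, v t * (Real.log ‖1 - (t : ℂ) * (x : ℂ)‖ : ℂ) ∂unitVol) + c * tailPrimitive v x⁻¹ := by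
  have hvi : Integrable v unitVol := hv.integrable (by norm_num)
  have e : ∀ t, v t * (Set.Ioi x⁻¹).indicator (fun _ => c) t = (Set.Ioi x⁻¹).indicator (fun t => c * v t) t := by
    intro t
    by_cases ht : t ∈ Set.Ioi x⁻¹
    · rw [Set.indicator_of_mem ht, Set.indicator_of_mem ht, mul_comm]
    · rw [Set.indicator_of_notMem ht, Set.indicator_of_notMem ht, mul_zero]
  simp_rw [mul_add, e]
  rw [integral_add (integrable_mul_log_norm hv (by rw [Complex.ofReal_re]; linarith))
    ((hvi.const_mul c).indicator measurableSet_Ioi), integral_indicator measurableSet_Ioi,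
    Measure.restrict_restrict measurableSet_Ioi, integral_const_mul]
  have hset : Set.Ioi x⁻¹ ∩ Set.Ioo 0 1 = Set.Ioo x⁻¹ 1 := by
    ext s
    constructor
    · rintro ⟨h1, h2⟩; exact ⟨h1, h2.2⟩
    · rintro ⟨h1, h2⟩; exact ⟨h1, (inv_pos.2 (by linarith)).trans h1, h2⟩
  rw [hset, tailPrimitive]

theorem tendsto_log_one_sub_mul {x t : ℝ} {z : ℝ → ℂ} (hz : Tendsto z (𝓝[>] 0) (𝓝 (x : ℂ)))
    (htx : 1 - t * x > 0) :
    Tendsto (fun ε => Complex.log (1 - t * z ε)) (𝓝[>] 0) (𝓝 (Real.log ‖1 - (t : ℂ) * (x : ℂ)‖ : ℂ)) := by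
  have e : (1 - (t : ℂ) * (x : ℂ)) = ((1 - t * x : ℝ) : ℂ) := by push_cast; ring
  have h1 := ((hz.const_mul (t : ℂ)).const_sub 1).clog (by rw [e]; exact Complex.ofReal_mem_slitPlane.2 htx)
  rw [e] at h1 ⊢
  rwa [Complex.norm_real, Real.norm_of_nonneg htx.le, Complex.ofReal_log htx.le]

/-- As z descends to x from above, 1 - tz reaches the negative axis from below when t > 1/x, so its
argument tends to -π. For t < 1/x the logarithm is continuous. -/
theorem tendsto_logPotential_above {v : ℝ → ℂ} (hv : MemLp v 2 unitVol) {x : ℝ} (hx : 1 < x) :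
    Tendsto (fun ε : ℝ => logPotential v ((x : ℂ) + (ε : ℂ) * Complex.I)) (𝓝[>] 0)
      (𝓝 ((∫ t, v t * (Real.log ‖1 - (t : ℂ) * (x : ℂ)‖ : ℂ) ∂unitVol) +
        -(Real.pi * Complex.I) * tailPrimitive v x⁻¹)) := by
  rw [← integral_mul_boundary_log hv hx]
  have hx0 : 0 < x := by linarith
  have hzc : Continuous (fun ε : ℝ => (x : ℂ) + (ε : ℂ) * Complex.I) := by fun_prop
  have hz : Tendsto (fun ε : ℝ => (x : ℂ) + (ε : ℂ) * Complex.I) (𝓝[>] 0) (𝓝 (x : ℂ)) := by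
    have := (hzc.tendsto 0).mono_left (nhdsWithin_le_nhds (s := Set.Ioi 0))
    simpa using this
  refine tendsto_logPotential hv (x := x) (R := x + 1) (by linarith) ?_ ?_
  · filter_upwards [hz.norm.eventually_lt_const (show ‖(x : ℂ)‖ < x + 1 by
      rw [Complex.norm_real, Real.norm_of_nonneg hx0.le]; linarith)] with ε hε
    exact ⟨by simp, hε.le⟩
  · intro t ht htx
    rcases lt_or_gt_of_ne htx with h | h
    · rw [Set.indicator_of_mem (show t ∈ Set.Ioi x⁻¹ by rw [Set.mem_Ioi, inv_lt_iff_one_lt_mul₀ hx0]; linarith)]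
      have h1 := Complex.tendsto_log_nhdsWithin_im_neg_of_re_neg_of_im_zero (z := 1 - (t : ℂ) * (x : ℂ))
        (by simpa using h) (by simp)
      rw [← sub_eq_add_neg]
      refine h1.comp (tendsto_nhdsWithin_iff.2 ⟨(hz.const_mul (t : ℂ)).const_sub 1, ?_⟩)
      filter_upwards [self_mem_nhdsWithin] with ε hε
      have hε : 0 < ε := hε
      have := mul_pos ht.1 hε
      simpa using this
    · rw [Set.indicator_of_notMem (show t ∉ Set.Ioi x⁻¹ by
        rw [Set.mem_Ioi, inv_lt_iff_one_lt_mul₀ hx0]; linarith), add_zero]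
      exact tendsto_log_one_sub_mul hz h

theorem tendsto_logPotential_below {v : ℝ → ℂ} (hv : MemLp v 2 unitVol) {x : ℝ} (hx : 1 < x) :
    Tendsto (fun ε : ℝ => logPotential v ((x : ℂ) - (ε : ℂ) * Complex.I)) (𝓝[>] 0)
      (𝓝 ((∫ t, v t * (Real.log ‖1 - (t : ℂ) * (x : ℂ)‖ : ℂ) ∂unitVol) +
        (Real.pi * Complex.I) * tailPrimitive v x⁻¹)) := by
  rw [← integral_mul_boundary_log hv hx]
  have hx0 : 0 < x := by linarith
  have hzc : Continuous (fun ε : ℝ => (x : ℂ) - (ε : ℂ) * Complex.I) := by fun_prop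
  have hz : Tendsto (fun ε : ℝ => (x : ℂ) - (ε : ℂ) * Complex.I) (𝓝[>] 0) (𝓝 (x : ℂ)) := by
    have := (hzc.tendsto 0).mono_left (nhdsWithin_le_nhds (s := Set.Ioi 0))
    simpa using this
  refine tendsto_logPotential hv (x := x) (R := x + 1) (by linarith) ?_ ?_
  · filter_upwards [hz.norm.eventually_lt_const (show ‖(x : ℂ)‖ < x + 1 by
      rw [Complex.norm_real, Real.norm_of_nonneg hx0.le]; linarith)] with ε hε
    exact ⟨by simp, hε.le⟩
  · intro t ht htx
    rcases lt_or_gt_of_ne htx with h | h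
    · rw [Set.indicator_of_mem (show t ∈ Set.Ioi x⁻¹ by rw [Set.mem_Ioi, inv_lt_iff_one_lt_mul₀ hx0]; linarith)]
      have h1 := Complex.tendsto_log_nhdsWithin_im_nonneg_of_re_neg_of_im_zero (z := 1 - (t : ℂ) * (x : ℂ))
        (by simpa using h) (by simp)
      refine h1.comp (tendsto_nhdsWithin_iff.2 ⟨(hz.const_mul (t : ℂ)).const_sub 1, ?_⟩)
      filter_upwards [self_mem_nhdsWithin] with ε hε
      have hε : 0 < ε := hε
      have := mul_pos ht.1 hε
      simpa using this.le
    · rw [Set.indicator_of_notMem (show t ∉ Set.Ioi x⁻¹ by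
        rw [Set.mem_Ioi, inv_lt_iff_one_lt_mul₀ hx0]; linarith), add_zero]
      exact tendsto_log_one_sub_mul hz h

/-! ### Continuity at the branch point z = 1 -/

/-- The argument is bounded by π, so dominated convergence suffices; the limits 1 - t with t < 1
avoid the branch cut. -/
theorem continuousAt_integral_mul_arg {v : ℝ → ℂ} (hv : Integrable v unitVol) :
    ContinuousAt (fun z : ℂ => ∫ t, v t * (Complex.arg (1 - t * z) : ℂ) ∂unitVol) 1 := by
  refine continuousAt_of_dominated (bound := fun t => ‖v t‖ * Real.pi) (Eventually.of_forall fun z => ?_)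
    (Eventually.of_forall fun z => Eventually.of_forall fun t => ?_) (hv.norm.mul_const _) ?_
  · refine hv.1.mul (Measurable.aestronglyMeasurable ?_)
    exact Complex.measurable_ofReal.comp (Complex.measurable_arg.comp (by fun_prop))
  · rw [norm_mul, Complex.norm_real, Real.norm_eq_abs]
    gcongr
    exact Complex.abs_arg_le_pi _
  · filter_upwards [ae_restrict_mem measurableSet_Ioo] with t ht
    refine continuousAt_const.mul (Complex.continuous_ofReal.continuousAt.comp ?_)
    refine ContinuousAt.comp (g := Complex.arg) (Complex.continuousAt_arg ?_) (by fun_prop)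
    rw [show (1 - (t : ℂ) * 1) = ((1 - t : ℝ) : ℂ) by push_cast; ring]
    exact Complex.ofReal_mem_slitPlane.2 (by linarith [ht.2])

/-- The majorant |1 - t Re z|^(-1/4) moves with z, so it is not a single dominating function. The
Hölder estimate for the logarithm gives instead a difference of order |z - 1|^(1/4), with a constant
uniform in Re z ≥ 1/2. -/
theorem continuousAt_integral_mul_log_norm {v : ℝ → ℂ} (hv : MemLp v 2 unitVol) :
    ContinuousAt (fun z : ℂ => ∫ t, v t * (Real.log ‖1 - (t : ℂ) * z‖ : ℂ) ∂unitVol) 1 := by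
  obtain ⟨C, hC⟩ := exists_integral_norm_mul_rpow_le hv
  have hbound : ∀ z : ℂ, 1 / 2 ≤ z.re →
      ‖(∫ t, v t * (Real.log ‖1 - (t : ℂ) * z‖ : ℂ) ∂unitVol) -
        ∫ t, v t * (Real.log ‖1 - (t : ℂ) * 1‖ : ℂ) ∂unitVol‖ ≤ 4 * ‖z - 1‖ ^ (1 / 4 : ℝ) * (C + C) := by
    intro z hz
    have h1 := hC z.re hz
    have h2 := hC 1 (by norm_num)
    rw [← integral_sub (integrable_mul_log_norm hv hz) (integrable_mul_log_norm hv (by norm_num))]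
    calc _ ≤ ∫ t, 4 * ‖z - 1‖ ^ (1 / 4 : ℝ) * (‖v t‖ * |1 - t * z.re| ^ (-(1 / 4) : ℝ) +
            ‖v t‖ * |1 - t * 1| ^ (-(1 / 4) : ℝ)) ∂unitVol := by
          refine norm_integral_le_of_norm_le ((h1.1.add h2.1).const_mul _) ?_
          filter_upwards [ae_restrict_mem measurableSet_Ioo, ae_one_sub_mul_ne_zero z.re] with t ht htz
          have hre : |1 - t * z.re| ≤ ‖1 - (t : ℂ) * z‖ := by
            simpa using Complex.abs_re_le_norm (1 - (t : ℂ) * z)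
          have hpos := (abs_pos.2 htz).trans_le hre
          have ht1 : 0 < 1 - t * 1 := by linarith [ht.2]
          have hone : ‖1 - (t : ℂ) * 1‖ = |1 - t * 1| := by
            rw [← Real.norm_eq_abs, ← Complex.norm_real]
            push_cast
            rfl
          rw [← mul_sub, norm_mul, ← Complex.ofReal_sub, Complex.norm_real, Real.norm_eq_abs, hone]
          have h3 := abs_log_sub_log_le hpos (abs_pos.2 ht1.ne')
          have h4 : |‖1 - (t : ℂ) * z‖ - (|1 - t * 1|)| ≤ ‖z - 1‖ := by
            rw [← hone]
            refine (abs_norm_sub_norm_le _ _).trans ?_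
            rw [show (1 - (t : ℂ) * z - (1 - t * 1)) = -(t * (z - 1)) by ring, norm_neg, norm_mul, Complex.norm_real,
              Real.norm_of_nonneg ht.1.le]
            exact mul_le_of_le_one_left (norm_nonneg _) ht.2.le
          have h5 : ‖1 - (t : ℂ) * z‖ ^ (-(1 / 4) : ℝ) ≤ |1 - t * z.re| ^ (-(1 / 4) : ℝ) :=
            Real.rpow_le_rpow_of_nonpos (abs_pos.2 htz) hre (by norm_num)
          have h6 : 0 ≤ |1 - t * 1| ^ (-(1 / 4) : ℝ) := Real.rpow_nonneg (abs_nonneg _) _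
          calc _ ≤ ‖v t‖ * (4 * ‖z - 1‖ ^ (1 / 4 : ℝ) * (|1 - t * z.re| ^ (-(1 / 4) : ℝ) +
                |1 - t * 1| ^ (-(1 / 4) : ℝ))) := by
                gcongr
                refine h3.trans ?_
                gcongr
            _ = _ := by ring
      _ = 4 * ‖z - 1‖ ^ (1 / 4 : ℝ) * ((∫ t, ‖v t‖ * |1 - t * z.re| ^ (-(1 / 4) : ℝ) ∂unitVol) +
            ∫ t, ‖v t‖ * |1 - t * 1| ^ (-(1 / 4) : ℝ) ∂unitVol) := by
          rw [integral_const_mul, integral_add h1.1 h2.1]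
      _ ≤ _ := by
          gcongr
          · exact h1.2
          · exact h2.2
  rw [ContinuousAt, tendsto_iff_norm_sub_tendsto_zero]
  have hlim : Tendsto (fun z : ℂ => 4 * ‖z - 1‖ ^ (1 / 4 : ℝ) * (C + C)) (𝓝 1) (𝓝 0) := by
    have hc : Continuous (fun z : ℂ => 4 * ‖z - 1‖ ^ (1 / 4 : ℝ) * (C + C)) := by
      refine (continuous_const.mul (Continuous.rpow_const (by fun_prop) fun _ => Or.inr (by norm_num))).mul
        continuous_const
    have := hc.tendsto 1
    rwa [sub_self, norm_zero, Real.zero_rpow (by norm_num), mul_zero, zero_mul] at this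
  refine squeeze_zero' (Eventually.of_forall fun _ => norm_nonneg _) ?_ hlim
  have : ∀ᶠ z : ℂ in 𝓝 1, 1 / 2 < z.re :=
    Complex.continuous_re.continuousAt.eventually_const_lt (by norm_num)
  filter_upwards [this] with z hz
  exact hbound z hz.le

theorem continuousAt_logPotential_one {v : ℝ → ℂ} (hv : MemLp v 2 unitVol) :
    ContinuousAt (logPotential v) 1 := by
  have hvi : Integrable v unitVol := hv.integrable (by norm_num)
  refine ((continuousAt_integral_mul_log_norm hv).add
    ((continuousAt_integral_mul_arg hvi).mul (continuousAt_const (y := Complex.I)))).congr ?_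
  have : ∀ᶠ z : ℂ in 𝓝 1, 1 / 2 < z.re :=
    Complex.continuous_re.continuousAt.eventually_const_lt (by norm_num)
  filter_upwards [this] with z hz
  have hm : Measurable (fun t : ℝ => (Complex.arg (1 - t * z) : ℂ)) :=
    Complex.measurable_ofReal.comp (Complex.measurable_arg.comp (by fun_prop))
  have harg : Integrable (fun t : ℝ => v t * (Complex.arg (1 - t * z) : ℂ)) unitVol := by
    refine (hvi.norm.mul_const Real.pi).mono' (hvi.1.mul hm.aestronglyMeasurable) (Eventually.of_forall fun t => ?_)
    rw [norm_mul, Complex.norm_real, Real.norm_eq_abs]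
    gcongr
    exact Complex.abs_arg_le_pi _
  simp only [Pi.add_apply, Pi.mul_apply]
  rw [logPotential, ← integral_mul_const, ← integral_add (integrable_mul_log_norm hv hz.le) (harg.mul_const _)]
  refine integral_congr_ae (Eventually.of_forall fun t => ?_)
  simp only [Complex.log]
  ring

/-! ### Decay of the coefficients, construction of the density and conclusion -/

theorem HausdorffL2.exists_norm_sq_le {s : ℕ → ℂ} (hs : HausdorffL2 s) :
    ∃ M : ℝ, ∀ n : ℕ, ((n : ℝ) + 1) * ‖s n‖ ^ 2 ≤ M := by
  obtain ⟨M, -, hM⟩ := hs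
  refine ⟨M, fun n => le_trans ?_ (hM n).le⟩
  gcongr
  have := Finset.single_le_sum (f := fun i => ((n.choose i : ℝ)) ^ 2 * ‖((fwdDiff (1 : ℕ))^[i] s) (n - i)‖ ^ 2)
    (fun i _ => by positivity) (Finset.mem_range.2 n.succ_pos)
  simpa using this

/-- The term i = 0 of (H) makes n^p a_n of order n^(-1/2). Since p ≥ 1, a_n is of order n^(-3/2),
which gives uniform convergence on the whole open disk. -/
theorem summable_norm_of_hausdorffL2_pow_mul {a : ℕ → ℂ} {p : ℕ} (hp : 1 ≤ p)
    (h : HausdorffL2 (fun n : ℕ => (n : ℂ) ^ p * a n)) : Summable (fun n => ‖a n‖) := by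
  obtain ⟨M, hM⟩ := h.exists_norm_sq_le
  have hM0 : 0 ≤ M := le_trans (by positivity) (hM 0)
  refine Summable.of_norm_bounded_eventually_nat (g := fun n : ℕ => √M * ((n : ℝ) ^ (3 / 2 : ℝ))⁻¹)
    ((Real.summable_nat_rpow_inv.2 (by norm_num)).mul_left _) ?_
  filter_upwards [eventually_ge_atTop 1] with n hn
  have hn1 : (1 : ℝ) ≤ n := by exact_mod_cast hn
  have hn0 : (0 : ℝ) < n := by linarith
  have h1 : (n : ℝ) * ‖a n‖ ≤ ‖(n : ℂ) ^ p * a n‖ := by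
    rw [norm_mul, norm_pow, Complex.norm_natCast]
    gcongr
    exact le_self_pow₀ hn1 (by omega)
  have h2 : ((n : ℝ) ^ (3 / 2 : ℝ) * ‖a n‖) ^ 2 ≤ M := by
    refine le_trans ?_ (hM n)
    have h3 : ((n : ℝ) ^ (3 / 2 : ℝ)) ^ 2 = n * (n : ℝ) ^ 2 := by
      rw [← Real.rpow_natCast, ← Real.rpow_mul hn0.le]
      norm_num
      ring
    rw [mul_pow, h3, mul_assoc, ← mul_pow]
    gcongr
    linarith
  rw [norm_norm, ← div_eq_mul_inv, le_div_iff₀ (by positivity), mul_comm]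
  exact Real.le_sqrt_of_sq_le h2

theorem hasSum_mul_pow_of_moments {a : ℕ → ℂ} {v : ℝ → ℂ} (hv : Integrable v unitVol)
    (h : ∀ n : ℕ, ∫ t, (t : ℂ) ^ n * v t ∂unitVol = n * a n) {z : ℂ} (hz : ‖z‖ < 1) :
    HasSum (fun n => a n * z ^ n) (a 0 - logPotential v z) := by
  have h1 := hasSum_logPotential hv hz
  have h2 := (hasSum_ite_eq (0 : ℕ) (a 0)).add h1
  rw [← sub_eq_add_neg] at h2
  refine h2.congr_fun ?_
  intro n
  rcases eq_or_ne n 0 with rfl | hn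
  · simp
  · have : (n : ℂ) ≠ 0 := by exact_mod_cast hn
    rw [h n, if_neg hn]
    field_simp
    ring

theorem notMem_cut_of_norm_lt_one {z : ℂ} (hz : ‖z‖ < 1) : z ∉ (fun x : ℝ => (x : ℂ)) '' Set.Ici 1 := by
  rintro ⟨x, hx, rfl⟩
  have hx : 1 ≤ x := hx
  rw [Complex.norm_real, Real.norm_of_nonneg (by linarith)] at hz
  linarith

/-- Data representing a sequence `a` through a density `v` on `(0, 1)` of mean zero. -/
theorem exists_density {p : ℕ} (hp : 1 ≤ p) {a : ℕ → ℂ} (ha : HausdorffL2 a)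
    (hf : HausdorffL2 (fun n : ℕ => (n : ℂ) ^ p * a n)) :
    ∃ v : ℝ → ℂ, MemLp v 2 unitVol ∧ MemLp (hardyAverage v) 2 unitVol ∧
      (∀ z ∈ halfPlane, cutMellin v z = z * cutMellin (hardyAverage v) z) ∧
      (∀ n : ℕ, cutMellin (hardyAverage v) n = a n) ∧
      ContDiffOn ℝ ((p - 1 : ℕ) : WithTop ℕ∞) (tailPrimitive v) (Set.Ioo 0 1) := by
  obtain ⟨u, hu, hua⟩ := ha.exists_moments
  obtain ⟨w, hw, hwa⟩ := hf.exists_moments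
  have hua : ∀ n : ℕ, cutMellin u n = a n := by
    intro n
    rw [← hua n, cutMellin]
    simp_rw [Complex.cpow_natCast]
  have hwa : ∀ n : ℕ, cutMellin w n = (n : ℂ) ^ p * cutMellin u n := by
    intro n
    rw [hua n, ← hwa n, cutMellin]
    simp_rw [Complex.cpow_natCast]
  obtain ⟨q, rfl⟩ : ∃ q, p = q + 1 := ⟨p - 1, by omega⟩
  obtain ⟨v, hv, hvu, hsmooth⟩ := exists_hardyAverage_ladder hu q w 0 hw (cutMellin_eq_pow_mul hu hw hwa)
    (by
      rw [Nat.cast_zero, contDiffOn_zero]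
      exact (continuousOn_tailPrimitive (hw.integrable (by norm_num))).mono Set.Ioo_subset_Icc_self)
  have hzero : (0 : ℂ) ∈ halfPlane := by
    change -(1 / 2 : ℝ) < (0 : ℂ).re
    norm_num
  have h0 : ∫ t, v t ∂unitVol = 0 := by
    have := hvu 0 hzero
    rw [zero_mul, cutMellin] at this
    simpa using this
  have hJ := memLp_hardyAverage hv h0
  -- Both transforms become that of v after multiplication by z. From here on the Hardy average of v
  -- replaces u, with the advantage that it is t⁻¹ times a continuous primitive.
  have heq : Set.EqOn (cutMellin (hardyAverage v)) (cutMellin u) halfPlane := by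
    refine eqOn_halfPlane_of_eq_of_pos (differentiableOn_cutMellin hJ) (differentiableOn_cutMellin hu) fun z hz => ?_
    have hz0 : z ≠ 0 := by rintro rfl; simp at hz
    have hzm : z ∈ halfPlane := by
      change -(1 / 2 : ℝ) < z.re
      linarith
    exact mul_left_cancel₀ hz0 ((mul_cutMellin_hardyAverage hv h0 hzm).trans (hvu z hzm))
  refine ⟨v, hv, hJ, fun z hz => (mul_cutMellin_hardyAverage hv h0 hz).symm, fun n => ?_, by simpa using hsmooth⟩
  rw [heq, hua n]
  change -(1 / 2 : ℝ) < (n : ℂ).re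
  rw [Complex.natCast_re]
  linarith [(Nat.cast_nonneg n : (0 : ℝ) ≤ n)]

/-- The boundary values of the potential differ by -2πi times the tail primitive at 1/x; the factors
-1/(2π) and -i reduce this to the tail primitive itself. -/
theorem isJumpFunction_logPotential {v : ℝ → ℂ} (hv : MemLp v 2 unitVol) (c : ℂ) :
    IsJumpFunction (fun z => 1 / (2 * (Real.pi : ℂ)) * (c - logPotential v z)) (fun x => tailPrimitive v x⁻¹) := by
  intro x hx
  refine ⟨_, _, ((tendsto_logPotential_above hv hx).const_sub c).const_mul _,
    ((tendsto_logPotential_below hv hx).const_sub c).const_mul _, ?_⟩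
  have hpi : (Real.pi : ℂ) ≠ 0 := by exact_mod_cast Real.pi_ne_zero
  generalize (∫ t, v t * (Real.log ‖1 - (t : ℂ) * (x : ℂ)‖ : ℂ) ∂unitVol) = L
  field_simp
  ring_nf
  rw [Complex.I_sq]
  ring

theorem theorem1 (p : ℕ) (hp : 1 ≤ p) (a : ℕ → ℂ)
    (ha : HausdorffL2 a)
    (hf : HausdorffL2 (fun n : ℕ => (n : ℂ) ^ p * a n)) :
    ∃ A : ℂ → ℂ,
      -- `A` is the Carlsonian interpolation of the coefficients, and it is unique
      IsCarlsonInterpolation a A ∧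
      (∀ B : ℂ → ℂ, IsCarlsonInterpolation a B → Set.EqOn B A halfPlane) ∧
      ∃ (f : ℂ → ℂ) (F : ℝ → ℂ),
        -- (1') uniform convergence in the unit disk to an analytic function
        TendstoUniformlyOn
          (fun (N : ℕ) (z : ℂ) =>
            1 / (2 * (Real.pi : ℂ)) * ∑ n ∈ Finset.range N, a n * z ^ n)
          f atTop (Metric.ball (0 : ℂ) 1) ∧
        AnalyticOnNhd ℂ f (Metric.ball (0 : ℂ) 1) ∧
        -- (2') holomorphic extension to the cut plane
        DifferentiableOn ℂ f ((fun x : ℝ => (x : ℂ)) '' Set.Ici 1)ᶜ ∧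
        ContinuousOn f ((fun x : ℝ => (x : ℂ)) '' Set.Ioi 1)ᶜ ∧
        -- (3') the jump function, its smoothness and its bound
        IsJumpFunction f F ∧
        ContDiffOn ℝ ((p - 1 : ℕ) : WithTop ℕ∞) F (Set.Ioi 1) ∧
        (∀ σ : ℝ, -(1 / 2 : ℝ) ≤ σ →
          Integrable (onLine A σ) ∧
          ∀ x : ℝ, 1 < x → ‖F x‖ ≤ lineNormL1 A σ * x ^ σ) ∧
        -- (4') the interpolation is the Mellin transform of the jump function
        (∀ σ ν : ℝ, -(1 / 2 : ℝ) < σ →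
          IntegrableOn
            (fun x : ℝ => F x * (x : ℂ) ^ (-((σ : ℂ) + (ν : ℂ) * Complex.I) - 1)) (Set.Ioi 1) ∧
          A ((σ : ℂ) + (ν : ℂ) * Complex.I) =
            ∫ x in Set.Ioi (1 : ℝ),
              F x * (x : ℂ) ^ (-((σ : ℂ) + (ν : ℂ) * Complex.I) - 1)) ∧
        -- (5') Plancherel formula for the Mellin transform
        (∀ σ : ℝ, -(1 / 2 : ℝ) ≤ σ →
          Integrable (fun ν : ℝ => ‖onLine A σ ν‖ ^ 2) ∧
          IntegrableOn (fun x : ℝ => ‖F x‖ ^ 2 * x ^ (-2 * σ - 1)) (Set.Ioi 1) ∧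
          ∫ ν : ℝ, ‖onLine A σ ν‖ ^ 2 =
            2 * Real.pi * ∫ x in Set.Ioi (1 : ℝ), ‖F x‖ ^ 2 * x ^ (-2 * σ - 1)) := by
  obtain ⟨v, hv, hJ, hmul, hmom, hsmooth⟩ := exists_density hp ha hf
  have hvi : Integrable v unitVol := hv.integrable (by norm_num)
  have hnat : ∀ n : ℕ, (n : ℂ) ∈ halfPlane := by
    intro n
    change -(1 / 2 : ℝ) < (n : ℂ).re
    rw [Complex.natCast_re]
    linarith [(Nat.cast_nonneg n : (0 : ℝ) ≤ n)]
  have hH := memHardyH2_hardyExtension hJ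
  have hA : ∀ n : ℕ, hardyExtension (hardyAverage v) n = a n := fun n => by
    rw [hardyExtension_of_mem (hnat n), hmom n]
  -- The factor n cancels the 1/n in the Taylor series of the logarithm, so the potential reproduces
  -- every coefficient but a 0, which is added separately.
  have hvmom : ∀ n : ℕ, ∫ t, (t : ℂ) ^ n * v t ∂unitVol = n * a n := by
    intro n
    rw [← hmom n, ← hmul n (hnat n), cutMellin]
    simp_rw [Complex.cpow_natCast]
  have hdiff : DifferentiableOn ℂ (fun z => 1 / (2 * (Real.pi : ℂ)) * (a 0 - logPotential v z))
      ((fun x : ℝ => (x : ℂ)) '' Set.Ici 1)ᶜ := fun z hz =>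
    (((differentiableAt_logPotential hvi hz).const_sub _).const_mul _).differentiableWithinAt
  refine ⟨hardyExtension (hardyAverage v), ⟨hH, hA⟩,
    fun B hB => hH.eqOn_of_nat hB.memHardy fun n => (hB.interpolates n).trans (hA n).symm,
    fun z => 1 / (2 * (Real.pi : ℂ)) * (a 0 - logPotential v z), fun x => tailPrimitive v x⁻¹,
    ?_, ?_, hdiff, ?_, isJumpFunction_logPotential hv _, ?_, ?_, ?_, fun σ hσ => plancherel_tailPrimitive_inv hJ hσ⟩
  · have hsum := summable_norm_of_hausdorffL2_pow_mul hp hf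
    have hu := tendstoUniformlyOn_tsum_nat (f := fun n (z : ℂ) => 1 / (2 * (Real.pi : ℂ)) * (a n * z ^ n))
      (s := Metric.ball 0 1) (hsum.mul_left ‖1 / (2 * (Real.pi : ℂ))‖) (by
        intro n z hz
        rw [mem_ball_zero_iff] at hz
        rw [norm_mul, norm_mul, norm_pow]
        gcongr
        exact mul_le_of_le_one_right (norm_nonneg _) (pow_le_one₀ (norm_nonneg _) hz.le))
    refine (hu.congr (Eventually.of_forall fun N z _ => ?_)).congr_right fun z hz => ?_
    · simp only [Finset.mul_sum]
    · exact ((hasSum_mul_pow_of_moments hvi hvmom (mem_ball_zero_iff.1 hz)).mul_left _).tsum_eq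
  · exact (hdiff.mono fun z hz => notMem_cut_of_norm_lt_one (mem_ball_zero_iff.1 hz)).analyticOnNhd
      Metric.isOpen_ball
  · intro z hz
    refine (continuousAt_const.mul (continuousAt_const.sub ?_)).continuousWithinAt
    by_cases h1 : z = 1
    · rw [h1]
      exact continuousAt_logPotential_one hv
    · refine (differentiableAt_logPotential hvi ?_).continuousAt
      rintro ⟨x, hx, rfl⟩
      refine hz ⟨x, Set.mem_Ioi.2 (lt_of_le_of_ne (Set.mem_Ici.1 hx) fun h => h1 ?_), rfl⟩
      rw [← h]
      exact Complex.ofReal_one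
  · refine hsmooth.comp (contDiffOn_inv ℝ |>.mono fun x hx => ?_) fun x hx => ?_
    · have hx : 1 < x := hx
      exact (by linarith : x ≠ 0)
    · have hx : 1 < x := hx
      exact ⟨inv_pos.2 (by linarith), inv_lt_one_of_one_lt₀ hx⟩
  · intro σ hσ
    have hint := integrable_onLine_hardyExtension hJ hv hmul hσ
    exact ⟨hint, fun x hx => norm_tailPrimitive_inv_le hvi hJ hσ hint hx⟩
  · intro σ ν hσ
    have hz : (σ : ℂ) + (ν : ℂ) * Complex.I ∈ halfPlane := by
      change -(1 / 2 : ℝ) < ((σ : ℂ) + (ν : ℂ) * Complex.I).re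
      simpa using hσ
    rw [hardyExtension_of_mem hz]
    exact mellin_tailPrimitive_inv hJ hz
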